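/- Let $n\ge 1$, $I=[0,1]$, and let $m$ be Lebesgue measure on $I^n$. *Bounded variation.* For $g:I^n\to\mathbb R$ let $\mathbf V_i g$ be the function of $(x_j)_{j\ne i}\in I^{n-1}$ whose value is the total variation of $t\mapsto g(x_1,\dots,x_{i-1},t,x_{i+1},\dots,x_n)$ on $[0,1]$. For $h\in L^1(I^n)$ let $\mathbb V_i h=\inf\int_{I^{n-1}}\mathbf V_i g\,dm$, the infimum being over all $g=h$ a.e. such that $\mathbf V_i g$ is measurable; let $\mathbb V h=\max_i\mathbb V_i h$, $BV(I^n)=\{h\in L^1(I^n):\mathbb V h<\infty\}$ and $\|h\|_{BV}=\|h\|_1+\mathbb V h$. *Setting.* Let $\Omega$ be a Polish space with its Borel $\sigma$-algebra and a probability measure $\mathbb P$, and let $\sigma:\Omega\to\Omega$ be invertible, measure preserving and ergodic. For each $\omega\in\Omega$ let $f_\omega:I^n\to I^n$ be nonsingular, and let $\mathcal L_\omega:L^1(I^n)\to L^1(I^n)$ be its transfer operator, i.e. $\int_A\mathcal L_\omega h\,dm=\int_{f_\omega^{-1}A}h\,dm$ for all $h\in L^1(I^n)$ and all Borel sets $A$.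 Assume that $\{f_\omega\}$ is an admissible random Jabłoński map, that is: (a) there are subdivisions $0=a_{i,0}<a_{i,1}<\dots<a_{i,r_i}=1$ ($i=1,\dots,n$), independent of $\omega$, such that for each $\vec s=(s_1,\dots,s_n)$ with $1\le s_i\le r_i$ one has $f_\omega(x)=(\varphi_{\omega,1,\vec s}(x_1),\dots,\varphi_{\omega,n,\vec s}(x_n))$ for $x\in\prod_i B_{s_i}$, where $B_{s_i}=[a_{i,s_i-1},a_{i,s_i})$ if $s_i<r_i$ and $B_{r_i}=[a_{i,r_i-1},1]$, and each $\varphi_{\omega,i,\vec s}:[a_{i,s_i-1},a_{i,s_i}]\to[0,1]$ is $C^2$ and monotonic; (b) with $\gamma_i(\omega)=\inf\{|\varphi_{\omega,i,\vec s}'(t)|:\vec s,\ t\in[a_{i,s_i-1},a_{i,s_i}]\}$, there is a constant $\gamma>0$ with $\int_\Omega\min_i\log\gamma_i(\omega)\,d\mathbb P(\omega)>\gamma$ (with $\log 0=-\infty$); (c) $\omega\mapsto\mathcal L_\omega$ is $\mathbb P$-continuous: $\Omega$ is a countable union of Borel sets on each of which this map is continuous for the operator norm on $BV(I^n)$. Assume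 moreover that $\int_\Omega\log^+\|\mathcal L_\omega\|_{BV}\,d\mathbb P(\omega)<\infty$, where $\|\mathcal L_\omega\|_{BV}$ is the operator norm on $BV(I^n)$. For $\omega\in\Omega$ and $k,s\ge1$ put $h^k_\omega=(\mathcal L_{\sigma^{-1}\omega}\circ\mathcal L_{\sigma^{-2}\omega}\circ\dots\circ\mathcal L_{\sigma^{-k}\omega})1$ and $H^s_\omega=\frac1s\sum_{k=1}^s h^k_\omega$. *Conclusion.* For $\mathbb P$-a.e. $\omega$: (i) $\{H^s_\omega\}_{s\ge1}$ is relatively compact in $L^1(I^n)$; (ii) $H^s_\omega$ converges in $L^1(I^n)$, as $s\to\infty$, to some $h_\omega\in BV(I^n)$. Moreover $\{h_\omega\}_{\omega\in\Omega}$ (defined suitably on the exceptional null set) is a family of random invariant densities: $h_\omega\ge0$ and $\|h_\omega\|_1=1$ for all $\omega$, the map $\omega\mapsto h_\omega\in L^1(I^n)$ is measurable, and $\mathcal L_\omega h_\omega=h_{\sigma\omega}$ for $\mathbb P$-a.e. $\omega$. -/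

import Mathlib

open MeasureTheory Filter Topology
open scoped ENNReal

namespace RandomJablonski

noncomputable section

/-- The cube `[0,1]^(n+1)`, with product Lebesgue (probability) measure `volume`.
The dimension is written `n + 1`, so that it runs over the positive integers. -/
abbrev Cube (n : ℕ) : Type := Fin (n + 1) → unitInterval

/-- The Banach space `L¹` of the cube. -/
abbrev L1 (n : ℕ) : Type := Lp ℝ 1 (volume : Measure (Cube n))

/-! ### Variation in the sense of Tonelli and Cesari -/

/-- The variation of `g` along the line parallel to the `i`-th axis whose other coordinates
are `y`, as a function of `y`. -/
def lineVariation {n : ℕ} (i : Fin (n + 1)) (g : Cube n → ℝ) (y : Fin n → unitInterval) : ℝ≥0∞ :=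
  eVariationOn (fun t : unitInterval => g (i.insertNth t y : Fin (n + 1) → unitInterval)) Set.univ

/-- The variation of `h` in the `i`-th direction: the infimum of the integrated line variations
over all representatives of `h` whose line variation is (Lebesgue) measurable. -/
def dirVariation {n : ℕ} (i : Fin (n + 1)) (h : L1 n) : ℝ≥0∞ :=
  ⨅ (g : Cube n → ℝ) (_ : g =ᵐ[volume] h) (_ : AEMeasurable (lineVariation i g) volume),
    ∫⁻ y, lineVariation i g y

/-- The total variation: the largest of the directional variations. -/
def totalVariation {n : ℕ} (h : L1 n) : ℝ≥0∞ :=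
  ⨆ i : Fin (n + 1), dirVariation i h

/-- Membership in `BV`. -/
def IsBV {n : ℕ} (h : L1 n) : Prop := totalVariation h < ∞

/-- The `BV` norm `‖h‖₁ + V(h)`, with the value `∞` off `BV`. -/
def bvNorm {n : ℕ} (h : L1 n) : ℝ≥0∞ := ‖h‖ₑ + totalVariation h

/-- The operator norm on `BV` of a linear map `T`, with the value `∞` if `T` is not bounded
on `BV`. -/
def bvOpNorm {n : ℕ} (T : L1 n → L1 n) : ℝ≥0∞ :=
  ⨆ (h : L1 n) (_ : bvNorm h ≤ 1), bvNorm (T h)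

/-! ### Transfer operators -/

/-- `f` is nonsingular: measurable, and preimages of Lebesgue null sets are null. -/
def Nonsingular {n : ℕ} (f : Cube n → Cube n) : Prop :=
  Measure.QuasiMeasurePreserving f volume volume

/-- The transfer (Perron-Frobenius) operator of `f`: the density of the push-forward under `f`
of the signed measure with density `h`. -/
def transfer {n : ℕ} (f : Cube n → Cube n) (h : L1 n) : L1 n :=
  (SignedMeasure.integrable_rnDeriv
    (((volume : Measure (Cube n)).withDensityᵥ h).map f) volume).toL1 _

/-- The duality relation that characterizes the transfer operator of a nonsingular map. -/
theorem setIntegral_transfer {n : ℕ} {f : Cube n → Cube n} (hf : Nonsingular f) (h : L1 n)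
    {A : Set (Cube n)} (hA : MeasurableSet A) :
    ∫ x in A, transfer f h x = ∫ x in f ⁻¹' A, h x := by
  set s : SignedMeasure (Cube n) := ((volume : Measure (Cube n)).withDensityᵥ h).map f with hs
  have hint : Integrable (h : Cube n → ℝ) volume := L1.integrable_coeFn h
  have hac : VectorMeasure.AbsolutelyContinuous s
      (volume : Measure (Cube n)).toENNRealVectorMeasure := by
    refine VectorMeasure.AbsolutelyContinuous.mk fun B hB h0 => ?_
    rw [Measure.toENNRealVectorMeasure_apply_measurable hB] at h0
    rw [hs, VectorMeasure.map_apply _ hf.measurable hB,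
      withDensityᵥ_apply hint (hf.measurable hB)]
    exact setIntegral_measure_zero _ (hf.preimage_null h0)
  have hd := (SignedMeasure.absolutelyContinuous_iff_withDensityᵥ_rnDeriv_eq s volume).1 hac
  have h1 : ∫ x in A, transfer f h x = ∫ x in A, s.rnDeriv volume x :=
    setIntegral_congr_ae hA ((Integrable.coeFn_toL1 _).mono fun x hx _ => hx)
  rw [h1, ← withDensityᵥ_apply (SignedMeasure.integrable_rnDeriv s volume) hA, hd, hs,
    VectorMeasure.map_apply _ hf.measurable hA, withDensityᵥ_apply hint (hf.measurable hA)]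

/-! ### Jablonski maps on a rectangular grid -/

/-- A rectangular grid on the cube: in each direction `i` a subdivision
`0 = a i 0 < a i 1 < ... < a i (r i) = 1`. -/
structure Grid (n : ℕ) where
  r : Fin (n + 1) → ℕ
  a : ∀ i, Fin (r i + 1) → ℝ
  strictMono : ∀ i, StrictMono (a i)
  first : ∀ i, a i 0 = 0
  last : ∀ i, a i (Fin.last (r i)) = 1

namespace Grid

variable {n : ℕ} (G : Grid n)

/-- Labels of the rectangles of the grid. -/
abbrev Index : Type := ∀ i, Fin (G.r i)

/-- The closed `i`-th side of the rectangle with label `s`. -/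
def side (s : G.Index) (i : Fin (n + 1)) : Set ℝ :=
  Set.Icc (G.a i (s i).castSucc) (G.a i (s i).succ)

/-- The rectangle with label `s`: each side is closed on the left and open on the right, except
that the last subinterval in each direction also contains its right end point `1`. -/
def cell (s : G.Index) : Set (Cube n) :=
  {x | ∀ i, G.a i (s i).castSucc ≤ (x i : ℝ) ∧
    ((x i : ℝ) < G.a i (s i).succ ∨ ((s i).succ = Fin.last (G.r i) ∧ (x i : ℝ) = 1))}

end Grid

/-- `f` is a Jablonski map, piecewise defined on the grid `G` with components `φ i s`, that are
`C²` and monotonic on the closed sides of the rectangles and take values in `[0,1]` there. -/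
structure IsJablonski {n : ℕ} (G : Grid n) (φ : Fin (n + 1) → G.Index → ℝ → ℝ)
    (f : Cube n → Cube n) : Prop where
  eq_component : ∀ s, ∀ x ∈ G.cell s, ∀ i, (f x i : ℝ) = φ i s (x i)
  mapsTo : ∀ i s, Set.MapsTo (φ i s) (G.side s i) (Set.Icc 0 1)
  contDiff : ∀ i s, ContDiffOn ℝ 2 (φ i s) (G.side s i)
  monotonic : ∀ i s, MonotoneOn (φ i s) (G.side s i) ∨ AntitoneOn (φ i s) (G.side s i)

/-- The minimal expansion in direction `i`: the infimum of `|φ i s '|` over all rectangles `s`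
and all points of the closed `i`-th side of `s`. -/
def minExpansion {n : ℕ} (G : Grid n) (φ : Fin (n + 1) → G.Index → ℝ → ℝ)
    (i : Fin (n + 1)) : ℝ :=
  sInf {c : ℝ | ∃ s : G.Index, ∃ t ∈ G.side s i, c = |derivWithin (φ i s) (G.side s i) t|}

/-! ### Admissible random Jablonski maps -/

/-- `ω ↦ T ω` is `P`-continuous: `Ω` is a countable union of Borel sets on each of which the map
is continuous for the operator norm of `BV`. -/
def PContinuous {Ω : Type*} [TopologicalSpace Ω] [MeasurableSpace Ω] {n : ℕ}
    (T : Ω → L1 n → L1 n) : Prop :=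
  ∃ A : ℕ → Set Ω, (∀ k, MeasurableSet (A k)) ∧ ⋃ k, A k = Set.univ ∧
    ∀ k, ∀ ω ∈ A k, Tendsto (fun ω' => bvOpNorm (T ω' - T ω)) (𝓝[A k] ω) (𝓝 0)

/-- Admissible random Jablonski maps: nonsingular maps `f ω` that are `C²` and monotonic Jablonski
maps on a common grid, expanding on average, with `P`-continuous transfer operators.
The a.e. positivity of the `minExpansion`s and the integrability of the minimum of their
logarithms say that the integral of this minimum, with `log 0 = -∞`, is defined and finite. -/
structure IsAdmissible {Ω : Type*} [TopologicalSpace Ω] [MeasurableSpace Ω] (P : Measure Ω)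
    {n : ℕ} (f : Ω → Cube n → Cube n) : Prop where
  nonsingular : ∀ ω, Nonsingular (f ω)
  expanding : ∃ (G : Grid n) (φ : Ω → Fin (n + 1) → G.Index → ℝ → ℝ) (γ : ℝ),
    (∀ ω, IsJablonski G (φ ω) (f ω)) ∧
    0 < γ ∧
    (∀ᵐ ω ∂P, ∀ i, 0 < minExpansion G (φ ω) i) ∧
    Integrable (fun ω => ⨅ i, Real.log (minExpansion G (φ ω) i)) P ∧
    γ < ∫ ω, ⨅ i, Real.log (minExpansion G (φ ω) i) ∂P
  pContinuous : PContinuous fun ω => transfer (f ω)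

/-- Integrability of `log⁺` of the operator norm on `BV` of the transfer operators
(`ENNReal.log` is the extended logarithm and `EReal.toENNReal` the positive part). -/
def LogIntegrable {Ω : Type*} [MeasurableSpace Ω] (P : Measure Ω)
    {n : ℕ} (f : Ω → Cube n → Cube n) : Prop :=
  ∫⁻ ω, (ENNReal.log (bvOpNorm (transfer (f ω)))).toENNReal ∂P < ∞

/-! ### Pulled-back iterates and random invariant densities -/

/-- `L_{σ⁻¹ω} ∘ L_{σ⁻²ω} ∘ ... ∘ L_{σ⁻ᵏω}` applied to the constant function `1`. -/
def pullback {Ω : Type*} [MeasurableSpace Ω] (σ : Ω ≃ᵐ Ω) {n : ℕ} (f : Ω → Cube n → Cube n) :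
    ℕ → Ω → L1 n
  | 0, _ => Lp.const 1 volume (1 : ℝ)
  | k + 1, ω => transfer (f (σ.symm ω)) (pullback σ f k (σ.symm ω))

/-- The averages `H^s_ω = (1/s) ∑_{k=1}^s h^k_ω` of the pulled-back iterates. -/
def cesaro {Ω : Type*} [MeasurableSpace Ω] (σ : Ω ≃ᵐ Ω) {n : ℕ} (f : Ω → Cube n → Cube n)
    (s : ℕ) (ω : Ω) : L1 n :=
  (s : ℝ)⁻¹ • ∑ k ∈ Finset.Icc 1 s, pullback σ f k ω

/-- A family of random invariant densities. As `L1 n` is separable, `StronglyMeasurable` is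
Borel measurability. -/
structure IsRandomInvariantDensity {Ω : Type*} [MeasurableSpace Ω] (P : Measure Ω) (σ : Ω ≃ᵐ Ω)
    {n : ℕ} (f : Ω → Cube n → Cube n) (h : Ω → L1 n) : Prop where
  nonneg : ∀ ω, 0 ≤ h ω
  norm_eq_one : ∀ ω, ‖h ω‖ = 1
  measurable : StronglyMeasurable h
  equivariant : ∀ᵐ ω ∂P, transfer (f ω) (h ω) = h (σ ω)

end

end RandomJablonski

namespace RandomJablonski

noncomputable section

/-! The averages `cesaro σ f s ω` are averages of the iterates of the constant function 1 under the
skew action F ↦ (ω ↦ L_{σ⁻¹ω} F(σ⁻¹ω)) on L¹-valued functions of ω. For a.e. ω these iterates stay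
in a compact convex subset of L¹. Together with the contractivity of the transfer operators on L¹,
this forces pointwise convergence of the averages.

Compactness. The variation in direction i is the supremum of ∫ hθ over test functions θ, which are
derivatives in direction i of functions bounded by 1 that vanish at both ends of every line
(`dirVariation_eq_testVar`). Hence it is lower semicontinuous on L¹. Replacing a bounded function by
its averages over grid cells shows that the sets of norm at most 1 and bounded variation are totally
bounded; being closed, they are compact (`isCompact_bvBall`).

Bounded variation of the iterates. Duality also gives a Lasota-Yorke inequality V_i(Lh) ≤ (8/γ_i)
V_i(h) + K‖h‖ for one piecewise expanding product map
(`ExpandingBranches.exists_testVar_transfer_le`). Its factor 8 does not depend on the map, so for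
compositions of N maps the coefficient is 8 exp(-S_N g), where g is the logarithm of the least
expansion and S_N g its Birkhoff sum; this contracts on average once N is large. The constant K of
the composition depends on ω without any integrability. Outside a set of small measure it is
bounded, and on that set the operator norm on BV is used instead, whose log⁺ is integrable.
Iterating into the past bounds the variation of every iterate by one series that converges a.e.
(`ae_exists_bound_of_recursion`).

Convergence. L¹ is embedded injectively into ℓ². In L²(Ω; ℓ²), near-minimal convex combinations F_j
of long averages form a Cauchy sequence by the parallelogram law. Pointwise compactness lifts a.e.
convergence of their images back to L¹, and the limit h is invariant because long averages almost
are. For fixed j, the averages of the iterates of 1 and of F_j differ by O(1/s), and the latter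
differ from h by at most a Birkhoff average of ‖F_j - h‖, whose integral tends to 0 with j
(`exists_ae_tendsto_average`). Throughout, only an upper bound for Birkhoff sums is needed. The
limit inherits positivity, norm one and bounded variation because these conditions are closed and
convex. -/

/-! ### An ergodic upper bound for Birkhoff sums -/

/-- Running maxima of the Birkhoff sums `S₁, …, Sₖ₊₁` of `g`, defined recursively. -/
def birkhoffMax {Ω : Type*} (T : Ω → Ω) (g : Ω → ℝ) : ℕ → Ω → ℝ
  | 0, ω => g ω
  | k + 1, ω => g ω + max 0 (birkhoffMax T g k (T ω))

theorem le_birkhoffMax {Ω : Type*} (T : Ω → Ω) (g : Ω → ℝ) (k : ℕ) (ω : Ω) :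
    g ω ≤ birkhoffMax T g k ω := by
  cases k with
  | zero => exact le_rfl
  | succ k => simp [birkhoffMax]

theorem birkhoffMax_mono {Ω : Type*} (T : Ω → Ω) (g : Ω → ℝ) (ω : Ω) :
    Monotone fun k => birkhoffMax T g k ω := by
  refine monotone_nat_of_le_succ fun k => ?_
  induction k generalizing ω with
  | zero => exact le_birkhoffMax T g 1 ω
  | succ k ih =>
    simp only [birkhoffMax]
    have := ih (T ω)
    gcongr
    exact this

theorem birkhoffSum_le_birkhoffMax {Ω : Type*} (T : Ω → Ω) (g : Ω → ℝ) (k : ℕ) (ω : Ω) :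
    birkhoffSum T g (k + 1) ω ≤ birkhoffMax T g k ω := by
  induction k generalizing ω with
  | zero => simp [birkhoffMax]
  | succ k ih =>
    rw [birkhoffSum_succ']
    simp only [birkhoffMax]
    have := (ih (T ω)).trans (le_max_right 0 _)
    gcongr

theorem integrable_birkhoffMax {Ω : Type*} [MeasurableSpace Ω] {P : Measure Ω} {T : Ω → Ω}
    (hT : MeasurePreserving T P P) {g : Ω → ℝ} (hg : Integrable g P) (k : ℕ) :
    Integrable (birkhoffMax T g k) P := by
  induction k with
  | zero => exact hg
  | succ k ih =>
    have h1 : Integrable (fun ω => birkhoffMax T g k (T ω)) P := hT.integrable_comp_of_integrable ih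
    exact hg.add ((integrable_zero _ _ _).sup h1)

theorem integral_comp_eq_of_measurePreserving {Ω : Type*} [MeasurableSpace Ω] {P : Measure Ω}
    {T : Ω → Ω} (hT : MeasurePreserving T P P) {g : Ω → ℝ} (hg : AEStronglyMeasurable g P) :
    ∫ ω, g (T ω) ∂P = ∫ ω, g ω ∂P := by
  have h := integral_map (μ := P) hT.measurable.aemeasurable (f := g) (by rwa [hT.map_eq])
  rw [← h, hT.map_eq]

/-- The set where the sums are unbounded is invariant, hence null or of full measure. If it had full
measure, `birkhoffMax T g k (T ω)` would tend to infinity a.e., and `birkhoffMax T g (k + 1) ω -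
birkhoffMax T g k (T ω)` would tend to `g ω` boundedly by an integrable function. The integrals of
these differences are nonnegative, because the maxima increase with k and T preserves P, so the
integral of g would be nonnegative. -/
theorem ae_bddAbove_birkhoffSum {Ω : Type*} [MeasurableSpace Ω] {P : Measure Ω}
    [IsProbabilityMeasure P] {T : Ω → Ω} (hT : Ergodic T P) {g : Ω → ℝ} (hg : Integrable g P)
    (hneg : ∫ ω, g ω ∂P < 0) :
    ∀ᵐ ω ∂P, BddAbove (Set.range fun k => birkhoffSum T g k ω) := by
  have hmp := hT.toMeasurePreserving
  have hS : ∀ k, AEMeasurable (birkhoffSum T g k) P := by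
    intro k
    unfold birkhoffSum
    exact Finset.aemeasurable_fun_sum _ fun j _ =>
      hg.aemeasurable.comp_quasiMeasurePreserving (hmp.iterate j).quasiMeasurePreserving
  set E : Set Ω := {ω | ¬ BddAbove (Set.range fun k => birkhoffSum T g k ω)} with hE
  have hEeq : E = ⋂ N : ℕ, ⋃ k, {ω | (N : ℝ) < birkhoffSum T g k ω} := by
    ext ω
    simp only [hE, Set.mem_ofPred_eq, not_bddAbove_iff, Set.exists_range_iff, Set.mem_iInter,
      Set.mem_iUnion]
    refine ⟨fun h N => h N, fun h x => ?_⟩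
    obtain ⟨N, hN⟩ := exists_nat_gt x
    obtain ⟨k, hk⟩ := h N
    exact ⟨k, hN.trans hk⟩
  have hEmeas : NullMeasurableSet E P := by
    rw [hEeq]
    exact NullMeasurableSet.iInter fun N => NullMeasurableSet.iUnion fun k =>
      nullMeasurableSet_lt aemeasurable_const (hS k)
  have hEinv : T ⁻¹' E = E := by
    ext ω
    simp only [hE, Set.mem_preimage, Set.mem_ofPred_eq, not_iff_not]
    constructor
    · rintro ⟨C, hC⟩
      refine ⟨max 0 (g ω + C), ?_⟩
      rintro _ ⟨k, rfl⟩
      cases k with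
      | zero => simp
      | succ k =>
        simp only [birkhoffSum_succ']
        have := hC ⟨k, rfl⟩
        exact le_max_of_le_right (by simpa using this)
    · rintro ⟨C, hC⟩
      refine ⟨C - g ω, ?_⟩
      rintro _ ⟨k, rfl⟩
      have := hC ⟨k + 1, rfl⟩
      simp only [birkhoffSum_succ'] at this
      simpa using by linarith
  rcases hT.quasiErgodic.ae_empty_or_univ₀ hEmeas (by rw [hEinv]; exact ae_eq_refl _) with h | h
  · have := h.mem_iff
    filter_upwards [this] with ω hω
    by_contra hcon
    exact (hω.1 hcon).elim
  · exfalso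
    have hbig : ∀ᵐ ω ∂P, Tendsto (fun k => birkhoffMax T g k (T ω)) atTop atTop := by
      filter_upwards [h.mem_iff] with ω hω
      have hω' : T ω ∈ E := by
        have : ω ∈ T ⁻¹' E := by rw [hEinv]; exact hω.2 trivial
        exact this
      refine tendsto_atTop_atTop_of_monotone (birkhoffMax_mono T g (T ω)) fun b => ?_
      obtain ⟨_, ⟨k, rfl⟩, hk⟩ := not_bddAbove_iff.1 hω' (max b 0)
      cases k with
      | zero => simp at hk
      | succ k =>
        exact ⟨k, ((le_max_left b 0).trans hk.le).trans (birkhoffSum_le_birkhoffMax T g k _)⟩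
    have hlim : Tendsto (fun k => ∫ ω, (birkhoffMax T g (k + 1) ω - birkhoffMax T g k (T ω)) ∂P)
        atTop (𝓝 (∫ ω, g ω ∂P)) := by
      have hgT : Integrable (fun ω => g (T ω)) P := hmp.integrable_comp_of_integrable hg
      refine tendsto_integral_of_dominated_convergence (fun ω => |g ω| + |g (T ω)|)
        (fun k => ?_) (hg.abs.add hgT.abs) (fun k => ?_) ?_
      · exact ((integrable_birkhoffMax hmp hg (k + 1)).sub
          (hmp.integrable_comp_of_integrable (integrable_birkhoffMax hmp hg k))).1
      · refine Eventually.of_forall fun ω => ?_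
        have h1 := le_birkhoffMax T g k (T ω)
        simp only [birkhoffMax, Real.norm_eq_abs]
        rcases le_total 0 (birkhoffMax T g k (T ω)) with h2 | h2
        · rw [max_eq_right h2]; simp
        · rw [max_eq_left h2]
          have h3 : |birkhoffMax T g k (T ω)| ≤ |g (T ω)| := by
            rw [abs_of_nonpos h2, abs_of_nonpos (h1.trans h2)]; linarith
          calc _ ≤ |g ω + 0| + |birkhoffMax T g k (T ω)| := abs_sub _ _
            _ ≤ _ := by rw [add_zero]; gcongr
      · filter_upwards [hbig] with ω hω
        refine tendsto_const_nhds.congr' ?_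
        filter_upwards [hω.eventually_ge_atTop 0] with k hk
        simp [birkhoffMax, max_eq_right hk]
    have hnn : ∀ k, 0 ≤ ∫ ω, (birkhoffMax T g (k + 1) ω - birkhoffMax T g k (T ω)) ∂P := by
      intro k
      have hk := integrable_birkhoffMax hmp hg k
      have hkT : Integrable (fun ω => birkhoffMax T g k (T ω)) P :=
        hmp.integrable_comp_of_integrable hk
      rw [integral_sub (integrable_birkhoffMax hmp hg (k + 1)) hkT, sub_nonneg,
        integral_comp_eq_of_measurePreserving hmp hk.1]
      exact integral_mono hk (integrable_birkhoffMax hmp hg (k + 1))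
        fun ω => birkhoffMax_mono T g ω (Nat.le_succ k)
    exact absurd (ge_of_tendsto' hlim hnn) (not_le.2 hneg)

/-- The half of Birkhoff's theorem that is needed. With d strictly between the mean and c, the sums
of g - d are bounded above, and k (c - d) eventually exceeds the bound. -/
theorem ae_eventually_birkhoffSum_le {Ω : Type*} [MeasurableSpace Ω] {P : Measure Ω}
    [IsProbabilityMeasure P] {T : Ω → Ω} (hT : Ergodic T P) {g : Ω → ℝ} (hg : Integrable g P)
    {c : ℝ} (hc : ∫ ω, g ω ∂P < c) :
    ∀ᵐ ω ∂P, ∀ᶠ k : ℕ in atTop, birkhoffSum T g k ω ≤ k * c := by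
  set d : ℝ := (∫ ω, g ω ∂P + c) / 2 with hd
  have h1 : Integrable (fun ω => g ω - d) P := hg.sub (integrable_const d)
  have h2 : ∫ ω, (g ω - d) ∂P < 0 := by
    rw [integral_sub hg (integrable_const d)]
    simp
    linarith
  filter_upwards [ae_bddAbove_birkhoffSum hT h1 h2] with ω ⟨C, hC⟩
  have hcd : 0 < c - d := by linarith
  filter_upwards [(tendsto_natCast_atTop_atTop (R := ℝ)).eventually_ge_atTop (C / (c - d))]
    with k hk
  have h3 : birkhoffSum T (fun ω => g ω - d) k ω ≤ C := hC ⟨k, rfl⟩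
  have h4 : birkhoffSum T (fun ω => g ω - d) k ω = birkhoffSum T g k ω - k * d := by
    simp [birkhoffSum, Finset.sum_sub_distrib]
  rw [div_le_iff₀ hcd] at hk
  linarith

/-! ### Strongly convergent convex combinations -/

/-- Near-minimal elements of a decreasing sequence of convex sets form a Cauchy sequence. -/
theorem exists_cauchySeq_of_antitone_convex {X H : Type*} [AddCommGroup X] [Module ℝ X]
    [NormedAddCommGroup H] [InnerProductSpace ℝ H] (W : X →ₗ[ℝ] H) {K : ℕ → Set X}
    (hK : Antitone K) (hc : ∀ j, Convex ℝ (K j)) (hne : ∀ j, (K j).Nonempty) {R : ℝ}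
    (hR : ∀ w ∈ K 0, ‖W w‖ ≤ R) :
    ∃ w : ℕ → X, (∀ j, w j ∈ K j) ∧ CauchySeq fun j => W (w j) := by
  set d : ℕ → ℝ := fun j => sInf ((fun w => ‖W w‖ ^ 2) '' K j) with hd
  have hbdd : ∀ j, BddBelow ((fun w => ‖W w‖ ^ 2) '' K j) := fun j =>
    ⟨0, by rintro _ ⟨w, -, rfl⟩; positivity⟩
  have hdle : ∀ j, ∀ w ∈ K j, d j ≤ ‖W w‖ ^ 2 := fun j w hw => csInf_le (hbdd j) ⟨w, hw, rfl⟩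
  have hdmono : Monotone d := fun i j hij =>
    csInf_le_csInf (hbdd i) ((hne j).image _) (Set.image_mono (hK hij))
  have hdbdd : BddAbove (Set.range d) := by
    refine ⟨R ^ 2, ?_⟩
    rintro _ ⟨j, rfl⟩
    obtain ⟨w, hw⟩ := hne j
    exact (hdle j w hw).trans (by
      have := hR w (hK (Nat.zero_le j) hw)
      gcongr)
  set D : ℝ := ⨆ j, d j with hD
  have hdD : Tendsto d atTop (𝓝 D) := tendsto_atTop_ciSup hdmono hdbdd
  have hex : ∀ j, ∃ w ∈ K j, ‖W w‖ ^ 2 < d j + 1 / ((j : ℝ) + 1) := by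
    intro j
    obtain ⟨_, ⟨w, hw, rfl⟩, h⟩ := exists_lt_of_csInf_lt ((hne j).image fun w => ‖W w‖ ^ 2)
      (show d j < d j + 1 / ((j : ℝ) + 1) by
        have : (0 : ℝ) < 1 / ((j : ℝ) + 1) := by positivity
        linarith)
    exact ⟨w, hw, h⟩
  choose w hw hwd using hex
  refine ⟨w, hw, ?_⟩
  -- Under the root is the bound from the parallelogram law: twice the two squared norms, each at
  -- most D + 1/(N + 1), minus four times the squared norm of the midpoint, which is at least `d N`
  -- because `K N` is convex.
  have hb : Tendsto (fun N : ℕ => √(4 * (D - d N) + 4 * (1 / ((N : ℝ) + 1)))) atTop (𝓝 0) := by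
    have h1 : Tendsto (fun N : ℕ => 4 * (D - d N) + 4 * (1 / ((N : ℝ) + 1))) atTop
        (𝓝 (4 * (D - D) + 4 * 0)) :=
      ((hdD.const_sub D).const_mul 4).add (tendsto_one_div_add_atTop_nhds_zero_nat.const_mul 4)
    have h2 := h1.sqrt
    simpa using h2
  refine cauchySeq_of_le_tendsto_0 _ (fun i j N hi hj => ?_) hb
  rw [dist_eq_norm]
  refine Real.le_sqrt_of_sq_le ?_
  have hmid : (1 / 2 : ℝ) • w i + (1 / 2 : ℝ) • w j ∈ K N :=
    hc N (hK hi (hw i)) (hK hj (hw j)) (by norm_num) (by norm_num) (by norm_num)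
  have h1 := hdle N _ hmid
  have h2 : W ((1 / 2 : ℝ) • w i + (1 / 2 : ℝ) • w j) = (1 / 2 : ℝ) • (W (w i) + W (w j)) := by
    simp [smul_add]
  rw [h2, norm_smul, mul_pow] at h1
  have h3 := parallelogram_law_with_norm ℝ (W (w i)) (W (w j))
  have h4 : d i ≤ D := le_ciSup hdbdd i
  have h5 : d j ≤ D := le_ciSup hdbdd j
  have h6 : 1 / ((i : ℝ) + 1) ≤ 1 / ((N : ℝ) + 1) := by gcongr
  have h7 : 1 / ((j : ℝ) + 1) ≤ 1 / ((N : ℝ) + 1) := by gcongr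
  have h8 := hwd i
  have h9 := hwd j
  norm_num at h1
  nlinarith

/-- A separable Banach space embeds continuously and linearly into `ℓ²`. -/
theorem exists_injective_clm_l2 (E : Type*) [NormedAddCommGroup E] [NormedSpace ℝ E]
    [TopologicalSpace.SeparableSpace E] :
    ∃ J : E →L[ℝ] lp (fun _ : ℕ => ℝ) 2, Function.Injective J := by
  have hdense := TopologicalSpace.denseRange_denseSeq E
  set x := TopologicalSpace.denseSeq E
  -- Norming functionals of a dense sequence; the weights (1/2)^m put their values into ℓ².
  choose e he1 he2 using fun m => exists_dual_vector'' ℝ (x m)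
  have hle : ∀ m y, |e m y| ≤ ‖y‖ := fun m y => by
    have := (e m).le_of_opNorm_le (he1 m) y
    simpa using this
  have hgeo : Summable fun m : ℕ => ((1 / 4 : ℝ)) ^ m :=
    summable_geometric_of_lt_one (by norm_num) (by norm_num)
  have hterm : ∀ y (m : ℕ), ‖(1 / 2 : ℝ) ^ m * e m y‖ ^ (2 : ℝ≥0∞).toReal ≤
      (1 / 4 : ℝ) ^ m * ‖y‖ ^ 2 := by
    intro y m
    have h1 : (2 : ℝ≥0∞).toReal = ((2 : ℕ) : ℝ) := by simp
    rw [h1, Real.rpow_natCast, norm_mul, mul_pow, Real.norm_eq_abs, Real.norm_eq_abs, abs_pow,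
      ← pow_mul, mul_comm m 2, pow_mul]
    have h2 := hle m y
    have h3 : |(1 / 2 : ℝ)| ^ 2 = 1 / 4 := by norm_num
    rw [h3]
    gcongr
  have hmem : ∀ y, Memℓp (fun m : ℕ => (1 / 2 : ℝ) ^ m * e m y) 2 := fun y =>
    memℓp_gen (Summable.of_nonneg_of_le (fun m => by positivity) (hterm y) (hgeo.mul_right _))
  let J₀ : E →ₗ[ℝ] lp (fun _ : ℕ => ℝ) 2 :=
    { toFun := fun y => ⟨fun m : ℕ => (1 / 2 : ℝ) ^ m * e m y, hmem y⟩
      map_add' := fun y z => by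
        apply lp.ext
        funext m
        exact (congrArg ((1 / 2 : ℝ) ^ m * ·) (map_add (e m) y z)).trans (mul_add _ _ _)
      map_smul' := fun c y => by
        apply lp.ext
        funext m
        simp
        ring }
  -- The geometric series gives ‖J₀ y‖² ≤ (4/3) ‖y‖², so 2 bounds the norm.
  refine ⟨J₀.mkContinuous 2 fun y => ?_, fun y z hyz => ?_⟩
  · have h0 : (0 : ℝ) < (2 : ℝ≥0∞).toReal := by simp
    have h1 := lp.norm_rpow_eq_tsum h0 (J₀ y)
    have h2 : ∑' m, ‖J₀ y m‖ ^ (2 : ℝ≥0∞).toReal ≤ ∑' m : ℕ, (1 / 4 : ℝ) ^ m * ‖y‖ ^ 2 :=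
      Summable.tsum_le_tsum (hterm y) ((memℓp_gen_iff h0).1 (hmem y)) (hgeo.mul_right _)
    rw [← h1, tsum_mul_right, tsum_geometric_of_lt_one (by norm_num) (by norm_num)] at h2
    have h3 : (2 : ℝ≥0∞).toReal = ((2 : ℕ) : ℝ) := by simp
    rw [h3, Real.rpow_natCast] at h2
    refine le_of_sq_le_sq ?_ (by positivity)
    norm_num at h2
    nlinarith [sq_nonneg ‖y‖]
  · have hall : ∀ m, e m (y - z) = 0 := by
      intro m
      have h1 : (J₀ y : ℕ → ℝ) m = (J₀ z : ℕ → ℝ) m := by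
        have : J₀ y = J₀ z := hyz
        rw [this]
      have h2 : (1 / 2 : ℝ) ^ m * e m y = (1 / 2 : ℝ) ^ m * e m z := h1
      have h3 : e m y = e m z := mul_left_cancel₀ (by positivity) h2
      rw [map_sub, h3, sub_self]
    -- All functionals vanish on y - z. If x m is closer than ‖y - z‖/2 to y - z, then ‖x m‖ = |e m
    -- (y - z - x m)| is also less than ‖y - z‖/2, against the triangle inequality.
    by_contra hne
    have hpos : 0 < ‖y - z‖ := norm_pos_iff.2 (sub_ne_zero.2 hne)
    obtain ⟨m, hm⟩ := hdense.exists_dist_lt (y - z) (half_pos hpos)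
    rw [dist_eq_norm] at hm
    have h1 : ‖x m‖ ≤ ‖y - z - x m‖ := by
      have h4 := hle m (y - z - x m)
      rw [map_sub, hall, he2, zero_sub, abs_neg] at h4
      simpa using h4
    have h2 : ‖y - z‖ ≤ ‖y - z - x m‖ + ‖x m‖ := by
      simpa using norm_add_le (y - z - x m) (x m)
    linarith

/-- Every cluster point of the sequence is mapped to the limit g, so injectivity leaves only one; in
a compact set a unique cluster point is the limit. -/
theorem exists_tendsto_of_injective_of_isCompact {E F : Type*} [TopologicalSpace E]
    [TopologicalSpace F] [T2Space F] {J : E → F} (hJ : Continuous J)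
    (hinj : Function.Injective J) {K : Set E} (hK : IsCompact K) {x : ℕ → E} (hx : ∀ j, x j ∈ K)
    {g : F} (hg : Tendsto (fun j => J (x j)) atTop (𝓝 g)) :
    ∃ l, Tendsto x atTop (𝓝 l) := by
  have huniq : ∀ y, MapClusterPt y atTop x → J y = g := by
    intro y hy
    obtain ⟨U, hU, hUy⟩ := mapClusterPt_iff_ultrafilter.1 hy
    exact tendsto_nhds_unique ((hJ.tendsto y).comp hUy) (hg.mono_left hU)
  obtain ⟨l, -, hl⟩ := hK.exists_mapClusterPt (f := atTop) (u := x)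
    (tendsto_principal.2 (Eventually.of_forall hx))
  refine ⟨l, hK.tendsto_nhds_of_unique_mapClusterPt (Eventually.of_forall hx) fun y _ hy => ?_⟩
  exact hinj ((huniq y hy).trans (huniq l hl).symm)

/-! ### Averages of cocycles of contractions -/

/-- Raising the shift by one adds a telescoping sum, of which two terms of norm at most 1 remain. -/
theorem norm_sum_sub_shift_le {E : Type*} [NormedAddCommGroup E] {u : ℕ → E} (hu : ∀ k, ‖u k‖ ≤ 1) (i s : ℕ) :
    ‖∑ k ∈ Finset.Icc 1 s, (u k - u (k + i))‖ ≤ 2 * i := by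
  induction i with
  | zero => simp
  | succ i ih =>
    have h1 : ∑ k ∈ Finset.Icc 1 s, (u k - u (k + (i + 1))) =
        ∑ k ∈ Finset.Icc 1 s, (u k - u (k + i)) + (u (1 + i) - u (s + 1 + i)) := by
      have h2 : ∑ k ∈ Finset.Icc 1 s, (u (k + i) - u (k + (i + 1))) =
          u (1 + i) - u (s + 1 + i) := by
        clear ih
        induction s with
        | zero => simp
        | succ s ihs =>
          rw [Finset.sum_Icc_succ_top (by omega), ihs,
            show s + 1 + (i + 1) = s + 1 + 1 + i by ring]
          abel
      rw [← h2, ← Finset.sum_add_distrib]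
      exact Finset.sum_congr rfl fun k _ => by abel
    rw [h1]
    have h3 := norm_add_le (∑ k ∈ Finset.Icc 1 s, (u k - u (k + i))) (u (1 + i) - u (s + 1 + i))
    have h4 := norm_sub_le (u (1 + i)) (u (s + 1 + i))
    have := hu (1 + i)
    have := hu (s + 1 + i)
    push_cast
    linarith

section Cocycle

variable {Ω E : Type*} [MeasurableSpace Ω] [NormedAddCommGroup E] [NormedSpace ℝ E]

/-- The action of a cocycle `L` over `σ` on `E`-valued functions of `ω`. -/
def skew (σ : Ω ≃ᵐ Ω) (L : Ω → E →L[ℝ] E) : Module.End ℝ (Ω → E) where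
  toFun F ω := L (σ.symm ω) (F (σ.symm ω))
  map_add' F G := by funext ω; simp
  map_smul' c F := by funext ω; simp

theorem skew_apply (σ : Ω ≃ᵐ Ω) (L : Ω → E →L[ℝ] E) (F : Ω → E) (ω : Ω) :
    skew σ L F ω = L (σ.symm ω) (F (σ.symm ω)) := rfl

theorem norm_skew_pow_le (σ : Ω ≃ᵐ Ω) {L : Ω → E →L[ℝ] E} (hL : ∀ ω x, ‖L ω x‖ ≤ ‖x‖)
    (F : Ω → E) (k : ℕ) (ω : Ω) : ‖(skew σ L ^ k) F ω‖ ≤ ‖F (σ.symm^[k] ω)‖ := by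
  induction k generalizing ω with
  | zero => simp
  | succ k ih =>
    rw [pow_succ', Module.End.mul_apply, skew_apply, Function.iterate_succ_apply]
    exact (hL _ _).trans (ih _)

theorem skew_pow_ae_eq {P : Measure Ω} {σ : Ω ≃ᵐ Ω} (hσ : MeasurePreserving σ.symm P P)
    (L : Ω → E →L[ℝ] E) {h : Ω → E} (hh : skew σ L h =ᵐ[P] h) (k : ℕ) :
    (skew σ L ^ k) h =ᵐ[P] h := by
  induction k with
  | zero => simp
  | succ k ih =>
    refine EventuallyEq.trans ?_ hh
    filter_upwards [hσ.quasiMeasurePreserving.ae ih] with ω hω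
    rw [pow_succ', Module.End.mul_apply, skew_apply, skew_apply, hω]

/-- Uniform weights on `{0, …, s - 1}`. -/
def uniformWeight (s : ℕ) : ℕ →₀ ℝ := (s : ℝ)⁻¹ • ∑ k ∈ Finset.range s, Finsupp.single k 1

/-- The combination of the iterates of `u₀` with weights `w`. -/
def combo (σ : Ω ≃ᵐ Ω) (L : Ω → E →L[ℝ] E) (u₀ : Ω → E) : (ℕ →₀ ℝ) →ₗ[ℝ] (Ω → E) :=
  Finsupp.linearCombination ℝ fun k => (skew σ L ^ k) u₀

theorem combo_uniformWeight (σ : Ω ≃ᵐ Ω) (L : Ω → E →L[ℝ] E) (u₀ : Ω → E) (s : ℕ) :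
    combo σ L u₀ (uniformWeight s) =
      (s : ℝ)⁻¹ • ∑ k ∈ Finset.range s, (skew σ L ^ k) u₀ := by
  simp [combo, uniformWeight, map_sum]

/-- The condition is convex in w, so it suffices to check uniform weights of length s > j; there s ≠
0, and the combination is an honest average. The weights do not depend on ω, so one w serves all
points. -/
theorem combo_mem_of_convex (σ : Ω ≃ᵐ Ω) (L : Ω → E →L[ℝ] E) (u₀ : Ω → E) {K : Set E}
    (hK : Convex ℝ K) {ω : Ω} (hu : ∀ k, (skew σ L ^ k) u₀ ω ∈ K) {j : ℕ} {w : ℕ →₀ ℝ}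
    (hw : w ∈ convexHull ℝ (uniformWeight '' Set.Ioi j)) : combo σ L u₀ w ω ∈ K := by
  have hlin : IsLinearMap ℝ fun w => combo σ L u₀ w ω :=
    ⟨fun x y => by simp, fun c x => by simp⟩
  have hconv : Convex ℝ {w | combo σ L u₀ w ω ∈ K} := hK.is_linear_preimage hlin
  refine convexHull_min ?_ hconv hw
  rintro _ ⟨s, hs, rfl⟩
  have hs0 : (s : ℝ) ≠ 0 := by
    have : 0 < s := lt_of_le_of_lt (Nat.zero_le j) hs
    positivity
  simp only [Set.mem_ofPred_eq, combo_uniformWeight, Pi.smul_apply, Finset.sum_apply,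
    Finset.smul_sum]
  refine hK.sum_mem (fun _ _ => by positivity) ?_ fun k _ => hu k
  simp [hs0]

/-- For uniform weights of length s the difference telescopes to (u_s - u_0)/s, and s ≥ j + 1. The
bound is a convex condition on w. -/
theorem norm_skew_combo_sub_le (σ : Ω ≃ᵐ Ω) {L : Ω → E →L[ℝ] E} {u₀ : Ω → E}
    (hu : ∀ k ω, ‖(skew σ L ^ k) u₀ ω‖ ≤ 1) {j : ℕ} {w : ℕ →₀ ℝ}
    (hw : w ∈ convexHull ℝ (uniformWeight '' Set.Ioi j)) (ω : Ω) :
    ‖skew σ L (combo σ L u₀ w) ω - combo σ L u₀ w ω‖ ≤ 2 / (j + 1) := by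
  have hlin : IsLinearMap ℝ fun w => skew σ L (combo σ L u₀ w) ω - combo σ L u₀ w ω :=
    ⟨fun x y => by simp; abel, fun c x => by simp [smul_sub]⟩
  have hconv := (convex_closedBall (0 : E) (2 / ((j : ℝ) + 1))).is_linear_preimage hlin
  have := convexHull_min ?_ hconv hw
  · simpa using this
  rintro _ ⟨s, hs, rfl⟩
  have hs0 : (j : ℝ) + 1 ≤ s := by exact_mod_cast hs
  simp only [Set.mem_preimage, mem_closedBall_zero_iff, combo_uniformWeight, map_smul, map_sum]
  have h1 : ∑ k ∈ Finset.range s, skew σ L ((skew σ L ^ k) u₀) -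
      ∑ k ∈ Finset.range s, (skew σ L ^ k) u₀ = (skew σ L ^ s) u₀ - (skew σ L ^ 0) u₀ := by
    rw [← Finset.sum_range_sub (fun k => (skew σ L ^ k) u₀) s, Finset.sum_sub_distrib]
    simp only [pow_succ', Module.End.mul_apply]
  rw [← Pi.sub_apply, ← smul_sub, h1, Pi.smul_apply, norm_smul, norm_inv, Real.norm_natCast,
    Pi.sub_apply]
  have h2 : ‖(skew σ L ^ s) u₀ ω - (skew σ L ^ 0) u₀ ω‖ ≤ 2 :=
    (norm_sub_le _ _).trans (by linarith [hu s ω, hu 0 ω])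
  have hj : (0 : ℝ) < (j : ℝ) + 1 := by positivity
  calc (s : ℝ)⁻¹ * ‖(skew σ L ^ s) u₀ ω - (skew σ L ^ 0) u₀ ω‖ ≤ ((j : ℝ) + 1)⁻¹ * 2 := by gcongr
    _ = _ := by ring

/-- Again a convex condition on w. For uniform weights of length t the combination is the mean of
the shifts by i < t, and each shift costs at most 2i ≤ 2t, whatever s and ω are. The bound may
depend on w: it is divided by s later. -/
theorem exists_norm_sum_sub_combo_le (σ : Ω ≃ᵐ Ω) {L : Ω → E →L[ℝ] E} {u₀ : Ω → E}
    (hu : ∀ k ω, ‖(skew σ L ^ k) u₀ ω‖ ≤ 1) {j : ℕ} {w : ℕ →₀ ℝ}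
    (hw : w ∈ convexHull ℝ (uniformWeight '' Set.Ioi j)) :
    ∃ C : ℝ, ∀ s ω,
      ‖∑ k ∈ Finset.Icc 1 s, ((skew σ L ^ k) u₀ ω - (skew σ L ^ k) (combo σ L u₀ w) ω)‖ ≤ C := by
  have hconv : Convex ℝ {w : ℕ →₀ ℝ | ∃ C : ℝ, ∀ s ω,
      ‖∑ k ∈ Finset.Icc 1 s, ((skew σ L ^ k) u₀ ω - (skew σ L ^ k) (combo σ L u₀ w) ω)‖ ≤ C} := by
    rintro x ⟨C, hC⟩ y ⟨D, hD⟩ a b ha hb hab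
    refine ⟨a * C + b * D, fun s ω => ?_⟩
    have h1 : ∑ k ∈ Finset.Icc 1 s,
        ((skew σ L ^ k) u₀ ω - (skew σ L ^ k) (combo σ L u₀ (a • x + b • y)) ω) =
        a • ∑ k ∈ Finset.Icc 1 s, ((skew σ L ^ k) u₀ ω - (skew σ L ^ k) (combo σ L u₀ x) ω) +
        b • ∑ k ∈ Finset.Icc 1 s, ((skew σ L ^ k) u₀ ω - (skew σ L ^ k) (combo σ L u₀ y) ω) := by
      rw [Finset.smul_sum, Finset.smul_sum, ← Finset.sum_add_distrib]
      refine Finset.sum_congr rfl fun k _ => ?_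
      have h2 : (skew σ L ^ k) u₀ ω = a • (skew σ L ^ k) u₀ ω + b • (skew σ L ^ k) u₀ ω := by
        rw [← add_smul, hab, one_smul]
      simp only [map_add, map_smul, Pi.add_apply, Pi.smul_apply]
      rw [smul_sub, smul_sub, sub_add_sub_comm, ← h2]
    rw [h1]
    refine (norm_add_le _ _).trans ?_
    rw [norm_smul, norm_smul, Real.norm_of_nonneg ha, Real.norm_of_nonneg hb]
    have := hC s ω
    have := hD s ω
    gcongr
  refine convexHull_min ?_ hconv hw
  rintro _ ⟨t, ht, rfl⟩
  have ht0 : (t : ℝ) ≠ 0 := by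
    have : 0 < t := lt_of_le_of_lt (Nat.zero_le j) ht
    positivity
  refine ⟨2 * t, fun s ω => ?_⟩
  have h1 : ∑ k ∈ Finset.Icc 1 s,
      ((skew σ L ^ k) u₀ ω - (skew σ L ^ k) (combo σ L u₀ (uniformWeight t)) ω) =
      (t : ℝ)⁻¹ • ∑ i ∈ Finset.range t, ∑ k ∈ Finset.Icc 1 s,
        ((skew σ L ^ k) u₀ ω - (skew σ L ^ (k + i)) u₀ ω) := by
    rw [Finset.sum_comm, Finset.smul_sum]
    refine Finset.sum_congr rfl fun k _ => ?_
    rw [Finset.sum_sub_distrib, Finset.sum_const, Finset.card_range, ← Nat.cast_smul_eq_nsmul ℝ,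
      smul_sub, smul_smul, inv_mul_cancel₀ ht0, one_smul, combo_uniformWeight, map_smul, map_sum,
      Pi.smul_apply, Finset.sum_apply]
    simp only [pow_add, Module.End.mul_apply]
  rw [h1, norm_smul, norm_inv, Real.norm_natCast]
  have h2 : ‖∑ i ∈ Finset.range t, ∑ k ∈ Finset.Icc 1 s,
      ((skew σ L ^ k) u₀ ω - (skew σ L ^ (k + i)) u₀ ω)‖ ≤ t * (2 * t) := by
    refine (norm_sum_le _ _).trans ?_
    calc _ ≤ ∑ i ∈ Finset.range t, (2 * t : ℝ) := by
          refine Finset.sum_le_sum fun i hi => ?_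
          refine (norm_sum_sub_shift_le (u := fun k => (skew σ L ^ k) u₀ ω)
            (fun k => hu k ω) i s).trans ?_
          have : (i : ℝ) ≤ t := by exact_mod_cast (Finset.mem_range.1 hi).le
          linarith
      _ = _ := by simp
  calc _ ≤ (t : ℝ)⁻¹ * (t * (2 * t)) := by gcongr
    _ = _ := by field_simp

theorem aestronglyMeasurable_combo {P : Measure Ω} (σ : Ω ≃ᵐ Ω) {L : Ω → E →L[ℝ] E}
    {u₀ : Ω → E} (hmeas : ∀ k, AEStronglyMeasurable ((skew σ L ^ k) u₀) P) (w : ℕ →₀ ℝ) :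
    AEStronglyMeasurable (combo σ L u₀ w) P := by
  induction w using Finsupp.induction_linear with
  | zero => simpa using aestronglyMeasurable_zero
  | add f g hf hg => rw [map_add]; exact hf.add hg
  | single k a => simpa [combo] using (hmeas k).const_smul a

/-- If the iterates of `u₀` stay in compact convex sets, then convex combinations of arbitrarily
long averages of them converge almost everywhere. -/
theorem exists_combo_tendsto [TopologicalSpace.SeparableSpace E] {P : Measure Ω}
    [IsProbabilityMeasure P] (σ : Ω ≃ᵐ Ω) {L : Ω → E →L[ℝ] E} {u₀ : Ω → E}
    (hmeas : ∀ k, AEStronglyMeasurable ((skew σ L ^ k) u₀) P)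
    (hu : ∀ k ω, ‖(skew σ L ^ k) u₀ ω‖ ≤ 1)
    (hK : ∀ᵐ ω ∂P, ∃ K : Set E, IsCompact K ∧ Convex ℝ K ∧ ∀ k, (skew σ L ^ k) u₀ ω ∈ K) :
    ∃ w : ℕ → ℕ →₀ ℝ, (∀ j, w j ∈ convexHull ℝ (uniformWeight '' Set.Ioi j)) ∧
      ∃ h : Ω → E, StronglyMeasurable h ∧
        ∀ᵐ ω ∂P, Tendsto (fun j => combo σ L u₀ (w j) ω) atTop (𝓝 (h ω)) := by
  obtain ⟨J, hJ⟩ := exists_injective_clm_l2 E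
  have hmem : ∀ k, MemLp (fun ω => J ((skew σ L ^ k) u₀ ω)) 2 P := fun k =>
    MemLp.of_bound (J.continuous.comp_aestronglyMeasurable (hmeas k)) ‖J‖
      (Eventually.of_forall fun ω => (J.le_opNorm _).trans
        (mul_le_of_le_one_right (norm_nonneg _) (hu k ω)))
  -- The minimization takes place in L²(Ω; ℓ²), but the near-minimizers are kept as weights, so that
  -- they give combinations at every ω.
  let W : (ℕ →₀ ℝ) →ₗ[ℝ] Lp (lp (fun _ : ℕ => ℝ) 2) 2 P :=
    Finsupp.linearCombination ℝ fun k => (hmem k).toLp _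
  have hW : ∀ w, W w =ᵐ[P] fun ω => J (combo σ L u₀ w ω) := by
    intro w
    induction w using Finsupp.induction_linear with
    | zero =>
      rw [map_zero]
      filter_upwards [Lp.coeFn_zero (lp (fun _ : ℕ => ℝ) 2) 2 P] with ω hω
      rw [hω]; simp
    | add f g hf hg =>
      rw [map_add]
      filter_upwards [hf, hg, Lp.coeFn_add (W f) (W g)] with ω h1 h2 h3
      rw [h3, Pi.add_apply, h1, h2]; simp
    | single k a =>
      have h1 : W (Finsupp.single k a) = a • (hmem k).toLp _ := by simp [W]
      rw [h1]
      filter_upwards [Lp.coeFn_smul a ((hmem k).toLp _), (hmem k).coeFn_toLp] with ω h2 h3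
      rw [h2, Pi.smul_apply, h3]; simp [combo]
  have hanti : Antitone fun j : ℕ => convexHull ℝ (uniformWeight '' Set.Ioi j) :=
    fun i j hij => convexHull_mono (Set.image_mono (Set.Ioi_subset_Ioi hij))
  obtain ⟨w, hw, hcau⟩ := exists_cauchySeq_of_antitone_convex W (R := ‖J‖) hanti
    (fun j => convex_convexHull ℝ _)
    (fun j => ((Set.nonempty_Ioi).image uniformWeight).mono (subset_convexHull ℝ _))
    (fun w hw => by
      have h1 : ‖W w‖ ≤ (P.real Set.univ) ^ ((2 : ℝ≥0∞).toReal)⁻¹ * ‖J‖ := by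
        refine Lp.norm_le_of_ae_bound (norm_nonneg _) ?_
        filter_upwards [hW w] with ω hω
        rw [hω]
        refine (J.le_opNorm _).trans (mul_le_of_le_one_right (norm_nonneg _) ?_)
        have := combo_mem_of_convex σ L u₀ (convex_closedBall (0 : E) 1) (ω := ω)
          (fun k => by simpa using hu k ω) hw
        simpa using this
      simpa using h1)
  obtain ⟨G, hG⟩ := cauchySeq_tendsto_of_complete hcau
  -- L² convergence gives a.e. convergence of the images under J along a subsequence; the compact
  -- sets lift it to convergence in E.
  obtain ⟨ns, hns, hlim⟩ := (tendstoInMeasure_of_tendsto_Lp hG).exists_seq_tendsto_ae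
  have hconv : ∀ᵐ ω ∂P, ∃ l, Tendsto (fun j => combo σ L u₀ (w (ns j)) ω) atTop (𝓝 l) := by
    filter_upwards [hlim, hK, ae_all_iff.2 fun j => hW (w (ns j))] with ω h1 ⟨K, hK1, hK2, hK3⟩ h2
    refine exists_tendsto_of_injective_of_isCompact J.continuous hJ hK1
      (fun j => combo_mem_of_convex σ L u₀ hK2 hK3 (hw (ns j))) (g := G ω) ?_
    exact h1.congr fun j => h2 j
  obtain ⟨h, hh, hlim'⟩ := exists_stronglyMeasurable_limit_of_tendsto_ae
    (fun j => aestronglyMeasurable_combo σ hmeas (w (ns j))) hconv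
  -- Since ns j ≥ j, the subsequence still uses only averages of length greater than j.
  exact ⟨fun j => w (ns j), fun j => hanti (hns.id_le j) (hw (ns j)), h, hh, hlim'⟩

/-- A pointwise ergodic theorem for the averages of the iterates of `u₀` under a cocycle of
contractions. -/
theorem exists_ae_tendsto_average [TopologicalSpace.SeparableSpace E] {P : Measure Ω}
    [IsProbabilityMeasure P] {σ : Ω ≃ᵐ Ω} (hσ : Ergodic σ P) {L : Ω → E →L[ℝ] E}
    (hL : ∀ ω x, ‖L ω x‖ ≤ ‖x‖) {u₀ : Ω → E}
    (hmeas : ∀ k, AEStronglyMeasurable ((skew σ L ^ k) u₀) P)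
    (hu : ∀ k ω, ‖(skew σ L ^ k) u₀ ω‖ ≤ 1)
    (hK : ∀ᵐ ω ∂P, ∃ K : Set E, IsCompact K ∧ Convex ℝ K ∧ ∀ k, (skew σ L ^ k) u₀ ω ∈ K) :
    ∃ h : Ω → E, StronglyMeasurable h ∧
      (∀ᵐ ω ∂P, Tendsto (fun s : ℕ => (s : ℝ)⁻¹ • ∑ k ∈ Finset.Icc 1 s, (skew σ L ^ k) u₀ ω)
        atTop (𝓝 (h ω))) ∧
      ∀ᵐ ω ∂P, L ω (h ω) = h (σ ω) := by
  obtain ⟨w, hw, h, hh, hlim⟩ := exists_combo_tendsto σ hmeas hu hK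
  have hσ' : Ergodic σ.symm P := hσ.symm
  have hmp := hσ'.toMeasurePreserving
  have hF1 : ∀ j ω, ‖combo σ L u₀ (w j) ω‖ ≤ 1 := fun j ω => by
    have := combo_mem_of_convex σ L u₀ (convex_closedBall (0 : E) 1) (ω := ω)
      (fun k => by simpa using hu k ω) (hw j)
    simpa using this
  -- The combinations are invariant up to 2/(j + 1) and each `L ω` is continuous, so the limit is
  -- invariant.
  have hinv : skew σ L h =ᵐ[P] h := by
    filter_upwards [hlim, hmp.quasiMeasurePreserving.ae hlim] with ω h1 h2
    have h3 : Tendsto (fun j => skew σ L (combo σ L u₀ (w j)) ω) atTop (𝓝 (skew σ L h ω)) :=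
      ((L (σ.symm ω)).continuous.tendsto _).comp h2
    have h4 : Tendsto (fun j => skew σ L (combo σ L u₀ (w j)) ω - combo σ L u₀ (w j) ω) atTop
        (𝓝 0) := by
      refine squeeze_zero_norm (fun j => norm_skew_combo_sub_le σ hu (hw j) ω) ?_
      have := (tendsto_one_div_add_atTop_nhds_zero_nat (𝕜 := ℝ)).const_mul 2
      simpa [div_eq_mul_inv] using this
    exact sub_eq_zero.1 (tendsto_nhds_unique (h3.sub h1) h4)
  refine ⟨h, hh, ?_, ?_⟩
  swap
  · filter_upwards [hσ.toMeasurePreserving.quasiMeasurePreserving.ae hinv] with ω hω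
    simpa [skew_apply] using hω
  have hh1 : ∀ᵐ ω ∂P, ‖h ω‖ ≤ 1 := by
    filter_upwards [hlim] with ω h1
    exact le_of_tendsto' h1.norm fun j => hF1 j ω
  -- The error of the j-th combination is bounded by 2 a.e. and tends to 0 a.e., so its integral
  -- tends to 0.
  set g : ℕ → Ω → ℝ := fun j ω => ‖combo σ L u₀ (w j) ω - h ω‖ with hg
  have hgm : ∀ j, AEStronglyMeasurable (g j) P := fun j =>
    ((aestronglyMeasurable_combo σ hmeas (w j)).sub hh.aestronglyMeasurable).norm
  have hgb : ∀ j, ∀ᵐ ω ∂P, ‖g j ω‖ ≤ 2 := by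
    intro j
    filter_upwards [hh1] with ω h1
    rw [hg, norm_norm]
    exact (norm_sub_le _ _).trans (by linarith [hF1 j ω])
  have hgi : ∀ j, Integrable (g j) P := fun j => Integrable.of_bound (hgm j) 2 (hgb j)
  have hglim : Tendsto (fun j => ∫ ω, g j ω ∂P) atTop (𝓝 0) := by
    have := tendsto_integral_of_dominated_convergence (F := g) (f := fun _ => (0 : ℝ)) (μ := P)
      (fun _ => (2 : ℝ)) hgm (integrable_const _) hgb (by
        filter_upwards [hlim] with ω h1
        exact tendsto_iff_norm_sub_tendsto_zero.1 h1)
    simpa using this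
  choose C hC using fun j => exists_norm_sum_sub_combo_le σ hu (hw j)
  -- The Birkhoff sums start at σ⁻¹ω because the averages run over k = 1, …, s.
  have hB : ∀ᵐ ω ∂P, ∀ j, ∀ᶠ s : ℕ in atTop,
      birkhoffSum σ.symm (g j) s (σ.symm ω) ≤ s * (∫ ω, g j ω ∂P + 1 / ((j : ℝ) + 1)) := by
    rw [ae_all_iff]
    intro j
    refine hmp.quasiMeasurePreserving.ae (ae_eventually_birkhoffSum_le hσ' (hgi j) ?_)
    have : (0 : ℝ) < 1 / ((j : ℝ) + 1) := by positivity
    linarith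
  filter_upwards [hB, ae_all_iff.2 fun k => skew_pow_ae_eq hmp L hinv k] with ω h1 h2
  rw [Metric.tendsto_atTop']
  intro ε hε
  have h3 : Tendsto (fun j : ℕ => ∫ ω, g j ω ∂P + 1 / ((j : ℝ) + 1)) atTop (𝓝 0) := by
    simpa using hglim.add (tendsto_one_div_add_atTop_nhds_zero_nat (𝕜 := ℝ))
  obtain ⟨j, hj⟩ := (h3.eventually (gt_mem_nhds (half_pos hε))).exists
  have h4 := tendsto_natCast_atTop_atTop (R := ℝ) |>.eventually_gt_atTop (2 * C j / ε)
  obtain ⟨s₀, hs₀⟩ := ((h1 j).and (h4.and (eventually_gt_atTop 0))).exists_forall_of_atTop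
  refine ⟨s₀, fun s hs => ?_⟩
  obtain ⟨h5, h6, h7⟩ := hs₀ s hs.le
  have hs0 : (0 : ℝ) < s := by exact_mod_cast h7
  rw [dist_eq_norm]
  -- The first sum compares the iterates of u₀ with those of the combination and is at most `C j`
  -- for all s. The second compares the combination with h, which equals its own iterates at ω;
  -- contractivity bounds it by a Birkhoff sum of `g j`.
  have h8 : (s : ℝ)⁻¹ • ∑ k ∈ Finset.Icc 1 s, (skew σ L ^ k) u₀ ω - h ω =
      (s : ℝ)⁻¹ • (∑ k ∈ Finset.Icc 1 s,
        ((skew σ L ^ k) u₀ ω - (skew σ L ^ k) (combo σ L u₀ (w j)) ω) +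
        ∑ k ∈ Finset.Icc 1 s, (skew σ L ^ k) (combo σ L u₀ (w j) - h) ω) := by
    have h9 : h ω = (s : ℝ)⁻¹ • ∑ k ∈ Finset.Icc 1 s, (skew σ L ^ k) h ω := by
      rw [Finset.sum_congr rfl fun k _ => h2 k, Finset.sum_const, Nat.card_Icc,
        ← Nat.cast_smul_eq_nsmul ℝ, smul_smul]
      simp [hs0.ne']
    conv_lhs => rw [h9]
    rw [← smul_sub, ← Finset.sum_sub_distrib, ← Finset.sum_add_distrib]
    congr 1
    refine Finset.sum_congr rfl fun k _ => ?_
    rw [map_sub, Pi.sub_apply]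
    abel
  have h10 : ‖∑ k ∈ Finset.Icc 1 s, (skew σ L ^ k) (combo σ L u₀ (w j) - h) ω‖ ≤
      birkhoffSum σ.symm (g j) s (σ.symm ω) := by
    refine (norm_sum_le _ _).trans ?_
    have h12 : birkhoffSum σ.symm (g j) s (σ.symm ω) =
        ∑ k ∈ Finset.Icc 1 s, g j (σ.symm^[k] ω) := by
      rw [← Finset.Ico_succ_right_eq_Icc, Finset.sum_Ico_eq_sum_range, birkhoffSum]
      refine Finset.sum_congr (by simp) fun k _ => ?_
      rw [add_comm 1 k, Function.iterate_succ_apply]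
    rw [h12]
    exact Finset.sum_le_sum fun k _ => norm_skew_pow_le σ hL _ k ω
  rw [h8, norm_smul, norm_inv, Real.norm_natCast, inv_mul_lt_iff₀ hs0]
  refine (norm_add_le _ _).trans_lt ?_
  have h11 := hC j s ω
  rw [div_lt_iff₀ hε] at h6
  nlinarith

end Cocycle

/-! ### Pairings with bounded functions and transfer operators -/

section Pairing

variable {n : ℕ}

theorem integrable_mul_of_bounded {μ : Measure (Cube n)} {u θ : Cube n → ℝ} (hu : Integrable u μ)
    (hθ : Measurable θ) {B : ℝ} (hB : ∀ x, |θ x| ≤ B) : Integrable (fun x => u x * θ x) μ :=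
  hu.mul_bdd (c := B) hθ.aestronglyMeasurable (Eventually.of_forall fun x => by simpa using hB x)

theorem integrable_mul (h : L1 n) {θ : Cube n → ℝ} (hθ : Measurable θ) {B : ℝ}
    (hB : ∀ x, |θ x| ≤ B) : Integrable (fun x => h x * θ x) :=
  integrable_mul_of_bounded (L1.integrable_coeFn h) hθ hB

theorem abs_integral_mul_le (h : L1 n) {θ : Cube n → ℝ} (hθ : Measurable θ) {B : ℝ}
    (hB : ∀ x, |θ x| ≤ B) : |∫ x, h x * θ x| ≤ B * ‖h‖ := by
  rw [L1.norm_eq_integral_norm, ← integral_const_mul]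
  refine (abs_integral_le_integral_abs).trans (integral_mono (integrable_mul h hθ hB).abs
    ((L1.integrable_coeFn h).norm.const_mul B) fun x => ?_)
  simp only [abs_mul, Real.norm_eq_abs]
  rw [mul_comm]
  exact mul_le_mul_of_nonneg_right (hB x) (abs_nonneg _)

theorem exists_norm_eq_integral_mul (h : L1 n) :
    ∃ ξ : Cube n → ℝ, Measurable ξ ∧ (∀ x, |ξ x| ≤ 1) ∧ ‖h‖ = ∫ x, h x * ξ x := by
  have hm : Measurable (h : Cube n → ℝ) := (Lp.stronglyMeasurable h).measurable
  refine ⟨fun x => if 0 ≤ h x then 1 else -1, Measurable.ite (measurableSet_le measurable_const hm)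
    measurable_const measurable_const, fun x => by dsimp only; split_ifs <;> simp, ?_⟩
  rw [L1.norm_eq_integral_norm]
  refine integral_congr_ae (Eventually.of_forall fun x => ?_)
  simp only [Real.norm_eq_abs]
  split_ifs with hx
  · rw [abs_of_nonneg hx, mul_one]
  · rw [abs_of_neg (not_le.1 hx)]; ring

/-- Integration against a bounded measurable function, as a continuous linear functional. -/
def pairing (θ : Cube n → ℝ) (hθ : Measurable θ) (B : ℝ) (hB : ∀ x, |θ x| ≤ B) :
    L1 n →L[ℝ] ℝ :=
  LinearMap.mkContinuous
    { toFun := fun h => ∫ x, h x * θ x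
      map_add' := fun h g => by
        rw [← integral_add (integrable_mul h hθ hB) (integrable_mul g hθ hB)]
        refine integral_congr_ae ?_
        filter_upwards [Lp.coeFn_add h g] with x hx
        rw [hx, Pi.add_apply, add_mul]
      map_smul' := fun c h => by
        rw [RingHom.id_apply, smul_eq_mul, ← integral_const_mul]
        refine integral_congr_ae ?_
        filter_upwards [Lp.coeFn_smul c h] with x hx
        rw [hx, Pi.smul_apply, smul_eq_mul, mul_assoc] }
    B fun h => by simpa using abs_integral_mul_le h hθ hB

theorem pairing_apply {θ : Cube n → ℝ} (hθ : Measurable θ) {B : ℝ} (hB : ∀ x, |θ x| ≤ B)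
    (h : L1 n) : pairing θ hθ B hB h = ∫ x, h x * θ x := rfl

variable {f : Cube n → Cube n}

/-- The defining relation is the case of indicators; linearity gives simple functions, and dominated
convergence with uniformly bounded simple approximations gives all bounded measurable θ. -/
theorem integral_transfer_mul (hf : Nonsingular f) (h : L1 n) {θ : Cube n → ℝ}
    (hθ : Measurable θ) {B : ℝ} (hB : ∀ x, |θ x| ≤ B) :
    ∫ x, transfer f h x * θ x = ∫ x, h x * θ (f x) := by
  have hfm : Measurable f := hf.measurable
  have hsimple : ∀ s : SimpleFunc (Cube n) ℝ,
      ∫ x, transfer f h x * s x = ∫ x, h x * s (f x) := by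
    intro s
    induction s using SimpleFunc.induction with
    | const c hA =>
      rename_i A
      have h1 := setIntegral_transfer hf h hA
      have h2 : ∀ g : Cube n → ℝ, ∀ S : Set (Cube n), MeasurableSet S →
          ∫ x, g x * S.indicator (fun _ => c) x = (∫ x in S, g x) * c := by
        intro g S hS
        rw [← integral_mul_const, ← integral_indicator hS]
        refine integral_congr_ae (Eventually.of_forall fun x => ?_)
        by_cases hx : x ∈ S <;> simp [hx]
      have h3 : ∀ x, (SimpleFunc.piecewise A hA (SimpleFunc.const _ c) (SimpleFunc.const _ 0)) x =
          A.indicator (fun _ => c) x := fun x => by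
        by_cases hx : x ∈ A <;> simp [hx, Set.piecewise]
      have h4 : ∀ x, A.indicator (fun _ => c) (f x) = (f ⁻¹' A).indicator (fun _ => c) x :=
        fun x => rfl
      simp only [h3, h4]
      rw [h2 _ _ hA, h2 _ _ (hfm hA), h1]
    | add hd hs ht =>
      rename_i s t
      obtain ⟨Bs, hBs⟩ := s.exists_forall_norm_le
      obtain ⟨Bt, hBt⟩ := t.exists_forall_norm_le
      simp only [SimpleFunc.coe_add, Pi.add_apply, mul_add]
      rw [integral_add (integrable_mul _ s.measurable hBs) (integrable_mul _ t.measurable hBt),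
        integral_add
          (integrable_mul h (θ := fun x => s (f x)) (s.measurable.comp hfm) fun x => hBs (f x))
          (integrable_mul h (θ := fun x => t (f x)) (t.measurable.comp hfm) fun x => hBt (f x)),
        hs, ht]
  have hsm := hθ.stronglyMeasurable
  have hB0 : 0 ≤ B := (abs_nonneg _).trans (hB 0)
  have hlim : ∀ x, Tendsto (fun m => hsm.approxBounded B m x) atTop (𝓝 (θ x)) := fun x =>
    hsm.tendsto_approxBounded_of_norm_le (by simpa using hB x)
  have hbd : ∀ m x, ‖hsm.approxBounded B m x‖ ≤ B := fun m x =>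
    hsm.norm_approxBounded_le hB0 m x
  have key : ∀ (g : L1 n) (p : Cube n → Cube n), Measurable p →
      Tendsto (fun m => ∫ x, g x * hsm.approxBounded B m (p x)) atTop
        (𝓝 (∫ x, g x * θ (p x))) := by
    intro g p hp
    refine tendsto_integral_of_dominated_convergence (fun x => ‖g x‖ * B) (fun m => ?_)
      ((L1.integrable_coeFn g).norm.mul_const B) (fun m => ?_) ?_
    · exact (integrable_mul g ((SimpleFunc.measurable _).comp hp) fun x => hbd m (p x)).1
    · refine Eventually.of_forall fun x => ?_
      rw [norm_mul]
      exact mul_le_mul_of_nonneg_left (hbd m _) (norm_nonneg _)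
    · exact Eventually.of_forall fun x => (hlim (p x)).const_mul _
  refine tendsto_nhds_unique (key (transfer f h) id measurable_id) ?_
  simp only [id, hsimple]
  exact key h f hfm

theorem eq_transfer_of_setIntegral (hf : Nonsingular f) {h g : L1 n}
    (hg : ∀ A, MeasurableSet A → ∫ x in A, g x = ∫ x in f ⁻¹' A, h x) : g = transfer f h := by
  refine Lp.ext (Integrable.ae_eq_of_forall_setIntegral_eq _ _ (L1.integrable_coeFn g)
    (L1.integrable_coeFn _) fun A hA _ => ?_)
  rw [hg A hA, setIntegral_transfer hf h hA]

/-- Pairing the image with its own sign ξ turns the norm into ∫ h · (ξ ∘ f), where |ξ ∘ f| ≤ 1. -/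
theorem norm_transfer_le (hf : Nonsingular f) (h : L1 n) : ‖transfer f h‖ ≤ ‖h‖ := by
  obtain ⟨ξ, hξ, hb, he⟩ := exists_norm_eq_integral_mul (transfer f h)
  rw [he, integral_transfer_mul hf h hξ hb]
  have := abs_integral_mul_le h (hξ.comp hf.measurable) (fun x => hb (f x))
  exact (le_abs_self _).trans (by simpa using this)

theorem transfer_add (hf : Nonsingular f) (h g : L1 n) :
    transfer f (h + g) = transfer f h + transfer f g := by
  refine (eq_transfer_of_setIntegral hf fun A hA => ?_).symm
  have h1 : ∀ (S : Set (Cube n)) (u v : L1 n), ∫ x in S, (u + v : L1 n) x =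
      (∫ x in S, u x) + ∫ x in S, v x := by
    intro S u v
    rw [← integral_add (L1.integrable_coeFn u).integrableOn (L1.integrable_coeFn v).integrableOn]
    exact integral_congr_ae (ae_restrict_of_ae (Lp.coeFn_add u v))
  rw [h1, h1, setIntegral_transfer hf h hA, setIntegral_transfer hf g hA]

theorem transfer_smul (hf : Nonsingular f) (c : ℝ) (h : L1 n) :
    transfer f (c • h) = c • transfer f h := by
  refine (eq_transfer_of_setIntegral hf fun A hA => ?_).symm
  have h1 : ∀ (S : Set (Cube n)) (u : L1 n), ∫ x in S, (c • u : L1 n) x = c * ∫ x in S, u x := by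
    intro S u
    rw [← integral_const_mul]
    exact integral_congr_ae (ae_restrict_of_ae (Lp.coeFn_smul c u))
  rw [h1, h1, setIntegral_transfer hf h hA]

/-- The transfer operator of a nonsingular map as a continuous linear map. -/
def transferCLM (f : Cube n → Cube n) (hf : Nonsingular f) : L1 n →L[ℝ] L1 n :=
  LinearMap.mkContinuous
    { toFun := transfer f
      map_add' := transfer_add hf
      map_smul' := transfer_smul hf } 1 fun h => by simpa using norm_transfer_le hf h

theorem transfer_nonneg (hf : Nonsingular f) {h : L1 n} (hh : 0 ≤ h) : 0 ≤ transfer f h := by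
  rw [← Lp.coeFn_nonneg] at hh ⊢
  refine ae_nonneg_of_forall_setIntegral_nonneg (L1.integrable_coeFn _) fun A hA _ => ?_
  rw [setIntegral_transfer hf h hA]
  exact integral_nonneg_of_ae (ae_restrict_of_ae hh)

theorem norm_eq_integral_of_nonneg {h : L1 n} (hh : 0 ≤ h) : ‖h‖ = ∫ x, h x := by
  rw [L1.norm_eq_integral_norm]
  rw [← Lp.coeFn_nonneg] at hh
  refine integral_congr_ae ?_
  filter_upwards [hh] with x hx
  exact Real.norm_of_nonneg hx

theorem norm_transfer_of_nonneg (hf : Nonsingular f) {h : L1 n} (hh : 0 ≤ h) :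
    ‖transfer f h‖ = ‖h‖ := by
  rw [norm_eq_integral_of_nonneg hh, norm_eq_integral_of_nonneg (transfer_nonneg hf hh),
    ← setIntegral_univ, setIntegral_transfer hf h MeasurableSet.univ, Set.preimage_univ,
    setIntegral_univ]

end Pairing

/-! ### A one-dimensional estimate by summation by parts -/

/-- This is ∫ uΘ = u(b)F(b) - ∫ F du for the primitive F of Θ, with du controlled by the increments
of v. No continuity of u is available, so u is frozen at the right end points of a uniform
subdivision and the resulting sum is rearranged by parts; the error is at most (v b - v a) B (b -
a)/m and disappears as m → ∞. -/
theorem abs_integral_mul_le_of_variation {a b B c : ℝ} (hab : a ≤ b) {u v Θ : ℝ → ℝ}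
    (hΘ : IntervalIntegrable Θ volume a b) (hB : ∀ x, |Θ x| ≤ B)
    (huΘ : IntervalIntegrable (fun x => u x * Θ x) volume a b)
    (huv : ∀ s ∈ Set.Icc a b, ∀ t ∈ Set.Icc a b, s ≤ t → |u t - u s| ≤ v t - v s)
    (hc : ∀ t ∈ Set.Icc a b, |∫ x in a..t, Θ x| ≤ c) :
    |∫ x in a..b, u x * Θ x| ≤ c * (v b - v a) + |u b| * |∫ x in a..b, Θ x| := by
  have hB0 : 0 ≤ B := (abs_nonneg _).trans (hB 0)
  have main : ∀ m : ℕ, 0 < m → |∫ x in a..b, u x * Θ x| ≤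
      c * (v b - v a) + |u b| * |∫ x in a..b, Θ x| + (v b - v a) * (B * (b - a)) / m := by
    intro m hm
    have hm0 : (0 : ℝ) < m := by exact_mod_cast hm
    set δ : ℝ := (b - a) / m with hδ
    have hδ0 : 0 ≤ δ := div_nonneg (sub_nonneg.2 hab) hm0.le
    set t : ℕ → ℝ := fun k => a + k * δ with ht
    have ht0 : t 0 = a := by simp [ht]
    have htm : t m = b := by simp only [ht, hδ]; field_simp; ring
    have htmono : Monotone t := fun i j hij => by
      simp only [ht]
      have : (i : ℝ) ≤ j := by exact_mod_cast hij
      nlinarith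
    have hmem : ∀ k, k ≤ m → t k ∈ Set.Icc a b := fun k hk =>
      ⟨ht0 ▸ htmono (Nat.zero_le k), htm ▸ htmono hk⟩
    have hsub : ∀ k, k < m → Set.uIcc (t k) (t (k + 1)) ⊆ Set.uIcc a b := by
      intro k hk
      rw [Set.uIcc_of_le (htmono (Nat.le_succ k)), Set.uIcc_of_le hab]
      exact Set.Icc_subset_Icc (hmem k hk.le).1 (hmem (k + 1) hk).2
    set F : ℕ → ℝ := fun k => ∫ x in a..t k, Θ x with hF
    have hFk : ∀ k, k < m → ∫ x in t k..t (k + 1), Θ x = F (k + 1) - F k := by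
      intro k hk
      have h1 : ∀ j, j ≤ m → IntervalIntegrable Θ volume a (t j) := fun j hj =>
        hΘ.mono_set (by
          rw [Set.uIcc_of_le (hmem j hj).1, Set.uIcc_of_le hab]
          exact Set.Icc_subset_Icc le_rfl (hmem j hj).2)
      rw [hF, intervalIntegral.integral_interval_sub_left (h1 _ hk) (h1 _ hk.le)]
    have hsum1 : ∫ x in a..b, u x * Θ x =
        ∑ k ∈ Finset.range m, ∫ x in t k..t (k + 1), u x * Θ x := by
      rw [intervalIntegral.sum_integral_adjacent_intervals (fun k hk => huΘ.mono_set (hsub k hk)),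
        ht0, htm]
    -- On one piece u differs from its right end value by at most the increment of v, and |Θ| ≤ B.
    have hpiece : ∀ k, k < m → |(∫ x in t k..t (k + 1), u x * Θ x) -
        u (t (k + 1)) * (F (k + 1) - F k)| ≤ (v (t (k + 1)) - v (t k)) * B * δ := by
      intro k hk
      rw [← hFk k hk, ← intervalIntegral.integral_const_mul, ← intervalIntegral.integral_sub
        (huΘ.mono_set (hsub k hk)) ((hΘ.mono_set (hsub k hk)).const_mul _)]
      have h1 := intervalIntegral.norm_integral_le_of_norm_le_const (a := t k) (b := t (k + 1))
        (f := fun x => u x * Θ x - u (t (k + 1)) * Θ x) (C := (v (t (k + 1)) - v (t k)) * B) ?_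
      · refine h1.trans_eq ?_
        have : t (k + 1) - t k = δ := by simp only [ht]; push_cast; ring
        rw [this, abs_of_nonneg hδ0]
      · intro x hx
        rw [Set.uIoc_of_le (htmono (Nat.le_succ k))] at hx
        have hxm : x ∈ Set.Icc a b := ⟨(hmem k hk.le).1.trans hx.1.le, hx.2.trans (hmem _ hk).2⟩
        rw [← sub_mul, Real.norm_eq_abs, abs_mul, abs_sub_comm]
        have h2 := huv x hxm _ (hmem _ hk) hx.2
        have h3 := (abs_nonneg _).trans (huv _ (hmem k hk.le) x hxm hx.1.le)
        exact mul_le_mul (by linarith) (hB x) (abs_nonneg _) (by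
          have := (abs_nonneg _).trans h2; linarith)
    have hvsum : ∑ k ∈ Finset.range m, (v (t (k + 1)) - v (t k)) = v b - v a := by
      rw [Finset.sum_range_sub (fun k => v (t k)), ht0, htm]
    -- Summation by parts; there is no boundary term at a because F 0 = 0.
    have habel : ∑ k ∈ Finset.range m, u (t (k + 1)) * (F (k + 1) - F k) =
        u b * (∫ x in a..b, Θ x) - ∑ k ∈ Finset.range m, F k * (u (t (k + 1)) - u (t k)) := by
      have h1 : ∑ k ∈ Finset.range m, (u (t (k + 1)) * F (k + 1) - u (t k) * F k) =
          u b * (∫ x in a..b, Θ x) := by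
        rw [Finset.sum_range_sub (fun k => u (t k) * F k)]
        simp [hF, ht0, htm]
      rw [← h1, ← Finset.sum_sub_distrib]
      exact Finset.sum_congr rfl fun k _ => by ring
    have h1 : |∑ k ∈ Finset.range m, u (t (k + 1)) * (F (k + 1) - F k)| ≤
        c * (v b - v a) + |u b| * |∫ x in a..b, Θ x| := by
      rw [habel]
      refine (abs_sub _ _).trans ?_
      rw [abs_mul, add_comm, ← hvsum, Finset.mul_sum]
      gcongr
      refine (Finset.abs_sum_le_sum_abs _ _).trans (Finset.sum_le_sum fun k hk => ?_)
      have hk' := Finset.mem_range.1 hk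
      rw [abs_mul]
      have h2 := huv _ (hmem k hk'.le) _ (hmem _ hk') (htmono (Nat.le_succ k))
      exact mul_le_mul (hc _ (hmem k hk'.le)) h2 (abs_nonneg _)
        ((abs_nonneg _).trans (hc _ (hmem k hk'.le)))
    have h2 : |(∫ x in a..b, u x * Θ x) - ∑ k ∈ Finset.range m, u (t (k + 1)) * (F (k + 1) - F k)|
        ≤ (v b - v a) * (B * (b - a)) / m := by
      rw [hsum1, ← Finset.sum_sub_distrib]
      refine (Finset.abs_sum_le_sum_abs _ _).trans ((Finset.sum_le_sum fun k hk =>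
        hpiece k (Finset.mem_range.1 hk)).trans_eq ?_)
      rw [← Finset.sum_mul, ← Finset.sum_mul, hvsum, hδ]
      ring
    have h3 := abs_sub_abs_le_abs_sub (∫ x in a..b, u x * Θ x)
      (∑ k ∈ Finset.range m, u (t (k + 1)) * (F (k + 1) - F k))
    linarith
  have hlim : Tendsto (fun m : ℕ => c * (v b - v a) + |u b| * |∫ x in a..b, Θ x| +
      (v b - v a) * (B * (b - a)) / m) atTop
      (𝓝 (c * (v b - v a) + |u b| * |∫ x in a..b, Θ x| + 0)) :=
    tendsto_const_nhds.add (tendsto_const_div_atTop_nhds_zero_nat _)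
  rw [add_zero] at hlim
  exact ge_of_tendsto hlim ((eventually_gt_atTop 0).mono fun m hm => main m hm)

/-! ### Lines in the cube -/

section Lines

variable {n : ℕ}

/-- The point of the cube with `i`-th coordinate `t` and other coordinates `y`. -/
abbrev ins (i : Fin (n + 1)) (t : unitInterval) (y : Fin n → unitInterval) : Cube n :=
  i.insertNth t y

theorem measurePreserving_ins (i : Fin (n + 1)) :
    MeasurePreserving (fun p : unitInterval × (Fin n → unitInterval) => ins i p.1 p.2)
      (volume.prod volume) volume :=
  (volume_preserving_piFinSuccAbove (fun _ : Fin (n + 1) => unitInterval) i).symm _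

theorem measurable_ins (i : Fin (n + 1)) :
    Measurable fun p : unitInterval × (Fin n → unitInterval) => ins i p.1 p.2 :=
  (measurePreserving_ins i).measurable

theorem measurable_ins_left (i : Fin (n + 1)) (y : Fin n → unitInterval) :
    Measurable fun t => ins i t y :=
  (measurable_ins i).comp (measurable_id.prodMk measurable_const)

theorem integrable_comp_ins (i : Fin (n + 1)) {F : Cube n → ℝ} (hF : Integrable F) :
    Integrable (fun p : unitInterval × (Fin n → unitInterval) => F (ins i p.1 p.2))
      (volume.prod volume) :=
  (measurePreserving_ins i).integrable_comp_of_integrable hF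

theorem integral_eq_integral_ins (i : Fin (n + 1)) {F : Cube n → ℝ} (hF : Integrable F) :
    ∫ x, F x = ∫ y, ∫ τ, F (ins i τ y) := by
  have h1 := (measurePreserving_ins i).integral_comp
    ((MeasurableEquiv.piFinSuccAbove (fun _ : Fin (n + 1) => unitInterval) i).symm.measurableEmbedding)
    F
  rw [← h1]
  exact integral_prod_symm _ (integrable_comp_ins i hF)

theorem ae_integrable_ins (i : Fin (n + 1)) {F : Cube n → ℝ} (hF : Integrable F) :
    ∀ᵐ y, Integrable fun τ => F (ins i τ y) :=
  (integrable_comp_ins i hF).prod_left_ae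

theorem setIntegral_Iic_eq (u : unitInterval → ℝ) (t : unitInterval) :
    ∫ τ in Set.Iic t, u τ = ∫ x in (0 : ℝ)..t, u (Set.projIcc 0 1 zero_le_one x) := by
  have h1 : ∫ τ in Set.Iic t, u τ =
      ∫ τ : unitInterval, (Set.Iic (t : ℝ)).indicator
        (fun x => u (Set.projIcc 0 1 zero_le_one x)) (τ : ℝ) := by
    rw [← integral_indicator measurableSet_Iic]
    refine integral_congr_ae (Eventually.of_forall fun τ => ?_)
    dsimp only
    by_cases hτ : τ ≤ t
    · rw [Set.indicator_of_mem (show τ ∈ Set.Iic t from hτ),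
        Set.indicator_of_mem (show (τ : ℝ) ∈ Set.Iic (t : ℝ) from hτ), Set.projIcc_val]
    · rw [Set.indicator_of_notMem (show τ ∉ Set.Iic t from hτ),
        Set.indicator_of_notMem (show (τ : ℝ) ∉ Set.Iic (t : ℝ) from hτ)]
  rw [h1]
  have h2 := integral_subtype_comap (μ := (volume : Measure ℝ)) (s := Set.Icc (0 : ℝ) 1)
    measurableSet_Icc ((Set.Iic (t : ℝ)).indicator fun x => u (Set.projIcc 0 1 zero_le_one x))
  refine h2.trans ?_
  rw [setIntegral_indicator measurableSet_Iic, intervalIntegral.integral_of_le t.2.1,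
    ← integral_Icc_eq_integral_Ioc]
  congr 2
  ext x
  simp only [Set.mem_inter_iff, Set.mem_Icc, Set.mem_Iic]
  have := t.2.2
  constructor
  · rintro ⟨⟨h1, -⟩, h3⟩; exact ⟨h1, h3⟩
  · rintro ⟨h1, h3⟩; exact ⟨⟨h1, h3.trans this⟩, h3⟩

theorem integral_eq_intervalIntegral (u : unitInterval → ℝ) :
    ∫ τ, u τ = ∫ x in (0 : ℝ)..1, u (Set.projIcc 0 1 zero_le_one x) := by
  have h := setIntegral_Iic_eq u 1
  have h1 : Set.Iic (1 : unitInterval) = Set.univ := Set.eq_univ_of_forall fun x => x.2.2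
  rwa [h1, setIntegral_univ, Set.Icc.coe_one] at h

theorem intervalIntegrable_projIcc {u : unitInterval → ℝ} (hu : Integrable u) :
    IntervalIntegrable (fun x => u (Set.projIcc 0 1 zero_le_one x)) volume 0 1 := by
  rw [intervalIntegrable_iff_integrableOn_Icc_of_le zero_le_one]
  have h1 := (measurePreserving_subtype_coe (μa := (volume : Measure ℝ))
    (measurableSet_Icc (a := (0 : ℝ)) (b := 1))).integrable_comp_emb
    (MeasurableEmbedding.subtype_coe measurableSet_Icc)
    (g := fun x => u (Set.projIcc 0 1 zero_le_one x))
  refine h1.1 ?_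
  have h2 : (fun x => u (Set.projIcc 0 1 zero_le_one x)) ∘ ((↑) : Set.Icc (0 : ℝ) 1 → ℝ) = u := by
    funext x
    simp
  rw [h2]
  exact hu

end Lines

/-! ### Test functions and the dual description of the variation -/

section Test

variable {n : ℕ}

/-- Bounded measurable functions all of whose line integrals in direction `i` vanish and whose
primitives in direction `i` are bounded by `c`. -/
structure IsTest (i : Fin (n + 1)) (c : ℝ) (θ : Cube n → ℝ) : Prop where
  measurable : Measurable θ
  bounded : ∃ B, ∀ x, |θ x| ≤ B
  primitive : ∀ y t, |∫ τ in Set.Iic t, θ (ins i τ y)| ≤ c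
  total : ∀ y, ∫ τ, θ (ins i τ y) = 0

/-- The variation in direction `i`, as a supremum over test functions. -/
def testVar (i : Fin (n + 1)) (h : L1 n) : ℝ≥0∞ :=
  ⨆ (θ : Cube n → ℝ) (_ : IsTest i 1 θ), ENNReal.ofReal (∫ x, h x * θ x)

theorem IsTest.const_mul {i : Fin (n + 1)} {c : ℝ} {θ : Cube n → ℝ} (hθ : IsTest i c θ) (a : ℝ) :
    IsTest i (|a| * c) fun x => a * θ x where
  measurable := hθ.measurable.const_mul a
  bounded := by
    obtain ⟨B, hB⟩ := hθ.bounded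
    exact ⟨|a| * B, fun x => by
      rw [abs_mul]; exact mul_le_mul_of_nonneg_left (hB x) (abs_nonneg a)⟩
  primitive y t := by
    rw [integral_const_mul, abs_mul]
    exact mul_le_mul_of_nonneg_left (hθ.primitive y t) (abs_nonneg a)
  total y := by rw [integral_const_mul, hθ.total, mul_zero]

theorem IsTest.ofReal_integral_le {i : Fin (n + 1)} {c : ℝ} (hc : 0 < c) {θ : Cube n → ℝ}
    (hθ : IsTest i c θ) (h : L1 n) :
    ENNReal.ofReal (∫ x, h x * θ x) ≤ ENNReal.ofReal c * testVar i h := by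
  have h1 : IsTest i 1 fun x => c⁻¹ * θ x := by
    have := hθ.const_mul c⁻¹
    rwa [abs_of_pos (inv_pos.2 hc), inv_mul_cancel₀ hc.ne'] at this
  have h2 : ENNReal.ofReal (∫ x, h x * (c⁻¹ * θ x)) ≤ testVar i h :=
    le_iSup₂ (f := fun θ (_ : IsTest i 1 θ) => ENNReal.ofReal (∫ x, h x * θ x)) _ h1
  have h3 : ∫ x, h x * θ x = c * ∫ x, h x * (c⁻¹ * θ x) := by
    rw [← integral_const_mul]
    refine integral_congr_ae (Eventually.of_forall fun x => ?_)
    have : c ≠ 0 := hc.ne'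
    field_simp
  rw [h3, ENNReal.ofReal_mul hc.le]
  gcongr

theorem integral_le_of_testVar {i : Fin (n + 1)} {θ : Cube n → ℝ} (hθ : IsTest i 1 θ) (h : L1 n) :
    ENNReal.ofReal (∫ x, h x * θ x) ≤ testVar i h :=
  le_iSup₂ (f := fun θ (_ : IsTest i 1 θ) => ENNReal.ofReal (∫ x, h x * θ x)) _ hθ

theorem testVar_add_le (i : Fin (n + 1)) (h g : L1 n) :
    testVar i (h + g) ≤ testVar i h + testVar i g := by
  refine iSup₂_le fun θ hθ => ?_
  obtain ⟨B, hB⟩ := hθ.bounded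
  have h1 := map_add (pairing θ hθ.measurable B hB) h g
  simp only [pairing_apply] at h1
  rw [h1]
  exact ENNReal.ofReal_add_le.trans
    (add_le_add (integral_le_of_testVar hθ h) (integral_le_of_testVar hθ g))

theorem testVar_smul_le (i : Fin (n + 1)) (a : ℝ) (h : L1 n) :
    testVar i (a • h) ≤ ENNReal.ofReal |a| * testVar i h := by
  refine iSup₂_le fun θ hθ => ?_
  obtain ⟨B, hB⟩ := hθ.bounded
  have h1 := map_smul (pairing θ hθ.measurable B hB) a h
  simp only [pairing_apply, smul_eq_mul] at h1
  -- Moving a into the test function and rescaling needs |a| > 0.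
  rcases eq_or_ne a 0 with rfl | ha
  · rw [h1]; simp
  have h2 : ∫ x, h x * (a * θ x) = a * ∫ x, h x * θ x := by
    rw [← integral_const_mul]
    exact integral_congr_ae (Eventually.of_forall fun x => by ring)
  rw [h1, ← h2]
  exact IsTest.ofReal_integral_le (abs_pos.2 ha) (by simpa using hθ.const_mul a) h

/-- A supremum of continuous functions of h. This, hidden in the definition as an infimum over
representatives, is a main gain of the dual description. -/
theorem lowerSemicontinuous_testVar (i : Fin (n + 1)) :
    LowerSemicontinuous (testVar i : L1 n → ℝ≥0∞) := by
  refine lowerSemicontinuous_iSup fun θ => lowerSemicontinuous_iSup fun hθ => ?_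
  obtain ⟨B, hB⟩ := hθ.bounded
  have h1 : (fun h : L1 n => ENNReal.ofReal (∫ x, h x * θ x)) =
      fun h => ENNReal.ofReal (pairing θ hθ.measurable B hB h) := rfl
  rw [h1]
  exact (ENNReal.continuous_ofReal.comp (pairing θ hθ.measurable B hB).continuous).lowerSemicontinuous

/-- The one-dimensional estimate on the unit interval. -/
theorem abs_integral_mul_le_eVariationOn {u θ : unitInterval → ℝ}
    (hu : eVariationOn u Set.univ ≠ ∞) (hui : Integrable u) (hθ : Measurable θ) {B c : ℝ}
    (hB : ∀ x, |θ x| ≤ B) (hc : ∀ t, |∫ τ in Set.Iic t, θ τ| ≤ c) (h0 : ∫ τ, θ τ = 0) :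
    |∫ τ, u τ * θ τ| ≤ c * (eVariationOn u Set.univ).toReal := by
  set p : ℝ → unitInterval := Set.projIcc 0 1 zero_le_one with hp
  have hloc : LocallyBoundedVariationOn u Set.univ :=
    BoundedVariationOn.locallyBoundedVariationOn hu
  -- The variation from 0 dominates the increments of u. As θ has integral zero, the boundary term
  -- at 1 vanishes.
  set v : ℝ → ℝ := fun x => variationOnFromTo u Set.univ 0 (p x) with hv
  have hθi : Integrable θ := Integrable.of_bound hθ.aestronglyMeasurable B
    (Eventually.of_forall fun x => by simpa using hB x)
  have huθ : Integrable fun τ => u τ * θ τ :=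
    hui.mul_bdd (c := B) hθ.aestronglyMeasurable (Eventually.of_forall fun x => by simpa using hB x)
  have h1 := abs_integral_mul_le_of_variation (a := 0) (b := 1) (B := B) (c := c) zero_le_one
    (u := fun x => u (p x)) (v := v) (Θ := fun x => θ (p x))
    (intervalIntegrable_projIcc hθi) (fun x => hB _) (intervalIntegrable_projIcc huθ)
    (fun s _ t _ hst => ?_) (fun t ht => ?_)
  · rw [← integral_eq_intervalIntegral θ, h0, abs_zero, mul_zero, add_zero,
      ← integral_eq_intervalIntegral (fun τ => u τ * θ τ)] at h1
    refine h1.trans_eq ?_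
    have hp0 : p 0 = 0 := Set.projIcc_left _
    have hp1 : p 1 = 1 := Set.projIcc_right _
    have huniv : Set.univ ∩ Set.Icc (0 : unitInterval) 1 = Set.univ := by
      ext x
      exact ⟨fun _ => trivial, fun _ => ⟨trivial, x.2.1, x.2.2⟩⟩
    simp only [hv, hp0, hp1, variationOnFromTo.self, sub_zero]
    rw [variationOnFromTo.eq_of_le u Set.univ (zero_le_one : (0 : unitInterval) ≤ 1), huniv]
  · have hst' : p s ≤ p t := Set.monotone_projIcc _ hst
    have h2 := variationOnFromTo.add hloc (Set.mem_univ (0 : unitInterval)) (Set.mem_univ (p s))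
      (Set.mem_univ (p t))
    simp only [hv]
    rw [← h2, add_sub_cancel_left, variationOnFromTo.eq_of_le u Set.univ hst', ← Real.dist_eq,
      dist_comm, dist_edist]
    refine ENNReal.toReal_mono (hloc _ _ (Set.mem_univ _) (Set.mem_univ _)) ?_
    exact eVariationOn.edist_le u ⟨trivial, le_rfl, hst'⟩ ⟨trivial, hst', le_rfl⟩
  · have h2 := setIntegral_Iic_eq θ ⟨t, ht⟩
    rw [← h2]
    exact hc _

/-- For any representative with finite integrated line variation, the one-dimensional estimate holds
on almost every line, and Fubini sums the lines up. -/
theorem testVar_le_dirVariation (i : Fin (n + 1)) (h : L1 n) :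
    testVar i h ≤ dirVariation i h := by
  refine iSup₂_le fun θ hθ => le_iInf₂ fun g hg => le_iInf fun hgm => ?_
  obtain ⟨B, hB⟩ := hθ.bounded
  rcases eq_or_ne (∫⁻ y, lineVariation i g y) ∞ with htop | htop
  · rw [htop]; exact le_top
  have hfin := ae_lt_top' hgm htop
  have hgi : Integrable g := (L1.integrable_coeFn h).congr hg.symm
  have hgθ : Integrable fun x => g x * θ x := integrable_mul_of_bounded hgi hθ.measurable hB
  have h1 : ∫ x, h x * θ x = ∫ y, ∫ τ, g (ins i τ y) * θ (ins i τ y) := by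
    rw [← integral_eq_integral_ins i hgθ]
    exact integral_congr_ae (hg.mono fun x hx => by simp only [hx])
  calc ENNReal.ofReal (∫ x, h x * θ x) ≤ ‖∫ x, h x * θ x‖ₑ := by
        rw [Real.enorm_eq_ofReal_abs]
        exact ENNReal.ofReal_le_ofReal (le_abs_self _)
    _ ≤ ∫⁻ y, ‖∫ τ, g (ins i τ y) * θ (ins i τ y)‖ₑ := by
        rw [h1]; exact enorm_integral_le_lintegral_enorm _
    _ ≤ ∫⁻ y, lineVariation i g y := by
        refine lintegral_mono_ae ?_
        filter_upwards [hfin, ae_integrable_ins i hgi] with y hy hyi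
        rw [Real.enorm_eq_ofReal_abs]
        have h2 := abs_integral_mul_le_eVariationOn (u := fun τ => g (ins i τ y))
          (θ := fun τ => θ (ins i τ y)) hy.ne hyi
          (hθ.measurable.comp (measurable_ins_left i y)) (fun x => hB _) (hθ.primitive y)
          (hθ.total y)
        rw [one_mul] at h2
        exact (ENNReal.ofReal_le_ofReal h2).trans ENNReal.ofReal_toReal_le

end Test

/-! ### Averaging over pieces of lines -/

section Averaging

variable {n : ℕ} {ι : Type*}

/-- The part of the line through `y` in direction `i` on which the label is `s`. -/
def linePiece (i : Fin (n + 1)) (κ : Cube n → ι) (s : ι) (y : Fin n → unitInterval) :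
    Set unitInterval :=
  {τ | κ (ins i τ y) = s}

/-- The average of `θ` over the piece with label `s` of the line through `y`. -/
def pieceAvg (i : Fin (n + 1)) (κ : Cube n → ι) (θ : Cube n → ℝ) (s : ι)
    (y : Fin n → unitInterval) : ℝ :=
  (volume.real (linePiece i κ s y))⁻¹ * ∫ τ in linePiece i κ s y, θ (ins i τ y)

/-- The average of `θ` over the piece of line with constant label through a point. -/
def lineAvg (i : Fin (n + 1)) (κ : Cube n → ι) (θ : Cube n → ℝ) (x : Cube n) : ℝ :=
  pieceAvg i κ θ (κ x) (i.removeNth x)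

theorem lineAvg_ins (i : Fin (n + 1)) (κ : Cube n → ι) (θ : Cube n → ℝ) (τ : unitInterval)
    (y : Fin n → unitInterval) :
    lineAvg i κ θ (ins i τ y) = pieceAvg i κ θ (κ (ins i τ y)) y := by
  simp [lineAvg, ins]

theorem abs_pieceAvg_le (i : Fin (n + 1)) (κ : Cube n → ι) {θ : Cube n → ℝ} {B : ℝ}
    (hB : ∀ x, |θ x| ≤ B) (s : ι) (y : Fin n → unitInterval) : |pieceAvg i κ θ s y| ≤ B := by
  have hB0 : 0 ≤ B := (abs_nonneg _).trans (hB 0)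
  have h1 : |∫ τ in linePiece i κ s y, θ (ins i τ y)| ≤ B * volume.real (linePiece i κ s y) := by
    rw [← Real.norm_eq_abs]
    exact norm_setIntegral_le_of_norm_le_const (measure_lt_top _ _) fun τ _ => hB _
  rw [pieceAvg, abs_mul, abs_inv, abs_of_nonneg measureReal_nonneg]
  -- On a null piece the average is 0, by the convention 0⁻¹ = 0.
  rcases eq_or_ne (volume.real (linePiece i κ s y)) 0 with h0 | h0
  · rw [h0]; simpa
  · have hpos : 0 < volume.real (linePiece i κ s y) := lt_of_le_of_ne measureReal_nonneg h0.symm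
    rw [inv_mul_le_iff₀ hpos, mul_comm]
    exact h1

theorem abs_pieceAvg_mul_le (i : Fin (n + 1)) (κ : Cube n → ι) (θ : Cube n → ℝ) (s : ι)
    (y : Fin n → unitInterval) :
    |pieceAvg i κ θ s y| * volume.real (linePiece i κ s y) ≤
      |∫ τ in linePiece i κ s y, θ (ins i τ y)| := by
  rw [pieceAvg, abs_mul, abs_inv, abs_of_nonneg measureReal_nonneg]
  rcases eq_or_ne (volume.real (linePiece i κ s y)) 0 with h0 | h0
  · rw [h0]; simp
  · rw [mul_comm, ← mul_assoc, mul_inv_cancel₀ h0, one_mul]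

theorem pieceAvg_mul (i : Fin (n + 1)) (κ : Cube n → ι) (θ : Cube n → ℝ) (s : ι)
    (y : Fin n → unitInterval) :
    pieceAvg i κ θ s y * volume.real (linePiece i κ s y) =
      ∫ τ in linePiece i κ s y, θ (ins i τ y) := by
  rw [pieceAvg]
  rcases eq_or_ne (volume.real (linePiece i κ s y)) 0 with h0 | h0
  · rw [h0, mul_zero, Measure.restrict_eq_zero.2, integral_zero_measure]
    rwa [measureReal_eq_zero_iff] at h0
  · rw [mul_comm, ← mul_assoc, mul_inv_cancel₀ h0, one_mul]

variable [MeasurableSpace ι] [MeasurableSingletonClass ι]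

theorem measurableSet_linePiece {i : Fin (n + 1)} {κ : Cube n → ι} (hκ : Measurable κ) (s : ι)
    (y : Fin n → unitInterval) : MeasurableSet (linePiece i κ s y) :=
  (hκ.comp (measurable_ins_left i y)) (measurableSet_singleton s)

theorem measurable_setIntegral_linePiece {i : Fin (n + 1)} {κ : Cube n → ι} (hκ : Measurable κ)
    {θ : Cube n → ℝ} (hθ : Measurable θ) (s : ι) :
    Measurable fun y => ∫ τ in linePiece i κ s y, θ (ins i τ y) := by
  have h1 : ∀ y, ∫ τ in linePiece i κ s y, θ (ins i τ y) =
      ∫ τ, (κ ⁻¹' {s}).indicator θ (ins i τ y) := by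
    intro y
    rw [← integral_indicator (measurableSet_linePiece hκ s y)]
    rfl
  simp only [h1]
  have h2 : StronglyMeasurable fun p : unitInterval × (Fin n → unitInterval) =>
      (κ ⁻¹' {s}).indicator θ (ins i p.1 p.2) :=
    ((hθ.indicator (hκ (measurableSet_singleton s))).comp (measurable_ins i)).stronglyMeasurable
  exact h2.integral_prod_left'.measurable

theorem measurable_pieceAvg {i : Fin (n + 1)} {κ : Cube n → ι} (hκ : Measurable κ)
    {θ : Cube n → ℝ} (hθ : Measurable θ) (s : ι) : Measurable (pieceAvg i κ θ s) := by
  have h1 : ∀ y, volume.real (linePiece i κ s y) = ∫ τ in linePiece i κ s y, (1 : ℝ) := by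
    intro y; simp
  unfold pieceAvg
  simp only [h1]
  exact (measurable_setIntegral_linePiece hκ (θ := fun _ => 1) measurable_const s).inv.mul
    (measurable_setIntegral_linePiece hκ hθ s)

theorem measurable_removeNth (i : Fin (n + 1)) :
    Measurable fun x : Cube n => (i.removeNth x : Fin n → unitInterval) :=
  measurable_pi_lambda _ fun j => measurable_pi_apply (i.succAbove j)

theorem measurable_lineAvg [Countable ι] {i : Fin (n + 1)} {κ : Cube n → ι} (hκ : Measurable κ)
    {θ : Cube n → ℝ} (hθ : Measurable θ) : Measurable (lineAvg i κ θ) := by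
  have h1 : Measurable fun p : ι × (Fin n → unitInterval) => pieceAvg i κ θ p.1 p.2 :=
    measurable_from_prod_countable_right fun s => measurable_pieceAvg hκ hθ s
  have h2 : Measurable fun x : Cube n => (κ x, (i.removeNth x : Fin n → unitInterval)) :=
    hκ.prodMk (measurable_removeNth i)
  have h3 : lineAvg i κ θ = (fun p : ι × (Fin n → unitInterval) => pieceAvg i κ θ p.1 p.2) ∘
      fun x : Cube n => (κ x, (i.removeNth x : Fin n → unitInterval)) := by
    funext x
    rfl
  rw [h3]
  exact h1.comp h2

/-- Subtracting averages over finitely many pieces turns a function whose integrals over initial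
segments of pieces are bounded into a test function. -/
theorem isTest_sub_lineAvg [Fintype ι] {i : Fin (n + 1)} {κ : Cube n → ι} (hκ : Measurable κ)
    (hord : ∀ s y, (linePiece i κ s y).OrdConnected) {θ : Cube n → ℝ} (hθ : Measurable θ)
    {B c : ℝ} (hB : ∀ x, |θ x| ≤ B)
    (hc : ∀ s y t, |∫ τ in linePiece i κ s y ∩ Set.Iic t, θ (ins i τ y)| ≤ c) :
    IsTest i (2 * c) fun x => θ x - lineAvg i κ θ x := by
  have hψm : Measurable fun x => θ x - lineAvg i κ θ x := hθ.sub (measurable_lineAvg hκ hθ)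
  have hψb : ∀ x, |θ x - lineAvg i κ θ x| ≤ 2 * B := fun x => by
    have h1 := abs_sub (θ x) (lineAvg i κ θ x)
    have h2 : |lineAvg i κ θ x| ≤ B := abs_pieceAvg_le i κ hB _ _
    linarith [hB x]
  have hIic1 : Set.Iic (1 : unitInterval) = Set.univ := Set.eq_univ_of_forall fun x => x.2.2
  have hint : ∀ (g : Cube n → ℝ) (C : ℝ), Measurable g → (∀ x, |g x| ≤ C) → ∀ y,
      Integrable fun τ => g (ins i τ y) := fun g C hg hC y =>
    Integrable.of_bound (hg.comp (measurable_ins_left i y)).aestronglyMeasurable C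
      (Eventually.of_forall fun τ => by simpa using hC _)
  have hsplit : ∀ y (S : Set unitInterval), MeasurableSet S →
      ∫ τ in S, (θ (ins i τ y) - lineAvg i κ θ (ins i τ y)) =
        ∑ s, ∫ τ in linePiece i κ s y ∩ S, (θ (ins i τ y) - lineAvg i κ θ (ins i τ y)) := by
    intro y S hS
    have hU : S = ⋃ s, linePiece i κ s y ∩ S := by
      ext τ; simp [linePiece]
    conv_lhs => rw [hU]
    refine integral_iUnion_fintype
      (fun s => (measurableSet_linePiece hκ s y).inter hS) ?_
      fun s => (hint _ _ hψm hψb y).integrableOn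
    intro s s' hss'
    refine Set.disjoint_left.2 fun τ h1 h2 => hss' ?_
    exact (show κ (ins i τ y) = s from h1.1).symm.trans h2.1
  have hpiece : ∀ y s (S : Set unitInterval), MeasurableSet S →
      ∫ τ in linePiece i κ s y ∩ S, (θ (ins i τ y) - lineAvg i κ θ (ins i τ y)) =
        (∫ τ in linePiece i κ s y ∩ S, θ (ins i τ y)) -
          pieceAvg i κ θ s y * volume.real (linePiece i κ s y ∩ S) := by
    intro y s S hS
    have hm := (measurableSet_linePiece (i := i) hκ s y).inter hS
    have h1 : ∫ τ in linePiece i κ s y ∩ S, (θ (ins i τ y) - lineAvg i κ θ (ins i τ y)) =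
        ∫ τ in linePiece i κ s y ∩ S, (θ (ins i τ y) - pieceAvg i κ θ s y) := by
      refine setIntegral_congr_fun hm fun τ hτ => ?_
      have h2 : κ (ins i τ y) = s := hτ.1
      simp only [lineAvg_ins, h2]
    rw [h1, integral_sub (hint θ B hθ hB y).integrableOn (integrable_const _)]
    simp [mul_comm]
  have hwhole : ∀ y s (S : Set unitInterval), MeasurableSet S → linePiece i κ s y ⊆ S →
      ∫ τ in linePiece i κ s y ∩ S, (θ (ins i τ y) - lineAvg i κ θ (ins i τ y)) = 0 := by
    intro y s S hS hsub
    rw [hpiece y s S hS, Set.inter_eq_left.2 hsub, pieceAvg_mul, sub_self]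
  refine ⟨hψm, ⟨2 * B, hψb⟩, fun y t => ?_, fun y => ?_⟩
  -- Only the piece that contains t contributes: pieces wholly below t have integral zero, and a
  -- piece that reaches beyond t without containing t lies above t, because pieces are
  -- order-connected. On the remaining piece θ and its average contribute at most c each.
  · rw [hsplit y _ measurableSet_Iic, Finset.sum_eq_single (κ (ins i t y))]
    · rw [hpiece y _ _ measurableSet_Iic]
      refine (abs_sub _ _).trans ?_
      have h1 := hc (κ (ins i t y)) y t
      have h2 := hc (κ (ins i t y)) y 1
      rw [hIic1, Set.inter_univ] at h2
      have h3 := abs_pieceAvg_mul_le i κ θ (κ (ins i t y)) y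
      have h4 : volume.real (linePiece i κ (κ (ins i t y)) y ∩ Set.Iic t) ≤
          volume.real (linePiece i κ (κ (ins i t y)) y) :=
        measureReal_mono Set.inter_subset_left
      rw [abs_mul, abs_of_nonneg (measureReal_nonneg (s := _ ∩ _))]
      have h5 := mul_le_mul_of_nonneg_left h4 (abs_nonneg (pieceAvg i κ θ (κ (ins i t y)) y))
      linarith
    · intro s _ hs
      by_cases hsub : linePiece i κ s y ⊆ Set.Iic t
      · exact hwhole y s _ measurableSet_Iic hsub
      · obtain ⟨τ, hτ, hτt⟩ := Set.not_subset.1 hsub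
        have hempty : linePiece i κ s y ∩ Set.Iic t = ∅ := by
          refine Set.eq_empty_of_forall_notMem fun τ' hτ' => hs ?_
          have : t ∈ linePiece i κ s y :=
            (hord s y).out hτ'.1 hτ ⟨hτ'.2, (not_le.1 hτt).le⟩
          exact this.symm
        rw [hempty, setIntegral_empty]
    · intro h; exact (h (Finset.mem_univ _)).elim
  · rw [← setIntegral_univ, hsplit y _ MeasurableSet.univ]
    exact Finset.sum_eq_zero fun s _ => hwhole y s _ MeasurableSet.univ (Set.subset_univ _)

end Averaging

/-! ### Uniform grids and compactness -/

section Grid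

variable {n : ℕ}

/-- The index of the interval of length `1 / m` that contains the `i`-th coordinate. -/
def gridLabel (i : Fin (n + 1)) (m : ℕ) (x : Cube n) : Fin (m + 1) :=
  ⟨⌊(m : ℝ) * x i⌋₊, Nat.lt_succ_of_le (Nat.floor_le_of_le
    (mul_le_of_le_one_right (Nat.cast_nonneg m) (x i).2.2))⟩

theorem measurable_gridLabel (i : Fin (n + 1)) (m : ℕ) :
    Measurable (gridLabel i m : Cube n → Fin (m + 1)) := by
  refine measurable_to_countable' fun k => ?_
  have h1 : Measurable fun x : Cube n => ⌊(m : ℝ) * x i⌋₊ :=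
    Nat.measurable_floor.comp ((measurable_subtype_coe.comp (measurable_pi_apply i)).const_mul _)
  have h2 : (gridLabel i m : Cube n → Fin (m + 1)) ⁻¹' {k} =
      (fun x : Cube n => ⌊(m : ℝ) * x i⌋₊) ⁻¹' {(k : ℕ)} := by
    ext x
    simp [gridLabel, Fin.ext_iff]
  rw [h2]
  exact h1 (measurableSet_singleton _)

theorem mem_linePiece_gridLabel {i : Fin (n + 1)} {m : ℕ} {k : Fin (m + 1)}
    {y : Fin n → unitInterval} {τ : unitInterval} :
    τ ∈ linePiece i (gridLabel i m) k y ↔ ⌊(m : ℝ) * τ⌋₊ = k := by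
  simp [linePiece, gridLabel, ins, Fin.ext_iff]

theorem ordConnected_linePiece_gridLabel (i : Fin (n + 1)) (m : ℕ) (k : Fin (m + 1))
    (y : Fin n → unitInterval) : (linePiece i (gridLabel i m) k y).OrdConnected := by
  refine ⟨fun τ hτ τ' hτ' t ht => ?_⟩
  rw [mem_linePiece_gridLabel] at *
  have hm : (0 : ℝ) ≤ m := Nat.cast_nonneg m
  have h1 : ⌊(m : ℝ) * τ⌋₊ ≤ ⌊(m : ℝ) * t⌋₊ :=
    Nat.floor_mono (mul_le_mul_of_nonneg_left ht.1 hm)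
  have h2 : ⌊(m : ℝ) * t⌋₊ ≤ ⌊(m : ℝ) * τ'⌋₊ :=
    Nat.floor_mono (mul_le_mul_of_nonneg_left ht.2 hm)
  omega

theorem volume_preimage_coe_le (A : Set ℝ) (hA : MeasurableSet A) :
    volume ((↑) ⁻¹' A : Set unitInterval) ≤ volume A := by
  have h1 := (measurePreserving_subtype_coe (μa := (volume : Measure ℝ))
    (measurableSet_Icc (a := (0 : ℝ)) (b := 1))).measure_preimage hA.nullMeasurableSet
  exact h1.trans_le (Measure.restrict_apply_le _ _)

theorem volume_linePiece_gridLabel_le (i : Fin (n + 1)) {m : ℕ} (hm : 0 < m) (k : Fin (m + 1))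
    (y : Fin n → unitInterval) :
    volume.real (linePiece i (gridLabel i m) k y) ≤ 1 / m := by
  have hm0 : (0 : ℝ) < m := by exact_mod_cast hm
  have h1 : linePiece i (gridLabel i m) k y ⊆
      (↑) ⁻¹' (Set.Icc ((k : ℝ) / m) ((k + 1) / m)) := by
    intro τ hτ
    rw [mem_linePiece_gridLabel] at hτ
    have h2 := Nat.floor_le (mul_nonneg hm0.le τ.2.1)
    have h3 := Nat.lt_floor_add_one ((m : ℝ) * τ)
    rw [hτ] at h2 h3
    refine ⟨?_, ?_⟩
    · rw [div_le_iff₀ hm0]; linarith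
    · rw [le_div_iff₀ hm0]; linarith
  have h2 : volume (linePiece i (gridLabel i m) k y) ≤ ENNReal.ofReal (1 / m) := by
    refine (measure_mono h1).trans ((volume_preimage_coe_le _ measurableSet_Icc).trans_eq ?_)
    rw [Real.volume_Icc]
    congr 1
    ring
  exact ENNReal.toReal_le_of_le_ofReal (by positivity) h2

/-- Integrals of a function bounded by 1 over parts of a grid interval are at most its length 1/m.
-/
theorem isTest_sub_gridAvg (i : Fin (n + 1)) {m : ℕ} (hm : 0 < m) {ξ : Cube n → ℝ}
    (hξ : Measurable ξ) (hb : ∀ x, |ξ x| ≤ 1) :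
    IsTest i (2 * (1 / m)) fun x => ξ x - lineAvg i (gridLabel i m) ξ x := by
  refine isTest_sub_lineAvg (measurable_gridLabel i m)
    (fun k y => ordConnected_linePiece_gridLabel i m k y) hξ hb fun k y t => ?_
  have h1 : ‖∫ τ in linePiece i (gridLabel i m) k y ∩ Set.Iic t, ξ (ins i τ y)‖ ≤
      1 * volume.real (linePiece i (gridLabel i m) k y ∩ Set.Iic t) :=
    norm_setIntegral_le_of_norm_le_const (measure_lt_top _ _) fun τ _ => by simpa using hb _
  rw [Real.norm_eq_abs, one_mul] at h1
  exact h1.trans ((measureReal_mono Set.inter_subset_left).trans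
    (volume_linePiece_gridLabel_le i hm k y))

/-- Averaging over grid intervals in the directions of a list, one after the other. -/
def gridAvg (m : ℕ) (l : List (Fin (n + 1))) (ξ : Cube n → ℝ) : Cube n → ℝ :=
  l.foldr (fun i ξ => lineAvg i (gridLabel i m) ξ) ξ

theorem measurable_gridAvg (m : ℕ) (l : List (Fin (n + 1))) {ξ : Cube n → ℝ} (hξ : Measurable ξ) :
    Measurable (gridAvg m l ξ) := by
  induction l with
  | nil => exact hξ
  | cons i l ih => exact measurable_lineAvg (measurable_gridLabel i m) ih

theorem abs_gridAvg_le (m : ℕ) (l : List (Fin (n + 1))) {ξ : Cube n → ℝ} (hb : ∀ x, |ξ x| ≤ 1) :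
    ∀ x, |gridAvg m l ξ x| ≤ 1 := by
  induction l with
  | nil => exact hb
  | cons i l ih => exact fun x => abs_pieceAvg_le i _ ih _ _

/-- Averaging in one more direction changes the function by a test function in that direction with
constant 2/m; the changes telescope along the list. -/
theorem ofReal_integral_sub_gridAvg_le {m : ℕ} (hm : 0 < m) (l : List (Fin (n + 1)))
    {ξ : Cube n → ℝ} (hξ : Measurable ξ) (hb : ∀ x, |ξ x| ≤ 1) (h : L1 n) :
    ENNReal.ofReal (∫ x, h x * (ξ x - gridAvg m l ξ x)) ≤
      (l.map fun i => ENNReal.ofReal (2 * (1 / m)) * testVar i h).sum := by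
  induction l with
  | nil => simp [gridAvg]
  | cons i l ih =>
    have h1 := measurable_gridAvg m l hξ
    have h2 := abs_gridAvg_le m l hb
    have hT := isTest_sub_gridAvg i hm h1 h2
    have hm0 : (0 : ℝ) < m := by exact_mod_cast hm
    have h3 := hT.ofReal_integral_le (by positivity) h
    obtain ⟨B, hB⟩ := hT.bounded
    have h4 : ∫ x, h x * (ξ x - gridAvg m (i :: l) ξ x) =
        (∫ x, h x * (gridAvg m l ξ x - lineAvg i (gridLabel i m) (gridAvg m l ξ) x)) +
          ∫ x, h x * (ξ x - gridAvg m l ξ x) := by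
      rw [← integral_add (integrable_mul h hT.measurable hB) (integrable_mul h
        (θ := fun x => ξ x - gridAvg m l ξ x) (hξ.sub h1)
        (fun x => (abs_sub _ _).trans (add_le_add (hb x) (h2 x))))]
      refine integral_congr_ae (Eventually.of_forall fun x => ?_)
      simp only [gridAvg, List.foldr_cons]
      ring
    rw [h4, List.map_cons, List.sum_cons]
    exact ENNReal.ofReal_add_le.trans (add_le_add h3 ih)

/-- `ξ` depends on the coordinates in `S` only through their grid labels. -/
def DependsOnLabels (m : ℕ) (S : Finset (Fin (n + 1))) (ξ : Cube n → ℝ) : Prop :=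
  ∀ x x' : Cube n, (∀ i ∈ S, gridLabel i m x = gridLabel i m x') → (∀ i ∉ S, x i = x' i) →
    ξ x = ξ x'

/-- Averaging in direction i leaves only the label of the i-th coordinate. Grid pieces are the same
on all lines, so the dependence on the other coordinates does not get worse. -/
theorem DependsOnLabels.lineAvg {m : ℕ} {S : Finset (Fin (n + 1))} {ξ : Cube n → ℝ}
    (hξ : DependsOnLabels m S ξ) (i : Fin (n + 1)) :
    DependsOnLabels m (insert i S) (lineAvg i (gridLabel i m) ξ) := by
  intro x x' h1 h2
  have hlab : gridLabel i m x = gridLabel i m x' := h1 i (Finset.mem_insert_self i S)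
  have hpiece : linePiece i (gridLabel i m) (gridLabel i m x) (i.removeNth x) =
      linePiece i (gridLabel i m) (gridLabel i m x') (i.removeNth x') := by
    ext τ
    rw [mem_linePiece_gridLabel, mem_linePiece_gridLabel, hlab]
  have hval : ∀ τ, ξ (ins i τ (i.removeNth x)) = ξ (ins i τ (i.removeNth x')) := by
    intro τ
    refine hξ _ _ (fun j hj => ?_) fun j hj => ?_
    · rcases eq_or_ne j i with rfl | hji
      · simp [gridLabel, ins]
      · obtain ⟨k, rfl⟩ := Fin.exists_succAbove_eq hji
        have := h1 _ (Finset.mem_insert_of_mem hj)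
        simpa [gridLabel, ins, Fin.removeNth] using this
    · rcases eq_or_ne j i with rfl | hji
      · simp [ins]
      · obtain ⟨k, rfl⟩ := Fin.exists_succAbove_eq hji
        have := h2 (i.succAbove k) (by simp [hj])
        simpa [ins, Fin.removeNth] using this
  simp only [RandomJablonski.lineAvg, pieceAvg, hpiece, hval]

theorem dependsOnLabels_gridAvg (m : ℕ) (l : List (Fin (n + 1))) (ξ : Cube n → ℝ) :
    DependsOnLabels m l.toFinset (gridAvg m l ξ) := by
  induction l with
  | nil =>
    intro x x' _ h2
    have : x = x' := funext fun i => h2 i (by simp)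
    rw [this]
  | cons i l ih =>
    rw [List.toFinset_cons]
    exact ih.lineAvg i

/-- All grid labels of a point. -/
def cellLabel (m : ℕ) (x : Cube n) : Fin (n + 1) → Fin (m + 1) := fun i => gridLabel i m x

theorem measurable_cellLabel (m : ℕ) :
    Measurable (cellLabel m : Cube n → Fin (n + 1) → Fin (m + 1)) :=
  measurable_pi_lambda _ fun i => measurable_gridLabel i m

theorem measurableSet_cell (m : ℕ) (q : Fin (n + 1) → Fin (m + 1)) :
    MeasurableSet (cellLabel m ⁻¹' {q} : Set (Cube n)) :=
  measurable_cellLabel m (measurableSet_singleton q)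

theorem integral_mul_le_sum_cells {m : ℕ} {ξ : Cube n → ℝ} (hξ : Measurable ξ)
    (hb : ∀ x, |ξ x| ≤ 1) (hdep : DependsOnLabels m Finset.univ ξ) (h : L1 n) :
    ∫ x, h x * ξ x ≤ ∑ q, |∫ x in cellLabel m ⁻¹' {q}, h x| := by
  have hU : (Set.univ : Set (Cube n)) = ⋃ q, cellLabel m ⁻¹' {q} := by
    ext x; simp
  rw [← setIntegral_univ, hU, integral_iUnion_fintype (fun q => measurableSet_cell m q) ?_
    fun q => (integrable_mul h hξ hb).integrableOn]
  · refine Finset.sum_le_sum fun q _ => ?_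
    rcases Set.eq_empty_or_nonempty (cellLabel m ⁻¹' {q} : Set (Cube n)) with he | ⟨x₀, hx₀⟩
    · rw [he]; simp
    · have h1 : ∫ x in cellLabel m ⁻¹' {q}, h x * ξ x =
          ∫ x in cellLabel m ⁻¹' {q}, h x * ξ x₀ := by
        refine setIntegral_congr_fun (measurableSet_cell m q) fun x hx => ?_
        have h2 : cellLabel m x = cellLabel m x₀ :=
          (Set.mem_singleton_iff.1 hx).trans (Set.mem_singleton_iff.1 hx₀).symm
        have h3 : ξ x = ξ x₀ := hdep x x₀ (fun i _ => congrFun h2 i)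
          fun i hi => (hi (Finset.mem_univ i)).elim
        simp only [h3]
      rw [h1, integral_mul_const]
      refine (le_abs_self _).trans ?_
      rw [abs_mul]
      exact mul_le_of_le_one_right (abs_nonneg _) (hb x₀)
  · intro q q' hqq'
    refine Set.disjoint_left.2 fun x h1 h2 => hqq' ?_
    exact (Set.mem_singleton_iff.1 h1).symm.trans (Set.mem_singleton_iff.1 h2)

/-- A Poincaré inequality. The norm is the pairing with the sign of h. Replacing the sign by its
average over grid cells costs 2C/m for each direction, and the average is constant on cells, so what
remains is controlled by the integrals of h over cells. -/
theorem norm_le_sum_cells {m : ℕ} (hm : 0 < m) (h : L1 n) {C : ℝ} (hC : 0 ≤ C)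
    (hV : ∀ i, testVar i h ≤ ENNReal.ofReal C) :
    ‖h‖ ≤ (n + 1) * (2 * C) / m + ∑ q, |∫ x in cellLabel m ⁻¹' {q}, h x| := by
  obtain ⟨ξ, hξ, hb, he⟩ := exists_norm_eq_integral_mul h
  set l := (Finset.univ : Finset (Fin (n + 1))).toList with hl
  have h1 := measurable_gridAvg m l hξ
  have h2 := abs_gridAvg_le m l hb
  have h3 : ∫ x, h x * ξ x = (∫ x, h x * (ξ x - gridAvg m l ξ x)) +
      ∫ x, h x * gridAvg m l ξ x := by
    rw [← integral_add (integrable_mul h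
        (θ := fun x => ξ x - gridAvg m l ξ x) (hξ.sub h1)
        (fun x => (abs_sub _ _).trans (add_le_add (hb x) (h2 x)))) (integrable_mul h h1 h2)]
    exact integral_congr_ae (Eventually.of_forall fun x => by ring)
  have h4 : ∫ x, h x * gridAvg m l ξ x ≤ ∑ q, |∫ x in cellLabel m ⁻¹' {q}, h x| := by
    refine integral_mul_le_sum_cells h1 h2 ?_ h
    have := dependsOnLabels_gridAvg m l ξ
    rwa [hl, Finset.toList_toFinset] at this
  have hm0 : (0 : ℝ) < m := by exact_mod_cast hm
  have h5 : ∫ x, h x * (ξ x - gridAvg m l ξ x) ≤ (n + 1) * (2 * C) / m := by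
    have h6 := ofReal_integral_sub_gridAvg_le hm l hξ hb h
    have h7 : (l.map fun i => ENNReal.ofReal (2 * (1 / m)) * testVar i h).sum ≤
        ENNReal.ofReal ((n + 1) * (2 * C) / m) := by
      rw [hl, Finset.sum_map_toList]
      calc ∑ i, ENNReal.ofReal (2 * (1 / m)) * testVar i h
          ≤ ∑ _i : Fin (n + 1), ENNReal.ofReal (2 * (1 / m)) * ENNReal.ofReal C := by
            gcongr with i; exact hV i
        _ = ENNReal.ofReal ((n + 1) * (2 * C) / m) := by
            rw [Finset.sum_const, Finset.card_univ, Fintype.card_fin, nsmul_eq_mul,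
              ← ENNReal.ofReal_mul (by positivity), ← ENNReal.ofReal_natCast,
              ← ENNReal.ofReal_mul (by positivity)]
            congr 1
            push_cast
            ring
    exact (ENNReal.ofReal_le_ofReal_iff (by positivity)).1 (h6.trans h7)
  rw [he, h3]
  linarith

/-- Bounded sets of functions of bounded variation are totally bounded in `L¹`. -/
theorem totallyBounded_testVar_le (C : ℝ) (hC : 0 ≤ C) :
    TotallyBounded {h : L1 n | ‖h‖ ≤ 1 ∧ ∀ i, testVar i h ≤ ENNReal.ofReal C} := by
  refine Metric.totallyBounded_of_finite_discretization fun ε hε => ?_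
  -- A difference of two elements has variation at most 2C in each direction, so this m makes the
  -- variation term of `norm_le_sum_cells` less than ε/2.
  obtain ⟨m, hm⟩ := exists_nat_gt ((n + 1) * (2 * (2 * C)) / (ε / 2))
  have hm0 : (0 : ℝ) < m := lt_of_le_of_lt (by positivity) hm
  have hm' : 0 < m := by exact_mod_cast hm0
  set N : ℕ := Fintype.card (Fin (n + 1) → Fin (m + 1)) with hN
  have hN0 : (0 : ℝ) < N := by exact_mod_cast Fintype.card_pos
  -- N cell integrals, each known up to δ, account for the other ε/2.
  set δ : ℝ := ε / 2 / N with hδ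
  have hδ0 : 0 < δ := by positivity
  set M : ℤ := ⌈1 / δ⌉ with hM
  have hbd : ∀ h : L1 n, ‖h‖ ≤ 1 → ∀ q : Fin (n + 1) → Fin (m + 1),
      ⌊(∫ x in cellLabel m ⁻¹' {q}, h x) / δ⌋ ∈ Finset.Icc (-M) M := by
    intro h hh q
    have h1 : |∫ x in cellLabel m ⁻¹' {q}, h x| ≤ 1 := by
      have h2 : ∫ x in cellLabel m ⁻¹' {q}, h x =
          ∫ x, h x * (cellLabel m ⁻¹' {q}).indicator (fun _ => (1 : ℝ)) x := by
        rw [← integral_indicator (measurableSet_cell m q)]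
        refine integral_congr_ae (Eventually.of_forall fun x => ?_)
        by_cases hx : x ∈ (cellLabel m ⁻¹' {q} : Set (Cube n)) <;> simp [Set.indicator, hx]
      rw [h2]
      refine (abs_integral_mul_le h (B := 1) (measurable_const.indicator (measurableSet_cell m q))
        fun x => ?_).trans (by simpa using hh)
      by_cases hx : x ∈ (cellLabel m ⁻¹' {q} : Set (Cube n)) <;> simp [Set.indicator, hx]
    rw [abs_le] at h1
    have h3 : (1 / δ : ℝ) ≤ M := Int.le_ceil _
    rw [Finset.mem_Icc]
    constructor
    · rw [Int.le_floor]
      push_cast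
      have : -(1 / δ) ≤ (∫ x in cellLabel m ⁻¹' {q}, h x) / δ := by
        rw [neg_div', div_le_div_iff_of_pos_right hδ0]
        exact h1.1
      linarith
    · have h4 : (∫ x in cellLabel m ⁻¹' {q}, h x) / δ ≤ 1 / δ := by
        rw [div_le_div_iff_of_pos_right hδ0]
        exact h1.2
      exact_mod_cast (Int.floor_le _).trans (h4.trans h3)
  -- An element is coded by the integer parts of its cell integrals divided by δ, which take
  -- finitely many values.
  refine ⟨(Fin (n + 1) → Fin (m + 1)) → Finset.Icc (-M) M, inferInstance,
    fun h q => ⟨_, hbd h.1 h.2.1 q⟩, ?_⟩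
  rintro ⟨h, hh1, hh2⟩ ⟨g, hg1, hg2⟩ heq
  change dist h g < ε
  rw [dist_eq_norm]
  have hsub : h - g = h + (-1 : ℝ) • g := by rw [neg_one_smul, sub_eq_add_neg]
  have hV : ∀ i, testVar i (h - g) ≤ ENNReal.ofReal (2 * C) := by
    intro i
    rw [hsub, two_mul, ENNReal.ofReal_add hC hC]
    refine (testVar_add_le i _ _).trans (add_le_add (hh2 i) ((testVar_smul_le i _ g).trans ?_))
    simpa using hg2 i
  refine (norm_le_sum_cells hm' (h - g) (by positivity) hV).trans_lt ?_
  have h1 : ((n : ℝ) + 1) * (2 * (2 * C)) / m < ε / 2 := by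
    rw [div_lt_iff₀ (by positivity)] at hm
    rw [div_lt_iff₀ hm0]
    linarith
  have h2 : ∑ q : Fin (n + 1) → Fin (m + 1), |∫ x in cellLabel m ⁻¹' {q}, (h - g : L1 n) x| ≤
      ε / 2 := by
    calc _ ≤ ∑ _q : Fin (n + 1) → Fin (m + 1), δ := by
          refine Finset.sum_le_sum fun q _ => ?_
          have h3 : ∫ x in cellLabel m ⁻¹' {q}, (h - g : L1 n) x =
              (∫ x in cellLabel m ⁻¹' {q}, h x) - ∫ x in cellLabel m ⁻¹' {q}, g x := by
            rw [← integral_sub (L1.integrable_coeFn h).integrableOn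
              (L1.integrable_coeFn g).integrableOn]
            exact integral_congr_ae (ae_restrict_of_ae (Lp.coeFn_sub h g))
          have h4 : ⌊(∫ x in cellLabel m ⁻¹' {q}, h x) / δ⌋ =
              ⌊(∫ x in cellLabel m ⁻¹' {q}, g x) / δ⌋ := congrArg Subtype.val (congrFun heq q)
          have h5 := Int.abs_sub_lt_one_of_floor_eq_floor h4
          rw [← sub_div, abs_div, abs_of_pos hδ0, div_lt_one hδ0] at h5
          rw [h3]
          exact h5.le
      _ = ε / 2 := by
          rw [Finset.sum_const, Finset.card_univ, ← hN, nsmul_eq_mul, hδ]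
          field_simp
  linarith

end Grid

/-! ### Step functions on uniform grids of the unit interval -/

section StepFunctions

/-- The floor equals k on the half-open interval only, and jumps at (k + 1)/m; hence the passage
from `Ioc` to `Ico`. -/
theorem integral_grid_piece {m k : ℕ} (hm : 0 < m) (G : ℕ → ℝ → ℝ) {t : ℝ}
    (hkt : (k : ℝ) / m ≤ t) (ht : t ≤ (k + 1) / m) :
    ∫ x in (k : ℝ) / m..t, G ⌊(m : ℝ) * x⌋₊ x = ∫ x in (k : ℝ) / m..t, G k x := by
  have hm0 : (0 : ℝ) < m := by exact_mod_cast hm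
  rw [intervalIntegral.integral_of_le hkt, intervalIntegral.integral_of_le hkt,
    ← integral_Ico_eq_integral_Ioc, ← integral_Ico_eq_integral_Ioc]
  refine setIntegral_congr_fun measurableSet_Ico fun x hx => ?_
  have h1 : ⌊(m : ℝ) * x⌋₊ = k := by
    rw [Nat.floor_eq_iff (mul_nonneg hm0.le (le_trans (by positivity) hx.1))]
    constructor
    · have := hx.1
      rw [div_le_iff₀ hm0] at this
      linarith
    · have := hx.2.trans_le ht
      rw [lt_div_iff₀ hm0] at this
      linarith
  simp only [h1]

/-- The mean of `U` over the `k`-th interval of length `1 / m`. -/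
def gridMean (U : ℝ → ℝ) (m k : ℕ) : ℝ := m * ∫ x in (k : ℝ) / m..(k + 1) / m, U x

/-- The derivative of the piecewise linear function with values `-s k` at `k / m`. -/
def zigzag (m : ℕ) (s : ℕ → ℝ) (x : ℝ) : ℝ := m * (s ⌊(m : ℝ) * x⌋₊ - s (⌊(m : ℝ) * x⌋₊ + 1))

theorem measurable_zigzag (m : ℕ) (s : ℕ → ℝ) : Measurable (zigzag m s) := by
  have h1 : Measurable fun x : ℝ => ⌊(m : ℝ) * x⌋₊ :=
    Nat.measurable_floor.comp (measurable_id.const_mul _)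
  have h2 : Measurable fun k : ℕ => (m : ℝ) * (s k - s (k + 1)) := measurable_of_countable _
  exact h2.comp h1

theorem abs_zigzag_le (m : ℕ) {s : ℕ → ℝ} (hs : ∀ k, |s k| ≤ 1) (x : ℝ) :
    |zigzag m s x| ≤ 2 * m := by
  rw [zigzag, abs_mul, Nat.abs_cast, mul_comm]
  have h1 := abs_sub (s ⌊(m : ℝ) * x⌋₊) (s (⌊(m : ℝ) * x⌋₊ + 1))
  have := hs ⌊(m : ℝ) * x⌋₊
  have := hs (⌊(m : ℝ) * x⌋₊ + 1)
  exact mul_le_mul_of_nonneg_right (by linarith) (Nat.cast_nonneg m)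

theorem intervalIntegrable_zigzag (m : ℕ) {s : ℕ → ℝ} (hs : ∀ k, |s k| ≤ 1) (a b : ℝ) :
    IntervalIntegrable (zigzag m s) volume a b :=
  (intervalIntegrable_const (c := 2 * (m : ℝ))).mono_fun
    (measurable_zigzag m s).aestronglyMeasurable
    (Eventually.of_forall fun x => by
      dsimp only
      rw [Real.norm_eq_abs, Real.norm_eq_abs]
      exact (abs_zigzag_le m hs x).trans (le_abs_self _))

theorem integral_zigzag_piece {m k : ℕ} (hm : 0 < m) (s : ℕ → ℝ) {t : ℝ}
    (hkt : (k : ℝ) / m ≤ t) (ht : t ≤ (k + 1) / m) :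
    ∫ x in (k : ℝ) / m..t, zigzag m s x = (t - k / m) * (m * (s k - s (k + 1))) := by
  have h1 := integral_grid_piece hm (fun k _ => (m : ℝ) * (s k - s (k + 1))) hkt ht
  simp only [zigzag]
  rw [h1, intervalIntegral.integral_const, smul_eq_mul]

theorem integral_zigzag_grid {m : ℕ} (hm : 0 < m) {s : ℕ → ℝ} (hs : ∀ k, |s k| ≤ 1)
    (h0 : s 0 = 0) (k : ℕ) : ∫ x in (0 : ℝ)..k / m, zigzag m s x = -s k := by
  have hm0 : (0 : ℝ) < m := by exact_mod_cast hm
  induction k with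
  | zero => simp [h0]
  | succ k ih =>
    rw [← intervalIntegral.integral_add_adjacent_intervals
      (intervalIntegrable_zigzag m hs 0 (k / m)) (intervalIntegrable_zigzag m hs _ _), ih,
      integral_zigzag_piece hm s (by push_cast; gcongr; linarith) (by push_cast; rfl)]
    push_cast
    field_simp
    ring

/-- Inside a grid interval the primitive interpolates linearly between -s k and -s (k + 1), so it is
a convex combination of numbers in [-1, 1]. -/
theorem abs_integral_zigzag_le {m : ℕ} (hm : 0 < m) {s : ℕ → ℝ} (hs : ∀ k, |s k| ≤ 1)
    (h0 : s 0 = 0) {t : ℝ} (ht : 0 ≤ t) : |∫ x in (0 : ℝ)..t, zigzag m s x| ≤ 1 := by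
  have hm0 : (0 : ℝ) < m := by exact_mod_cast hm
  set k := ⌊(m : ℝ) * t⌋₊ with hk
  have h1 : (k : ℝ) / m ≤ t := by
    rw [div_le_iff₀ hm0, mul_comm]; exact Nat.floor_le (mul_nonneg hm0.le ht)
  have h2 : t ≤ (k + 1) / m := by
    rw [le_div_iff₀ hm0, mul_comm]; exact (Nat.lt_floor_add_one _).le
  rw [← intervalIntegral.integral_add_adjacent_intervals
    (intervalIntegrable_zigzag m hs 0 (k / m)) (intervalIntegrable_zigzag m hs _ _),
    integral_zigzag_grid hm hs h0, integral_zigzag_piece hm s h1 h2]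
  set r : ℝ := (t - k / m) * m with hr
  have hr0 : 0 ≤ r := mul_nonneg (by linarith) hm0.le
  have hr1 : r ≤ 1 := by
    rw [hr]
    have : t - k / m ≤ 1 / m := by rw [add_div] at h2; linarith
    calc (t - k / m) * m ≤ 1 / m * m := by gcongr
      _ = 1 := by field_simp
  have h3 : -s k + (t - k / m) * (m * (s k - s (k + 1))) = -((1 - r) * s k + r * s (k + 1)) := by
    rw [hr]; ring
  rw [h3, abs_neg]
  refine (abs_add_le _ _).trans ?_
  rw [abs_mul, abs_mul, abs_of_nonneg hr0, abs_of_nonneg (by linarith : 0 ≤ 1 - r)]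
  have := hs k
  have := hs (k + 1)
  nlinarith

theorem integral_mul_zigzag {m : ℕ} (hm : 0 < m) (s : ℕ → ℝ) {U : ℝ → ℝ}
    (hU : IntervalIntegrable (fun x => U x * zigzag m s x) volume 0 1) :
    ∫ x in (0 : ℝ)..1, U x * zigzag m s x =
      ∑ k ∈ Finset.range m, gridMean U m k * (s k - s (k + 1)) := by
  have hm0 : (0 : ℝ) < m := by exact_mod_cast hm
  have hsub : ∀ k, k < m → Set.uIcc ((k : ℝ) / m) (((k + 1 : ℕ) : ℝ) / m) ⊆ Set.uIcc 0 1 := by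
    intro k hk
    have h1 : ((k + 1 : ℕ) : ℝ) ≤ m := by exact_mod_cast hk
    rw [Set.uIcc_of_le (by gcongr; simp), Set.uIcc_of_le zero_le_one]
    exact Set.Icc_subset_Icc (by positivity) (by rw [div_le_one hm0]; exact h1)
  have h1 := intervalIntegral.sum_integral_adjacent_intervals (n := m)
    (a := fun k : ℕ => (k : ℝ) / m) fun k hk => hU.mono_set (hsub k hk)
  simp only [Nat.cast_zero, zero_div, div_self hm0.ne'] at h1
  rw [← h1]
  refine Finset.sum_congr rfl fun k _ => ?_
  have h2 := integral_grid_piece hm (fun k x => U x * ((m : ℝ) * (s k - s (k + 1))))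
    (show (k : ℝ) / m ≤ (k + 1) / m by gcongr; linarith) le_rfl
  simp only [zigzag, gridMean]
  push_cast
  rw [h2, intervalIntegral.integral_mul_const]
  ring

/-- The signs of the increments of the sequence `c`, with `0` at the ends. -/
def incrSign (m : ℕ) (c : ℕ → ℝ) (k : ℕ) : ℝ :=
  if k = 0 ∨ m ≤ k then 0 else if c (k - 1) ≤ c k then 1 else -1

theorem abs_incrSign_le (m : ℕ) (c : ℕ → ℝ) (k : ℕ) : |incrSign m c k| ≤ 1 := by
  unfold incrSign
  split_ifs <;> simp

/-- Summation by parts; the boundary terms vanish because the signs are set to 0 at 0 and from m on.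
-/
theorem sum_mul_incrSign {m : ℕ} (hm : 0 < m) (c : ℕ → ℝ) :
    ∑ k ∈ Finset.range m, c k * (incrSign m c k - incrSign m c (k + 1)) =
      ∑ k ∈ Finset.range (m - 1), |c (k + 1) - c k| := by
  obtain ⟨p, rfl⟩ : ∃ p, m = p + 1 := ⟨m - 1, by omega⟩
  simp only [Nat.add_sub_cancel]
  have h1 : ∑ k ∈ Finset.range (p + 1), c k * (incrSign (p + 1) c k - incrSign (p + 1) c (k + 1)) =
      ∑ k ∈ Finset.range (p + 1), c k * incrSign (p + 1) c k -
        ∑ k ∈ Finset.range (p + 1), c k * incrSign (p + 1) c (k + 1) := by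
    rw [← Finset.sum_sub_distrib]
    exact Finset.sum_congr rfl fun k _ => by ring
  have h0 : incrSign (p + 1) c 0 = 0 := by simp [incrSign]
  have hp : incrSign (p + 1) c (p + 1) = 0 := by simp [incrSign]
  rw [h1, Finset.sum_range_succ', Finset.sum_range_succ (fun k => c k * incrSign (p + 1) c (k + 1)),
    h0, hp, mul_zero, mul_zero, add_zero, add_zero, ← Finset.sum_sub_distrib]
  refine Finset.sum_congr rfl fun k hk => ?_
  have hk' := Finset.mem_range.1 hk
  have h2 : incrSign (p + 1) c (k + 1) = if c k ≤ c (k + 1) then 1 else -1 := by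
    unfold incrSign
    rw [if_neg (by omega)]
    simp
  rw [h2]
  split_ifs with h3
  · rw [abs_of_nonneg (sub_nonneg.2 h3)]; ring
  · rw [abs_of_neg (by linarith [not_le.1 h3])]; ring

/-- Lebesgue differentiation along the grid intervals that contain x. These are not centred at x, so
the form of the theorem with moving centres `w m` and radii `δ m` is used. -/
theorem ae_tendsto_gridMean {W : ℝ → ℝ} (hW : Integrable W) :
    ∀ᵐ x, 0 ≤ x → Tendsto (fun m : ℕ => gridMean W (m + 1) ⌊((m + 1 : ℕ) : ℝ) * x⌋₊) atTop
      (𝓝 (W x)) := by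
  filter_upwards [IsUnifLocDoublingMeasure.ae_tendsto_average volume hW.locallyIntegrable 1]
    with x hx hx0
  set k : ℕ → ℕ := fun m => ⌊((m + 1 : ℕ) : ℝ) * x⌋₊ with hk
  set δ : ℕ → ℝ := fun m => 1 / (2 * ((m : ℝ) + 1)) with hδ
  set w : ℕ → ℝ := fun m => (k m + 1 / 2) / ((m : ℝ) + 1) with hw
  have hδ0 : ∀ m, 0 < δ m := fun m => by positivity
  have hlo : ∀ m, w m - δ m = (k m : ℝ) / ((m + 1 : ℕ) : ℝ) := fun m => by
    simp only [hw, hδ]; push_cast; field_simp; ring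
  have hhi : ∀ m, w m + δ m = ((k m : ℝ) + 1) / ((m + 1 : ℕ) : ℝ) := fun m => by
    simp only [hw, hδ]; push_cast; field_simp; ring
  have hlim : Tendsto δ atTop (𝓝[>] 0) := by
    rw [tendsto_nhdsWithin_iff]
    refine ⟨?_, Eventually.of_forall hδ0⟩
    have := (tendsto_one_div_add_atTop_nhds_zero_nat (𝕜 := ℝ)).const_mul (1 / 2)
    rw [mul_zero] at this
    refine this.congr fun m => ?_
    simp only [hδ]; field_simp
  have h1 := hx w δ hlim (Eventually.of_forall fun m => by
    have hm0 : (0 : ℝ) < ((m + 1 : ℕ) : ℝ) := by positivity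
    rw [one_mul, Real.closedBall_eq_Icc, hlo, hhi]
    constructor
    · rw [div_le_iff₀ hm0, mul_comm]; exact Nat.floor_le (mul_nonneg hm0.le hx0)
    · rw [le_div_iff₀ hm0, mul_comm]; exact (Nat.lt_floor_add_one _).le)
  refine h1.congr fun m => ?_
  have hm0 : (0 : ℝ) < ((m + 1 : ℕ) : ℝ) := by positivity
  rw [setAverage_eq, Real.closedBall_eq_Icc, Real.volume_real_Icc_of_le (by linarith [hδ0 m]),
    integral_Icc_eq_integral_Ioc, ← intervalIntegral.integral_of_le (by linarith [hδ0 m]),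
    hlo, hhi, gridMean, smul_eq_mul]
  congr 1
  field_simp
  ring

/-- Makes sets of full measure in the interval dense. -/
theorem isOpenPosMeasure_unitInterval : (volume : Measure unitInterval).IsOpenPosMeasure := by
  refine ⟨fun U hU hne h0 => ?_⟩
  obtain ⟨t, ht⟩ := hne
  obtain ⟨ε, hε, hb⟩ := Metric.isOpen_iff.1 hU t ht
  set a : ℝ := max (t - ε) 0
  set b : ℝ := min (t + ε) 1
  have hab : a < b := by
    have h1 := t.2.1
    have h2 := t.2.2
    refine max_lt (lt_min (by linarith) (by linarith)) (lt_min (by linarith) one_pos)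
  have hsub : ((↑) ⁻¹' Set.Ioo a b : Set unitInterval) ⊆ U := by
    intro x hx
    refine hb ?_
    rw [Metric.mem_ball, Subtype.dist_eq, Real.dist_eq, abs_lt]
    have h1 := (le_max_left (t - ε) 0).trans_lt hx.1
    have h2 := hx.2.trans_le (min_le_left (t + ε) 1)
    constructor <;> linarith
  have h1 := (measurePreserving_subtype_coe (μa := (volume : Measure ℝ))
    (measurableSet_Icc (a := (0 : ℝ)) (b := 1))).measure_preimage
    (measurableSet_Ioo (a := a) (b := b)).nullMeasurableSet
  have h4 : Set.Ioo a b ⊆ Set.Icc 0 1 := fun x hx =>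
    ⟨(le_max_right _ _).trans hx.1.le, hx.2.le.trans (min_le_right _ _)⟩
  rw [Measure.restrict_apply measurableSet_Ioo, Set.inter_eq_left.2 h4, Real.volume_Ioo] at h1
  have h2 : (volume : Measure unitInterval) ((↑) ⁻¹' Set.Ioo a b) = 0 := measure_mono_null hsub h0
  have h3 : ENNReal.ofReal (b - a) = 0 := h1.symm.trans h2
  rw [ENNReal.ofReal_eq_zero] at h3
  linarith

/-- A function of bounded variation on a dense set extends without increasing the variation. -/
theorem exists_extension_eVariationOn {E : Set unitInterval} (hE : Dense E) {u : unitInterval → ℝ}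
    (hu : eVariationOn u E ≠ ∞) :
    ∃ g : unitInterval → ℝ, Set.EqOn g u E ∧ eVariationOn g Set.univ = eVariationOn u E := by
  obtain ⟨e₀, he₀⟩ := hE.nonempty
  have hbd : ∀ x ∈ E, u x ∈ Metric.closedBall (u e₀) (eVariationOn u E).toReal := by
    intro x hx
    rw [Metric.mem_closedBall, dist_edist]
    exact ENNReal.toReal_mono hu (eVariationOn.edist_le u hx he₀)
  -- Off E the value is a limit of u along points of E, which exists because u is bounded on E; on E
  -- the constant sequence keeps the given value.
  have hseq : ∀ t, ∃ (e : ℕ → unitInterval) (l : ℝ), (∀ j, e j ∈ E) ∧ Tendsto e atTop (𝓝 t) ∧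
      Tendsto (fun j => u (e j)) atTop (𝓝 l) ∧ (t ∈ E → l = u t) := by
    intro t
    by_cases ht : t ∈ E
    · exact ⟨fun _ => t, u t, fun _ => ht, tendsto_const_nhds, tendsto_const_nhds, fun _ => rfl⟩
    · obtain ⟨x, hx, hxt⟩ := mem_closure_iff_seq_limit.1 (hE t)
      obtain ⟨l, -, ψ, hψ, hl⟩ := (isCompact_closedBall (u e₀) _).tendsto_subseq
        fun j => hbd (x j) (hx j)
      exact ⟨fun j => x (ψ j), l, fun j => hx _, hxt.comp hψ.tendsto_atTop, hl,
        fun h => (ht h).elim⟩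
  choose e g heE het heg hgE using hseq
  have heq : Set.EqOn g u E := fun t ht => hgE t ht
  refine ⟨g, heq, le_antisymm ?_ ?_⟩
  · refine iSup_le ?_
    rintro ⟨N, p, hp, -⟩
    have hlim : Tendsto (fun j => ∑ k ∈ Finset.range N,
        edist (u (e (p (k + 1)) j)) (u (e (p k) j))) atTop
        (𝓝 (∑ k ∈ Finset.range N, edist (g (p (k + 1))) (g (p k)))) :=
      tendsto_finsetSum _ fun k _ => (heg _).edist (heg _)
    refine le_of_tendsto hlim ?_
    -- Strict inequalities between partition points persist for their approximations in E, and equal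
    -- partition points have equal approximations, so the approximating partition is eventually
    -- monotone.
    have hord : ∀ᶠ j in atTop, ∀ a ∈ Finset.range (N + 1), ∀ b ∈ Finset.range (N + 1),
        p a < p b → e (p a) j < e (p b) j := by
      rw [Filter.eventually_all_finset]
      intro a _
      rw [Filter.eventually_all_finset]
      intro b _
      by_cases hab : p a < p b
      · filter_upwards [(het (p a)).eventually_lt (het (p b)) hab] with j hj _ using hj
      · exact Eventually.of_forall fun j h => (hab h).elim
    filter_upwards [hord] with j hj
    refine eVariationOn.sum_le_of_monotoneOn_Iic (u := fun k => e (p k) j) ?_ fun k _ => heE _ _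
    intro a ha b hb hab
    rcases (hp hab).lt_or_eq with h | h
    · exact (hj a (Finset.mem_range.2 (Nat.lt_succ_of_le ha)) b
        (Finset.mem_range.2 (Nat.lt_succ_of_le hb)) h).le
    · simp only [h, le_refl]
  · rw [← eVariationOn.eq_of_eqOn heq]
    exact eVariationOn.mono g (Set.subset_univ E)

/-- The step function is c composed with a monotone map into {0, …, m - 1}. The point 1 is excluded
because its floor is m. -/
theorem eVariationOn_step_le {m : ℕ} (hm : 0 < m) (c : ℕ → ℝ) {E : Set unitInterval}
    (hE : ∀ t ∈ E, (t : ℝ) < 1) :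
    eVariationOn (fun t : unitInterval => c ⌊(m : ℝ) * t⌋₊) E ≤
      ENNReal.ofReal (∑ k ∈ Finset.range (m - 1), |c (k + 1) - c k|) := by
  have hm0 : (0 : ℝ) < m := by exact_mod_cast hm
  have h1 := eVariationOn.comp_le_of_monotoneOn c (s := id '' Set.Iic (m - 1)) (t := E)
    (fun t : unitInterval => ⌊(m : ℝ) * t⌋₊)
    (fun a _ b _ hab => Nat.floor_mono (mul_le_mul_of_nonneg_left hab hm0.le)) ?_
  · refine h1.trans ?_
    rw [eVariationOn.image_range_of_monotone c monotone_id,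
      ENNReal.ofReal_sum_of_nonneg fun _ _ => abs_nonneg _]
    refine Finset.sum_le_sum fun k _ => ?_
    rw [edist_dist, dist_comm, Real.dist_eq]
    rfl
  · intro t ht
    rw [Set.image_id, Set.mem_Iic]
    have h2 : ⌊(m : ℝ) * t⌋₊ < m := by
      rw [Nat.floor_lt (mul_nonneg hm0.le t.2.1)]
      have := hE t ht
      nlinarith
    exact Nat.le_sub_one_of_lt h2

end StepFunctions

/-! ### Equality of the variation and its dual description -/

section Duality

variable {n : ℕ}

/-- The restriction of `h` to the line through `y` in direction `i`, as a function on `ℝ`. -/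
def lineFun (i : Fin (n + 1)) (h : Cube n → ℝ) (y : Fin n → unitInterval) (x : ℝ) : ℝ :=
  h (ins i (Set.projIcc 0 1 zero_le_one x) y)

theorem measurable_gridMean_lineFun (i : Fin (n + 1)) {h : Cube n → ℝ} (hh : Measurable h)
    (m k : ℕ) : Measurable fun y => gridMean (lineFun i h y) m k := by
  have hp : Measurable (Set.projIcc (0 : ℝ) 1 zero_le_one) := continuous_projIcc.measurable
  have h1 : StronglyMeasurable fun p : (Fin n → unitInterval) × ℝ => lineFun i h p.1 p.2 :=
    (hh.comp ((measurable_ins i).comp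
      ((hp.comp measurable_snd).prodMk measurable_fst))).stronglyMeasurable
  have hle : (k : ℝ) / m ≤ (k + 1) / m := by gcongr; linarith
  simp only [gridMean, intervalIntegral.integral_of_le hle]
  exact (h1.integral_prod_right' (ν := volume.restrict (Set.Ioc ((k : ℝ) / m) ((k + 1) / m)))
    ).measurable.const_mul _

/-- The variation of the grid means of `h` on the line through `y`. -/
def gridVar (i : Fin (n + 1)) (h : Cube n → ℝ) (m : ℕ) (y : Fin n → unitInterval) : ℝ :=
  ∑ k ∈ Finset.range (m - 1),
    |gridMean (lineFun i h y) m (k + 1) - gridMean (lineFun i h y) m k|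

theorem measurable_gridVar (i : Fin (n + 1)) {h : Cube n → ℝ} (hh : Measurable h) (m : ℕ) :
    Measurable (gridVar i h m) := by
  unfold gridVar
  refine Finset.measurable_fun_sum _ fun k _ => ?_
  exact measurable_norm.comp
    ((measurable_gridMean_lineFun i hh m (k + 1)).sub (measurable_gridMean_lineFun i hh m k))

/-- The signs of the increments of the grid means of `h` on the line through `y`. -/
def lineSign (i : Fin (n + 1)) (h : Cube n → ℝ) (m : ℕ) (y : Fin n → unitInterval) : ℕ → ℝ :=
  incrSign m fun k => gridMean (lineFun i h y) m k

/-- The test function that computes the variation of the grid means. -/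
def gridTest (i : Fin (n + 1)) (h : Cube n → ℝ) (m : ℕ) (x : Cube n) : ℝ :=
  zigzag m (lineSign i h m (i.removeNth x)) (x i)

theorem gridTest_ins (i : Fin (n + 1)) (h : Cube n → ℝ) (m : ℕ) (τ : unitInterval)
    (y : Fin n → unitInterval) :
    gridTest i h m (ins i τ y) = zigzag m (lineSign i h m y) τ := by
  simp [gridTest, ins]

theorem measurable_gridTest (i : Fin (n + 1)) {h : Cube n → ℝ} (hh : Measurable h) (m : ℕ) :
    Measurable (gridTest i h m) := by
  have h1 : Measurable fun p : ℕ × (Fin n → unitInterval) => lineSign i h m p.2 p.1 := by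
    refine measurable_from_prod_countable_right fun k => ?_
    simp only [lineSign, incrSign]
    split_ifs
    · exact measurable_const
    · exact Measurable.ite (measurableSet_le (measurable_gridMean_lineFun i hh m _)
        (measurable_gridMean_lineFun i hh m _)) measurable_const measurable_const
  have h2 : Measurable fun x : Cube n => ⌊(m : ℝ) * x i⌋₊ :=
    Nat.measurable_floor.comp ((measurable_subtype_coe.comp (measurable_pi_apply i)).const_mul _)
  have h3 : ∀ j : ℕ, Measurable fun x : Cube n =>
      lineSign i h m (i.removeNth x) (⌊(m : ℝ) * x i⌋₊ + j) := by
    intro j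
    have h4 : Measurable fun x : Cube n =>
        (⌊(m : ℝ) * x i⌋₊ + j, (i.removeNth x : Fin n → unitInterval)) :=
      (h2.add_const j).prodMk (measurable_removeNth i)
    have h5 : (fun x : Cube n => lineSign i h m (i.removeNth x) (⌊(m : ℝ) * x i⌋₊ + j)) =
        (fun p : ℕ × (Fin n → unitInterval) => lineSign i h m p.2 p.1) ∘ fun x : Cube n =>
        (⌊(m : ℝ) * x i⌋₊ + j, (i.removeNth x : Fin n → unitInterval)) := by
      funext x; rfl
    rw [h5]
    exact h1.comp h4
  exact ((h3 0).sub (h3 1)).const_mul _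

theorem isTest_gridTest (i : Fin (n + 1)) {h : Cube n → ℝ} (hh : Measurable h) {m : ℕ}
    (hm : 0 < m) : IsTest i 1 (gridTest i h m) := by
  have hs : ∀ y k, |lineSign i h m y k| ≤ 1 := fun y k => abs_incrSign_le m _ k
  have h0 : ∀ y, lineSign i h m y 0 = 0 := fun y => by simp [lineSign, incrSign]
  have hline : ∀ y (t : unitInterval), ∫ τ in Set.Iic t, gridTest i h m (ins i τ y) =
      ∫ x in (0 : ℝ)..t, zigzag m (lineSign i h m y) x := by
    intro y t
    simp only [gridTest_ins]
    rw [setIntegral_Iic_eq]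
    refine intervalIntegral.integral_congr fun x hx => ?_
    rw [Set.uIcc_of_le t.2.1] at hx
    simp only [Set.projIcc_of_mem zero_le_one ⟨hx.1, hx.2.trans t.2.2⟩]
  refine ⟨measurable_gridTest i hh m, ⟨2 * m, fun x => abs_zigzag_le m (hs _) _⟩,
    fun y t => ?_, fun y => ?_⟩
  · rw [hline]
    exact abs_integral_zigzag_le hm (hs y) (h0 y) t.2.1
  · have h1 : Set.Iic (1 : unitInterval) = Set.univ := Set.eq_univ_of_forall fun x => x.2.2
    have h2 := hline y 1
    rw [h1, setIntegral_univ] at h2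
    have hm0 : (m : ℝ) ≠ 0 := by positivity
    have h3 := integral_zigzag_grid hm (hs y) (h0 y) m
    rw [div_self hm0] at h3
    rw [h2, Set.Icc.coe_one, h3]
    simp [lineSign, incrSign]

theorem integral_mul_gridTest_line (i : Fin (n + 1)) {h : Cube n → ℝ} (hh : Measurable h) {m : ℕ}
    (hm : 0 < m) {y : Fin n → unitInterval} (hy : Integrable fun τ => h (ins i τ y)) :
    ∫ τ, h (ins i τ y) * gridTest i h m (ins i τ y) = gridVar i h m y := by
  obtain ⟨B, hB⟩ := (isTest_gridTest i hh hm).bounded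
  have hint : Integrable fun τ => h (ins i τ y) * gridTest i h m (ins i τ y) :=
    hy.mul_bdd (c := B) ((measurable_gridTest i hh m).comp
      (measurable_ins_left i y)).aestronglyMeasurable (Eventually.of_forall fun τ => by
        simpa using hB _)
  have h1 := intervalIntegrable_projIcc hint
  have hcongr : ∀ x ∈ Set.uIcc (0 : ℝ) 1,
      h (ins i (Set.projIcc 0 1 zero_le_one x) y) *
        gridTest i h m (ins i (Set.projIcc 0 1 zero_le_one x) y) =
      lineFun i h y x * zigzag m (lineSign i h m y) x := by
    intro x hx
    rw [Set.uIcc_of_le zero_le_one] at hx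
    rw [gridTest_ins, lineFun, Set.projIcc_of_mem zero_le_one hx]
  have h2 : IntervalIntegrable (fun x => lineFun i h y x * zigzag m (lineSign i h m y) x)
      volume 0 1 := h1.congr fun x hx => hcongr x (Set.uIoc_subset_uIcc hx)
  rw [integral_eq_intervalIntegral (fun τ => h (ins i τ y) * gridTest i h m (ins i τ y)),
    intervalIntegral.integral_congr hcongr, integral_mul_zigzag hm _ h2]
  exact sum_mul_incrSign hm _

/-- One test function computes the variation of the grid means on almost every line at once, so by
Fubini the integral is a single pairing with h. -/
theorem lintegral_gridVar_le (i : Fin (n + 1)) (h : L1 n) {m : ℕ} (hm : 0 < m) :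
    ∫⁻ y, ENNReal.ofReal (gridVar i h m y) ≤ testVar i h := by
  have hh : Measurable (h : Cube n → ℝ) := (Lp.stronglyMeasurable h).measurable
  have hT := isTest_gridTest i hh hm
  obtain ⟨B, hB⟩ := hT.bounded
  have hint := integrable_mul h hT.measurable hB
  have hae : (fun y => ∫ τ, h (ins i τ y) * gridTest i h m (ins i τ y)) =ᵐ[volume]
      gridVar i h m := by
    filter_upwards [ae_integrable_ins i (L1.integrable_coeFn h)] with y hy
    exact integral_mul_gridTest_line i hh hm hy
  have h1 : Integrable (gridVar i h m) :=
    ((integrable_comp_ins i hint).integral_prod_right).congr hae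
  rw [← ofReal_integral_eq_lintegral_ofReal h1
    (Eventually.of_forall fun y => Finset.sum_nonneg fun _ _ => abs_nonneg _),
    ← integral_congr_ae hae, ← integral_eq_integral_ins i hint]
  exact integral_le_of_testVar hT h

/-- On a single line, the same test function compares the grid means with an arbitrary version of h,
through the one-dimensional estimate. -/
theorem gridVar_le_eVariationOn (i : Fin (n + 1)) {h : Cube n → ℝ} (hh : Measurable h) {m : ℕ}
    (hm : 0 < m) {y : Fin n → unitInterval} (hy : Integrable fun τ => h (ins i τ y))
    {g : unitInterval → ℝ} (hg : g =ᵐ[volume] fun τ => h (ins i τ y)) :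
    ENNReal.ofReal (gridVar i h m y) ≤ eVariationOn g Set.univ := by
  rcases eq_or_ne (eVariationOn g Set.univ) ∞ with htop | htop
  · rw [htop]; exact le_top
  have hT := isTest_gridTest i hh hm
  obtain ⟨B, hB⟩ := hT.bounded
  have h1 := abs_integral_mul_le_eVariationOn htop (hy.congr hg.symm)
    (hT.measurable.comp (measurable_ins_left i y)) (fun τ => hB _) (hT.primitive y) (hT.total y)
  have h2 : ∫ τ, g τ * gridTest i h m (ins i τ y) = gridVar i h m y := by
    rw [← integral_mul_gridTest_line i hh hm hy]
    exact integral_congr_ae (hg.mono fun τ hτ => by simp only [hτ])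
  rw [one_mul] at h1
  have h3 : gridVar i h m y ≤ (eVariationOn g Set.univ).toReal :=
    (le_abs_self _).trans (h2 ▸ h1)
  exact (ENNReal.ofReal_le_ofReal h3).trans ENNReal.ofReal_toReal_le

/-- The points below the right end where the grid means of `h` converge to `h`. -/
def convSet (i : Fin (n + 1)) (h : Cube n → ℝ) : Set (Cube n) :=
  {x | (x i : ℝ) < 1 ∧ Tendsto (fun m : ℕ => gridMean (lineFun i h (i.removeNth x)) (m + 1)
    ⌊((m + 1 : ℕ) : ℝ) * x i⌋₊) atTop (𝓝 (h x))}

theorem measurableSet_convSet (i : Fin (n + 1)) {h : Cube n → ℝ} (hh : Measurable h) :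
    MeasurableSet (convSet i h) := by
  have h0 : MeasurableSet {x : Cube n | (x i : ℝ) < 1} := measurableSet_lt
    (measurable_subtype_coe.comp (measurable_pi_apply i)) measurable_const
  rw [convSet, Set.ofPred_and]
  refine h0.inter ?_
  refine measurableSet_tendsto_fun (fun m => ?_) hh
  have h1 : Measurable fun p : ℕ × (Fin n → unitInterval) =>
      gridMean (lineFun i h p.2) (m + 1) p.1 :=
    measurable_from_prod_countable_right fun k => measurable_gridMean_lineFun i hh (m + 1) k
  have h2 : Measurable fun x : Cube n =>
      (⌊((m + 1 : ℕ) : ℝ) * x i⌋₊, (i.removeNth x : Fin n → unitInterval)) :=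
    (Nat.measurable_floor.comp
      ((measurable_subtype_coe.comp (measurable_pi_apply i)).const_mul _)).prodMk
      (measurable_removeNth i)
  have h3 : (fun x : Cube n => gridMean (lineFun i h (i.removeNth x)) (m + 1)
      ⌊((m + 1 : ℕ) : ℝ) * x i⌋₊) = (fun p : ℕ × (Fin n → unitInterval) =>
      gridMean (lineFun i h p.2) (m + 1) p.1) ∘ fun x : Cube n =>
      (⌊((m + 1 : ℕ) : ℝ) * x i⌋₊, (i.removeNth x : Fin n → unitInterval)) := by
    funext x; rfl
  rw [h3]
  exact h1.comp h2

theorem mem_convSet_ins {i : Fin (n + 1)} {h : Cube n → ℝ} {τ : unitInterval}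
    {y : Fin n → unitInterval} : ins i τ y ∈ convSet i h ↔ (τ : ℝ) < 1 ∧
      Tendsto (fun m : ℕ => gridMean (lineFun i h y) (m + 1) ⌊((m + 1 : ℕ) : ℝ) * τ⌋₊) atTop
        (𝓝 (h (ins i τ y))) := by
  simp [convSet, ins]

theorem ae_mem_convSet_line (i : Fin (n + 1)) {h : Cube n → ℝ} {y : Fin n → unitInterval}
    (hy : Integrable fun τ => h (ins i τ y)) : ∀ᵐ τ, ins i τ y ∈ convSet i h := by
  have h1 := intervalIntegrable_projIcc hy
  rw [intervalIntegrable_iff_integrableOn_Icc_of_le zero_le_one] at h1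
  set W : ℝ → ℝ := (Set.Icc (0 : ℝ) 1).indicator (lineFun i h y) with hW
  have hWi : Integrable W := (integrable_indicator_iff measurableSet_Icc).2 h1
  have hmp := measurePreserving_subtype_coe (μa := (volume : Measure ℝ))
    (measurableSet_Icc (a := (0 : ℝ)) (b := 1))
  have h2 : ∀ᵐ τ : unitInterval, 0 ≤ (τ : ℝ) →
      Tendsto (fun m : ℕ => gridMean W (m + 1) ⌊((m + 1 : ℕ) : ℝ) * τ⌋₊) atTop (𝓝 (W τ)) :=
    hmp.quasiMeasurePreserving.ae (ae_restrict_of_ae (ae_tendsto_gridMean hWi))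
  have h3 : ∀ᵐ τ : unitInterval, τ ≠ 1 := by
    rw [ae_iff]
    simp
  filter_upwards [h2, h3] with τ hτ hτ1
  have hlt : (τ : ℝ) < 1 := lt_of_le_of_ne τ.2.2 fun h => hτ1 (Subtype.ext h)
  refine mem_convSet_ins.2 ⟨hlt, ?_⟩
  have hWτ : W τ = h (ins i τ y) := by
    rw [hW, Set.indicator_of_mem τ.2, lineFun, Set.projIcc_val]
  rw [← hWτ]
  refine (hτ τ.2.1).congr fun m => ?_
  have hm0 : (0 : ℝ) < ((m + 1 : ℕ) : ℝ) := by positivity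
  simp only [gridMean]
  congr 1
  refine intervalIntegral.integral_congr fun x hx => ?_
  rw [Set.uIcc_of_le (by gcongr; linarith)] at hx
  have hk : ⌊((m + 1 : ℕ) : ℝ) * τ⌋₊ + 1 ≤ m + 1 := by
    rw [Nat.succ_le_iff, Nat.floor_lt (mul_nonneg hm0.le τ.2.1)]
    nlinarith
  have hk' : ((⌊((m + 1 : ℕ) : ℝ) * τ⌋₊ : ℝ) + 1) / ((m + 1 : ℕ) : ℝ) ≤ 1 := by
    rw [div_le_one hm0]
    exact_mod_cast hk
  rw [hW, Set.indicator_of_mem]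
  exact ⟨le_trans (by positivity) hx.1, hx.2.trans hk'⟩

/-- On almost every line, `h` has a version whose variation is the lower limit of the variations
of the grid means. -/
theorem exists_line_version (i : Fin (n + 1)) {h : Cube n → ℝ} (hh : Measurable h)
    {y : Fin n → unitInterval} (hy : Integrable fun τ => h (ins i τ y))
    (hfin : liminf (fun m : ℕ => ENNReal.ofReal (gridVar i h (m + 1) y)) atTop ≠ ∞) :
    ∃ g : unitInterval → ℝ, (∀ τ, ins i τ y ∈ convSet i h → g τ = h (ins i τ y)) ∧
      eVariationOn g Set.univ =
        liminf (fun m : ℕ => ENNReal.ofReal (gridVar i h (m + 1) y)) atTop := by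
  have hae := ae_mem_convSet_line i hy
  set E : Set unitInterval := {τ | ins i τ y ∈ convSet i h} with hE
  set u : unitInterval → ℝ := fun τ => h (ins i τ y) with hu
  have := isOpenPosMeasure_unitInterval
  have hdense : Dense E := Measure.dense_of_ae hae
  -- The step functions of the grid means converge to u at every point of E, and variation is lower
  -- semicontinuous under pointwise convergence.
  have hle : eVariationOn u E ≤
      liminf (fun m : ℕ => ENNReal.ofReal (gridVar i h (m + 1) y)) atTop := by
    refine le_of_forall_lt fun v hv => ?_
    obtain ⟨v', hv1, hv2⟩ := exists_between hv
    have h1 := eVariationOn.lowerSemicontinuous_aux (p := atTop)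
      (F := fun (m : ℕ) (τ : unitInterval) =>
        gridMean (lineFun i h y) (m + 1) ⌊((m + 1 : ℕ) : ℝ) * τ⌋₊) (f := u) (s := E)
      (fun τ hτ => (mem_convSet_ins.1 hτ).2) hv2
    refine hv1.trans_le (le_liminf_of_le (by isBoundedDefault) ?_)
    filter_upwards [h1] with m hm
    exact hm.le.trans (eVariationOn_step_le (Nat.succ_pos m)
      (fun k => gridMean (lineFun i h y) (m + 1) k) fun τ hτ => (mem_convSet_ins.1 hτ).1)
  obtain ⟨g, hg1, hg2⟩ := exists_extension_eVariationOn hdense (ne_top_of_le_ne_top hfin hle)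
  refine ⟨g, fun τ hτ => hg1 hτ, le_antisymm (hg2.trans_le hle) ?_⟩
  have hgae : g =ᵐ[volume] u := hae.mono fun τ hτ => hg1 hτ
  refine liminf_le_of_le (by isBoundedDefault) fun b hb => ?_
  obtain ⟨m, hm⟩ := hb.exists
  exact hm.trans (gridVar_le_eVariationOn i hh (Nat.succ_pos m) hy hgae)

theorem ae_of_ae_ae_ins (i : Fin (n + 1)) {p : Cube n → Prop} (hp : MeasurableSet {x | p x})
    (h : ∀ᵐ y, ∀ᵐ τ, p (ins i τ y)) : ∀ᵐ x, p x := by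
  have h1 : ∀ᵐ q : (Fin n → unitInterval) × unitInterval ∂(volume.prod volume),
      p (ins i q.2 q.1) := by
    rw [Measure.ae_prod_iff_ae_ae]
    · exact h
    · exact ((measurable_ins i).comp measurable_swap) hp
  have h2 := (volume_preserving_piFinSuccAbove (fun _ : Fin (n + 1) => unitInterval) i)
  have h3 := (Measure.measurePreserving_swap.comp h2).quasiMeasurePreserving.ae h1
  refine h3.mono fun x hx => ?_
  have h4 : ins i (x i) (i.removeNth x) = x := Fin.insertNth_self_removeNth i x
  rw [← h4]
  exact hx

theorem ae_removeNth (i : Fin (n + 1)) {p : (Fin n → unitInterval) → Prop} (hp : ∀ᵐ y, p y) :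
    ∀ᵐ x : Cube n, p (i.removeNth x) := by
  have h2 := (volume_preserving_piFinSuccAbove (fun _ : Fin (n + 1) => unitInterval) i)
  have h3 := (measurePreserving_snd.comp h2).quasiMeasurePreserving.ae hp
  exact h3

/-- The versions of h on lines from `exists_line_version` are glued to a representative of h. Its
line variation is a.e. the lower limit of the variations of the grid means, so Fatou's lemma and
`lintegral_gridVar_le` bound the integral. -/
theorem dirVariation_le_testVar (i : Fin (n + 1)) (h : L1 n) :
    dirVariation i h ≤ testVar i h := by
  rcases eq_or_ne (testVar i h) ∞ with htop | htop
  · rw [htop]; exact le_top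
  have hh : Measurable (h : Cube n → ℝ) := (Lp.stronglyMeasurable h).measurable
  set S : (Fin n → unitInterval) → ℝ≥0∞ := fun y =>
    liminf (fun m : ℕ => ENNReal.ofReal (gridVar i h (m + 1) y)) atTop with hS
  have hSm : Measurable S := Measurable.liminf fun m => (measurable_gridVar i hh (m + 1)).ennreal_ofReal
  have hSint : ∫⁻ y, S y ≤ testVar i h := by
    refine (lintegral_liminf_le fun m => (measurable_gridVar i hh (m + 1)).ennreal_ofReal).trans ?_
    refine liminf_le_of_le (by isBoundedDefault) fun b hb => ?_
    obtain ⟨m, hm⟩ := hb.exists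
    exact hm.trans (lintegral_gridVar_le i h (Nat.succ_pos m))
  have hSfin : ∀ᵐ y, S y < ∞ := ae_lt_top hSm (ne_top_of_le_ne_top htop hSint)
  have hgood : ∀ᵐ y, (Integrable fun τ => h (ins i τ y)) ∧ S y ≠ ∞ := by
    filter_upwards [ae_integrable_ins i (L1.integrable_coeFn h), hSfin] with y h1 h2
    exact ⟨h1, h2.ne⟩
  -- The versions are chosen with no measurability in y. None is needed: the glued function is a.e.
  -- equal to h, and its line variation is a.e. equal to the measurable function S.
  have hex : ∀ y, ∃ g : unitInterval → ℝ, ((Integrable fun τ => h (ins i τ y)) ∧ S y ≠ ∞) →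
      (∀ τ, ins i τ y ∈ convSet i h → g τ = h (ins i τ y)) ∧ eVariationOn g Set.univ = S y := by
    intro y
    by_cases hy : (Integrable fun τ => h (ins i τ y)) ∧ S y ≠ ∞
    · obtain ⟨g, hg⟩ := exists_line_version i hh hy.1 hy.2
      exact ⟨g, fun _ => hg⟩
    · exact ⟨0, fun h => (hy h).elim⟩
  choose G hG using hex
  set g : Cube n → ℝ := fun x => G (i.removeNth x) (x i) with hg
  have hline : ∀ᵐ y, lineVariation i g y = S y := by
    filter_upwards [hgood] with y hy
    have h1 : (fun t : unitInterval => g (ins i t y)) = G y := by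
      funext t
      simp [hg, ins]
    exact (congrArg (fun f => eVariationOn f Set.univ) h1).trans (hG y hy).2
  have hconv : ∀ᵐ x, x ∈ convSet i (h : Cube n → ℝ) := by
    refine ae_of_ae_ae_ins i (measurableSet_convSet i hh) ?_
    filter_upwards [hgood] with y hy using ae_mem_convSet_line i hy.1
  have hgh : g =ᵐ[volume] h := by
    filter_upwards [hconv, ae_removeNth i hgood] with x hx hy
    have h4 : ins i (x i) (i.removeNth x) = x := Fin.insertNth_self_removeNth i x
    have h5 := (hG _ hy).1 (x i) (by rw [h4]; exact hx)
    rw [h4] at h5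
    exact h5
  have haem : AEMeasurable (lineVariation i g) volume := ⟨S, hSm, hline⟩
  calc dirVariation i h ≤ ∫⁻ y, lineVariation i g y := iInf₂_le_of_le g hgh (iInf_le _ haem)
    _ = ∫⁻ y, S y := lintegral_congr_ae hline
    _ ≤ testVar i h := hSint

theorem dirVariation_eq_testVar (i : Fin (n + 1)) (h : L1 n) : dirVariation i h = testVar i h :=
  le_antisymm (dirVariation_le_testVar i h) (testVar_le_dirVariation i h)

end Duality

/-! ### Integrals along expanding branches -/

section Branch

/-- Write ϑ ∘ φ = (1/φ') · (ϑ ∘ φ) φ'. By substitution the second factor has primitives bounded by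
2c, while 1/φ' is bounded by 1/γ and has variation at most M(b - a)/γ² ≤ 1/γ. Integration by parts
gives 2c/γ + 2c/γ. -/
theorem abs_integral_comp_le_of_expanding {φ φ' ϑ : ℝ → ℝ} {γ M B c a b : ℝ} (hγ : 0 < γ)
    (hd : ∀ t, HasDerivAt φ (φ' t) t) (hexp : ∀ t, γ ≤ |φ' t|) (hM : ∀ t, |φ' t| ≤ M)
    (hlip : ∀ s t, |φ' t - φ' s| ≤ M * |t - s|) (hϑ : Measurable ϑ) (hB : ∀ x, |ϑ x| ≤ B)
    (hc : ∀ x, |∫ u in (0 : ℝ)..x, ϑ u| ≤ c) (hab : a ≤ b) (hlen : M * (b - a) ≤ γ) :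
    |∫ t in a..b, ϑ (φ t)| ≤ 4 * c / γ := by
  have hB0 : 0 ≤ B := (abs_nonneg _).trans (hB 0)
  have hM0 : 0 ≤ M := (abs_nonneg _).trans (hM 0)
  have hc0 : 0 ≤ c := (abs_nonneg _).trans (hc 0)
  have hne : ∀ t, φ' t ≠ 0 := fun t h => by
    have := hexp t
    rw [h, abs_zero] at this
    linarith
  have hφc : Continuous φ := continuous_iff_continuousAt.2 fun t => (hd t).continuousAt
  have hφ'c : Continuous φ' := by
    have : LipschitzWith M.toNNReal φ' := LipschitzWith.of_dist_le_mul fun t s => by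
      rw [Real.dist_eq, Real.dist_eq, Real.coe_toNNReal M hM0]
      exact hlip s t
    exact this.continuous
  have hii : ∀ {g : ℝ → ℝ} {C : ℝ} (x y : ℝ), Measurable g → (∀ t, |g t| ≤ C) →
      IntervalIntegrable g volume x y := fun {g C} x y hg hC =>
    (intervalIntegrable_const (c := C)).mono_fun hg.aestronglyMeasurable
      (Eventually.of_forall fun t => by
        exact (hC t).trans (le_abs_self C))
  -- φ' has no zero, so by Darboux it has constant sign; substitution along a monotone map does not
  -- need ϑ to be continuous.
  have hsubst : ∀ t, ∫ x in a..t, ϑ (φ x) * φ' x = ∫ u in φ a..φ t, ϑ u := by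
    intro t
    rcases hasDerivWithinAt_forall_lt_or_forall_gt_of_forall_ne (s := Set.univ) convex_univ
      (fun x _ => (hd x).hasDerivWithinAt) (m := 0) (fun x _ => hne x) with h | h
    · exact intervalIntegral.integral_comp_mul_deriv_of_deriv_nonpos hφc.continuousOn
        (fun x _ => hd x) fun x _ => (h x trivial).le
    · exact intervalIntegral.integral_comp_mul_deriv_of_deriv_nonneg hφc.continuousOn
        (fun x _ => hd x) fun x _ => (h x trivial).le
  have hprim : ∀ t, |∫ x in a..t, ϑ (φ x) * φ' x| ≤ 2 * c := by
    intro t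
    rw [hsubst, ← intervalIntegral.integral_interval_sub_left (hii 0 _ hϑ hB) (hii 0 _ hϑ hB)]
    have := abs_sub (∫ u in (0 : ℝ)..φ t, ϑ u) (∫ u in (0 : ℝ)..φ a, ϑ u)
    linarith [hc (φ t), hc (φ a)]
  have hm1 : Measurable fun x => ϑ (φ x) * φ' x := (hϑ.comp hφc.measurable).mul hφ'c.measurable
  have hb1 : ∀ x, |ϑ (φ x) * φ' x| ≤ B * M := fun x => by
    rw [abs_mul]
    exact mul_le_mul (hB _) (hM _) (abs_nonneg _) hB0
  have heq : ∀ x, (φ' x)⁻¹ * (ϑ (φ x) * φ' x) = ϑ (φ x) := fun x => by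
    have := hne x
    field_simp
  have hinv : ∀ x, |(φ' x)⁻¹| ≤ γ⁻¹ := fun x => by
    rw [abs_inv]
    exact inv_anti₀ hγ (hexp x)
  have key := abs_integral_mul_le_of_variation hab (u := fun x => (φ' x)⁻¹)
    (v := fun x => M / γ ^ 2 * x) (Θ := fun x => ϑ (φ x) * φ' x) (c := 2 * c)
    (hii a b hm1 hb1) hb1 (by
      simp only [heq]
      exact hii a b (hϑ.comp hφc.measurable) fun x => hB _)
    (fun s _ t _ hst => by
      have h1 : (φ' t)⁻¹ - (φ' s)⁻¹ = -(φ' t - φ' s) * ((φ' t)⁻¹ * (φ' s)⁻¹) := by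
        have := hne s
        have := hne t
        field_simp
        ring
      rw [h1, abs_mul, abs_neg, abs_mul]
      have h2 := hlip s t
      rw [abs_of_nonneg (sub_nonneg.2 hst)] at h2
      calc |φ' t - φ' s| * (|(φ' t)⁻¹| * |(φ' s)⁻¹|)
          ≤ M * (t - s) * (γ⁻¹ * γ⁻¹) := by
            refine mul_le_mul h2 (mul_le_mul (hinv t) (hinv s) (abs_nonneg _) (by positivity))
              (by positivity) (mul_nonneg hM0 (sub_nonneg.2 hst))
        _ = M / γ ^ 2 * t - M / γ ^ 2 * s := by field_simp)
    (fun t _ => hprim t)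
  simp only [heq] at key
  refine key.trans ?_
  -- The condition on the length of the interval serves to make the variation of 1/φ' as small as
  -- its bound.
  have h3 : M / γ ^ 2 * b - M / γ ^ 2 * a ≤ γ⁻¹ := by
    have : M / γ ^ 2 * b - M / γ ^ 2 * a = M * (b - a) / γ ^ 2 := by ring
    rw [this, div_le_iff₀ (by positivity)]
    refine hlen.trans_eq ?_
    field_simp
  calc 2 * c * (M / γ ^ 2 * b - M / γ ^ 2 * a) +
        |(φ' b)⁻¹| * |∫ x in a..b, ϑ (φ x) * φ' x|
      ≤ 2 * c * γ⁻¹ + γ⁻¹ * (2 * c) := by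
        gcongr
        · exact hinv b
        · exact hprim b
    _ = 4 * c / γ := by ring

/-- Up to its end points, such a set is the interval from its infimum to its supremum. -/
theorem exists_setIntegral_eq_of_ordConnected {J : Set unitInterval} (hJ : J.OrdConnected)
    (hne : J.Nonempty) {l : ℝ} (hl : ∀ τ ∈ J, ∀ τ' ∈ J, (τ' : ℝ) - τ ≤ l) :
    ∃ a b : ℝ, a ≤ b ∧ b - a ≤ l ∧ ∀ u : ℝ → ℝ, ∫ τ in J, u τ = ∫ x in a..b, u x := by
  obtain ⟨τ₀, hτ₀⟩ := hne
  set J' : Set ℝ := (fun τ : unitInterval => (τ : ℝ)) '' J with hJ'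
  have hbdd : BddAbove J' := ⟨1, by rintro _ ⟨τ, -, rfl⟩; exact τ.2.2⟩
  have hbddb : BddBelow J' := ⟨0, by rintro _ ⟨τ, -, rfl⟩; exact τ.2.1⟩
  have hne' : J'.Nonempty := ⟨τ₀, τ₀, hτ₀, rfl⟩
  have hmem : ∀ x ∈ J', sInf J' ≤ x ∧ x ≤ sSup J' := fun x hx =>
    ⟨csInf_le hbddb hx, le_csSup hbdd hx⟩
  have hab : sInf J' ≤ sSup J' := (hmem τ₀ ⟨τ₀, hτ₀, rfl⟩).1.trans (hmem τ₀ ⟨τ₀, hτ₀, rfl⟩).2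
  refine ⟨sInf J', sSup J', hab, ?_, fun u => ?_⟩
  · rw [sub_le_iff_le_add]
    refine csSup_le hne' ?_
    rintro _ ⟨τ', hτ', rfl⟩
    rw [← sub_le_iff_le_add']
    refine le_csInf hne' ?_
    rintro _ ⟨τ, hτ, rfl⟩
    dsimp only
    linarith [hl τ hτ τ' hτ']
  · have hemb : MeasurableEmbedding ((↑) : unitInterval → ℝ) :=
      MeasurableEmbedding.subtype_coe measurableSet_Icc
    have h1 : J = ((↑) : unitInterval → ℝ) ⁻¹' J' :=
      (Set.preimage_image_eq J Subtype.coe_injective).symm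
    have hsub : J' ⊆ Set.Icc 0 1 := by rintro _ ⟨τ, -, rfl⟩; exact τ.2
    have h2 : ∫ τ in J, u τ = ∫ x in J', u x := by
      have h3 := (measurePreserving_subtype_coe (μa := (volume : Measure ℝ))
        (measurableSet_Icc (a := (0 : ℝ)) (b := 1))).setIntegral_preimage_emb hemb u J'
      rw [← h1] at h3
      refine h3.trans ?_
      rw [Measure.restrict_restrict_of_subset hsub]
    have hIoo : Set.Ioo (sInf J') (sSup J') ⊆ J' := by
      rintro x ⟨hx1, hx2⟩
      obtain ⟨_, ⟨τ1, hτ1, rfl⟩, h4⟩ := exists_lt_of_csInf_lt hne' hx1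
      obtain ⟨_, ⟨τ2, hτ2, rfl⟩, h5⟩ := exists_lt_of_lt_csSup hne' hx2
      dsimp only at h4 h5
      have hx : x ∈ Set.Icc (0 : ℝ) 1 := ⟨τ1.2.1.trans h4.le, h5.le.trans τ2.2.2⟩
      exact ⟨⟨x, hx⟩, hJ.out hτ1 hτ2 ⟨h4.le, h5.le⟩, rfl⟩
    have hae : J' =ᵐ[volume] Set.Ioc (sInf J') (sSup J') := by
      refine (Filter.EventuallyLE.antisymm ?_ ?_)
      · exact Filter.EventuallyLE.trans (Filter.Eventually.of_forall fun x hx => hmem x hx)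
          Ioc_ae_eq_Icc.symm.le
      · exact Ioo_ae_eq_Ioc.symm.le.trans (Filter.Eventually.of_forall fun x hx => hIoo hx)
    rw [h2, intervalIntegral.integral_of_le hab, setIntegral_congr_set hae]

end Branch

/-! ### Piecewise expanding maps -/

section Expanding

variable {n : ℕ}

/-- A partition of the cube into boxes on which `f` is a product of `C^{1,1}` expanding maps,
each given with an extension to the line, the `i`-th one expanding by at least `γ i`. -/
structure ExpandingBranches (γ : Fin (n + 1) → ℝ) (f : Cube n → Cube n) where
  ι : Type
  fintype : Fintype ι
  label : Cube n → ι
  S : ι → Fin (n + 1) → Set ℝ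
  ordConnected : ∀ s i, (S s i).OrdConnected
  label_eq_iff : ∀ x s, label x = s ↔ ∀ i, (x i : ℝ) ∈ S s i
  φ : ι → Fin (n + 1) → ℝ → ℝ
  φ' : ι → Fin (n + 1) → ℝ → ℝ
  M : ℝ
  map_eq : ∀ x i, (f x i : ℝ) = φ (label x) i (x i)
  hasDerivAt : ∀ s i t, HasDerivAt (φ s i) (φ' s i t) t
  expand : ∀ s i t, γ i ≤ |φ' s i t|
  bound : ∀ s i t, |φ' s i t| ≤ M
  lipschitz : ∀ s i t t', |φ' s i t' - φ' s i t| ≤ M * |t' - t|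

namespace ExpandingBranches

theorem monotone_or_antitone {γ : Fin (n + 1) → ℝ} {f : Cube n → Cube n}
    (E : ExpandingBranches γ f) {i : Fin (n + 1)} (hγ : 0 < γ i) (s : E.ι) :
    Monotone (E.φ s i) ∨ Antitone (E.φ s i) := by
  have hne : ∀ t, E.φ' s i t ≠ 0 := fun t h => by
    have := E.expand s i t
    rw [h, abs_zero] at this
    linarith
  have hdiff : Differentiable ℝ (E.φ s i) := fun t => (E.hasDerivAt s i t).differentiableAt
  rcases hasDerivWithinAt_forall_lt_or_forall_gt_of_forall_ne (s := Set.univ) convex_univ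
    (fun x _ => (E.hasDerivAt s i x).hasDerivWithinAt) (m := 0) (fun x _ => hne x) with h | h
  · right
    exact antitone_of_deriv_nonpos hdiff fun t => by
      rw [(E.hasDerivAt s i t).deriv]; exact (h t trivial).le
  · left
    exact monotone_of_deriv_nonneg hdiff fun t => by
      rw [(E.hasDerivAt s i t).deriv]; exact (h t trivial).le

/-- The branches of a composition. -/
def comp {γ₁ γ₂ : Fin (n + 1) → ℝ} {f₁ f₂ : Cube n → Cube n} (h₁ : ∀ i, 0 < γ₁ i)
    (E₂ : ExpandingBranches γ₂ f₂) (E₁ : ExpandingBranches γ₁ f₁) :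
    ExpandingBranches (fun i => γ₂ i * γ₁ i) (f₂ ∘ f₁) where
  ι := E₁.ι × E₂.ι
  fintype := @instFintypeProd _ _ E₁.fintype E₂.fintype
  label x := (E₁.label x, E₂.label (f₁ x))
  S s i := E₁.S s.1 i ∩ E₁.φ s.1 i ⁻¹' E₂.S s.2 i
  ordConnected s i := by
    rcases E₁.monotone_or_antitone (h₁ i) s.1 with h | h
    · exact (E₁.ordConnected _ _).inter ((E₂.ordConnected _ _).preimage_mono h)
    · exact (E₁.ordConnected _ _).inter ((E₂.ordConnected _ _).preimage_anti h)
  label_eq_iff x s := by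
    rw [Prod.ext_iff]
    dsimp only
    constructor
    · rintro ⟨ha, hb⟩ i
      refine ⟨(E₁.label_eq_iff x s.1).1 ha i, ?_⟩
      have := (E₂.label_eq_iff (f₁ x) s.2).1 hb i
      rwa [E₁.map_eq, ha] at this
    · intro h
      have ha : E₁.label x = s.1 := (E₁.label_eq_iff x s.1).2 fun i => (h i).1
      refine ⟨ha, (E₂.label_eq_iff (f₁ x) s.2).2 fun i => ?_⟩
      rw [E₁.map_eq, ha]
      exact (h i).2
  φ s i t := E₂.φ s.2 i (E₁.φ s.1 i t)
  φ' s i t := E₂.φ' s.2 i (E₁.φ s.1 i t) * E₁.φ' s.1 i t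
  -- The first product bounds the derivative, the sum its Lipschitz constant by the product and
  -- chain rules. The sign of M is not part of the data, hence the absolute values.
  M := |E₂.M| * |E₁.M| + |E₂.M| * |E₁.M| * |E₁.M|
  map_eq x i := by
    rw [Function.comp_apply, E₂.map_eq, E₁.map_eq]
  hasDerivAt s i t := (E₂.hasDerivAt s.2 i _).comp t (E₁.hasDerivAt s.1 i t)
  expand s i t := by
    rw [abs_mul]
    exact mul_le_mul (E₂.expand _ _ _) (E₁.expand _ _ _) (h₁ i).le (abs_nonneg _)
  bound s i t := by
    rw [abs_mul]
    have := mul_le_mul ((E₂.bound s.2 i (E₁.φ s.1 i t)).trans (le_abs_self _))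
      ((E₁.bound s.1 i t).trans (le_abs_self _)) (abs_nonneg _) (abs_nonneg _)
    have h3 : 0 ≤ |E₂.M| * |E₁.M| * |E₁.M| := by positivity
    linarith
  lipschitz s i t t' := by
    have hφ : |E₁.φ s.1 i t' - E₁.φ s.1 i t| ≤ |E₁.M| * |t' - t| := by
      have := Convex.norm_image_sub_le_of_norm_hasDerivWithin_le (s := Set.univ)
        (C := |E₁.M|) (fun x _ => (E₁.hasDerivAt s.1 i x).hasDerivWithinAt)
        (fun x _ => (E₁.bound s.1 i x).trans (le_abs_self _)) convex_univ
        (Set.mem_univ t) (Set.mem_univ t')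
      simpa using this
    set A := E₂.φ' s.2 i (E₁.φ s.1 i t')
    set A₀ := E₂.φ' s.2 i (E₁.φ s.1 i t)
    set D := E₁.φ' s.1 i t'
    set D₀ := E₁.φ' s.1 i t
    have e : A * D - A₀ * D₀ = A * (D - D₀) + (A - A₀) * D₀ := by ring
    have hA : |A| ≤ |E₂.M| := (E₂.bound _ _ _).trans (le_abs_self _)
    have hD₀ : |D₀| ≤ |E₁.M| := (E₁.bound _ _ _).trans (le_abs_self _)
    have hD : |D - D₀| ≤ |E₁.M| * |t' - t| := (E₁.lipschitz _ _ _ _).trans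
      (mul_le_mul_of_nonneg_right (le_abs_self _) (abs_nonneg _))
    have hAA : |A - A₀| ≤ |E₂.M| * (|E₁.M| * |t' - t|) := (E₂.lipschitz _ _ _ _).trans
      (mul_le_mul (le_abs_self _) hφ (abs_nonneg _) (abs_nonneg _))
    rw [e]
    refine (abs_add_le _ _).trans ?_
    rw [abs_mul, abs_mul]
    have e1 := mul_le_mul hA hD (abs_nonneg _) (abs_nonneg _)
    have e2 := mul_le_mul hAA hD₀ (abs_nonneg _) (by positivity)
    calc _ ≤ _ := add_le_add e1 e2
      _ = _ := by ring

end ExpandingBranches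

end Expanding

/-! ### The Lasota-Yorke inequality -/

section LasotaYorke

variable {n : ℕ}

/-- The restriction of `θ` to the line through `w`, extended by zero to the real line. -/
def lineExt (i : Fin (n + 1)) (θ : Cube n → ℝ) (w : Fin n → unitInterval) : ℝ → ℝ :=
  (Set.Icc (0 : ℝ) 1).indicator fun x => θ (ins i (Set.projIcc 0 1 zero_le_one x) w)

theorem measurable_lineExt (i : Fin (n + 1)) {θ : Cube n → ℝ} (hθ : Measurable θ)
    (w : Fin n → unitInterval) : Measurable (lineExt i θ w) := by
  have hp : Measurable (Set.projIcc (0 : ℝ) 1 zero_le_one) := continuous_projIcc.measurable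
  exact ((hθ.comp (measurable_ins_left i w)).comp hp).indicator measurableSet_Icc

theorem abs_lineExt_le (i : Fin (n + 1)) {θ : Cube n → ℝ} {B : ℝ} (hB : ∀ x, |θ x| ≤ B)
    (w : Fin n → unitInterval) (x : ℝ) : |lineExt i θ w x| ≤ B := by
  by_cases hx : x ∈ Set.Icc (0 : ℝ) 1
  · rw [lineExt, Set.indicator_of_mem hx]
    exact hB _
  · rw [lineExt, Set.indicator_of_notMem hx, abs_zero]
    exact (abs_nonneg _).trans (hB 0)

theorem lineExt_coe (i : Fin (n + 1)) (θ : Cube n → ℝ) (w : Fin n → unitInterval)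
    (τ : unitInterval) : lineExt i θ w τ = θ (ins i τ w) := by
  rw [lineExt, Set.indicator_of_mem τ.2, Set.projIcc_val]

/-- The primitive vanishes to the left of 0 and is constant to the right of 1. -/
theorem abs_integral_lineExt_le {i : Fin (n + 1)} {c : ℝ} {θ : Cube n → ℝ} (hθ : IsTest i c θ)
    (w : Fin n → unitInterval) (x : ℝ) : |∫ u in (0 : ℝ)..x, lineExt i θ w u| ≤ c := by
  have hc : 0 ≤ c := (abs_nonneg _).trans (hθ.primitive w 0)
  rcases le_total 0 x with hx | hx
  · have hmin : min x 1 ∈ Set.Icc (0 : ℝ) 1 := ⟨le_min hx zero_le_one, min_le_right _ _⟩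
    have h1 := hθ.primitive w ⟨min x 1, hmin⟩
    rw [setIntegral_Iic_eq] at h1
    dsimp only at h1
    rw [intervalIntegral.integral_of_le hmin.1] at h1
    rw [intervalIntegral.integral_of_le hx, lineExt, setIntegral_indicator measurableSet_Icc]
    have h2 : Set.Ioc 0 x ∩ Set.Icc 0 1 = Set.Ioc 0 (min x 1) := by
      ext t
      simp only [Set.mem_inter_iff, Set.mem_Ioc, Set.mem_Icc, le_min_iff]
      constructor
      · rintro ⟨⟨a, b⟩, -, d⟩; exact ⟨a, b, d⟩
      · rintro ⟨a, b, d⟩; exact ⟨⟨a, b⟩, a.le, d⟩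
    rwa [h2]
  · rw [intervalIntegral.integral_of_ge hx, lineExt, setIntegral_indicator measurableSet_Icc,
      setIntegral_measure_zero]
    · simpa using hc
    · refine measure_mono_null (t := {0}) ?_ (by simp)
      rintro t ⟨⟨-, h1⟩, h2, -⟩
      exact le_antisymm h1 h2

namespace ExpandingBranches

variable {γ : Fin (n + 1) → ℝ} {f : Cube n → Cube n} (E : ExpandingBranches γ f)

/-- The label of the box that contains a point, refined by a uniform grid in direction `i`. -/
def refinedLabel (i : Fin (n + 1)) (q : ℕ) (x : Cube n) : E.ι × Fin (q + 1) :=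
  (E.label x, gridLabel i q x)

/-- On a box f is a product map, so moving the i-th coordinate within the box moves only the i-th
coordinate of the image: a piece of a line goes into a line. -/
theorem map_ins_eq {i : Fin (n + 1)} {τ τ₀ : unitInterval} {y : Fin n → unitInterval}
    (h : E.label (ins i τ y) = E.label (ins i τ₀ y)) :
    f (ins i τ y) = ins i (f (ins i τ y) i) (i.removeNth (f (ins i τ₀ y))) := by
  refine funext fun j => ?_
  rcases Fin.eq_self_or_eq_succAbove i j with rfl | ⟨k, rfl⟩
  · simp [ins]
  · apply Subtype.ext
    have h1 := E.map_eq (ins i τ y) (i.succAbove k)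
    have h2 := E.map_eq (ins i τ₀ y) (i.succAbove k)
    rw [h] at h1
    simp only [ins, Fin.insertNth_apply_succAbove, Fin.removeNth] at h1 h2 ⊢
    rw [h1, h2]

theorem ordConnected_linePiece (i : Fin (n + 1)) (q : ℕ) (s : E.ι × Fin (q + 1))
    (y : Fin n → unitInterval) : (linePiece i (E.refinedLabel i q) s y).OrdConnected := by
  have h1 : linePiece i (E.refinedLabel i q) s y =
      linePiece i E.label s.1 y ∩ linePiece i (gridLabel i q) s.2 y := by
    ext τ
    simp [linePiece, refinedLabel, Prod.ext_iff]
  rw [h1]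
  refine Set.OrdConnected.inter ⟨fun τ hτ τ' hτ' t ht => ?_⟩
    (ordConnected_linePiece_gridLabel i q s.2 y)
  simp only [linePiece, Set.mem_ofPred_eq, E.label_eq_iff] at hτ hτ' ⊢
  intro j
  have hj := hτ j
  have hj' := hτ' j
  rcases Fin.eq_self_or_eq_succAbove i j with rfl | ⟨k, rfl⟩
  · simp only [ins, Fin.insertNth_apply_same] at hj hj' ⊢
    exact (E.ordConnected _ _).out hj hj' ⟨ht.1, ht.2⟩
  · simpa only [ins, Fin.insertNth_apply_succAbove] using hj

/-- The piece is mapped into a single line by an expanding branch, so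
`abs_integral_comp_le_of_expanding` applies. The refinement by the grid of size 1/q is there for its
length condition, which follows from M ≤ q γ i. -/
theorem abs_setIntegral_linePiece_le {i : Fin (n + 1)} (hγ : 0 < γ i) {q : ℕ} (hq : 0 < q)
    (hqM : E.M ≤ q * γ i) {c : ℝ} {θ : Cube n → ℝ} (hθ : IsTest i c θ) (s : E.ι × Fin (q + 1))
    (y : Fin n → unitInterval) (t : unitInterval) :
    |∫ τ in linePiece i (E.refinedLabel i q) s y ∩ Set.Iic t, θ (f (ins i τ y))| ≤ 4 * c / γ i := by
  have hc : 0 ≤ c := (abs_nonneg _).trans (hθ.primitive y 0)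
  obtain ⟨B, hB⟩ := hθ.bounded
  have hq0 : (0 : ℝ) < q := by exact_mod_cast hq
  set J := linePiece i (E.refinedLabel i q) s y ∩ Set.Iic t with hJ
  have hord : J.OrdConnected := (E.ordConnected_linePiece i q s y).inter Set.ordConnected_Iic
  rcases J.eq_empty_or_nonempty with h0 | hne
  · rw [h0, setIntegral_empty, abs_zero]
    positivity
  have hlab : ∀ τ ∈ J, E.label (ins i τ y) = s.1 := fun τ hτ => congrArg Prod.fst hτ.1
  have hgrid : ∀ τ ∈ J, ⌊(q : ℝ) * τ⌋₊ = (s.2 : ℕ) := fun τ hτ =>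
    mem_linePiece_gridLabel.1 (congrArg Prod.snd hτ.1 : gridLabel i q (ins i τ y) = s.2)
  obtain ⟨a, b, hab, hlen, hint⟩ := exists_setIntegral_eq_of_ordConnected hord hne (l := 1 / q) (by
    intro τ hτ τ' hτ'
    have h1 := hgrid τ hτ
    have h2 := hgrid τ' hτ'
    have h3 := Nat.floor_le (mul_nonneg hq0.le τ.2.1)
    have h4 := Nat.lt_floor_add_one ((q : ℝ) * τ')
    rw [h1] at h3
    rw [h2] at h4
    rw [le_div_iff₀ hq0]
    nlinarith)
  obtain ⟨τ₀, hτ₀⟩ := hne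
  set w : Fin n → unitInterval := i.removeNth (f (ins i τ₀ y)) with hw
  have hmeasJ : MeasurableSet J := hord.measurableSet
  have heq : ∫ τ in J, θ (f (ins i τ y)) = ∫ τ in J, lineExt i θ w (E.φ s.1 i τ) := by
    refine setIntegral_congr_fun hmeasJ fun τ hτ => ?_
    have h1 := E.map_eq (ins i τ y) i
    rw [hlab τ hτ] at h1
    simp only [ins, Fin.insertNth_apply_same] at h1
    rw [← h1, lineExt_coe]
    exact congrArg θ (E.map_ins_eq ((hlab τ hτ).trans (hlab τ₀ hτ₀).symm))
  rw [heq, hint fun x => lineExt i θ w (E.φ s.1 i x)]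
  refine abs_integral_comp_le_of_expanding hγ (E.hasDerivAt s.1 i) (E.expand s.1 i)
    (E.bound s.1 i) (E.lipschitz s.1 i) (measurable_lineExt i hθ.measurable w)
    (abs_lineExt_le i hB w) (abs_integral_lineExt_le hθ w) hab ?_
  calc E.M * (b - a) ≤ q * γ i * (1 / q) :=
        mul_le_mul hqM hlen (sub_nonneg.2 hab) (by positivity)
    _ = γ i := by field_simp

/-- The set of `i`-th coordinates of the points with a given refined label. -/
def pieceSet (i : Fin (n + 1)) (q : ℕ) (s : E.ι × Fin (q + 1)) : Set unitInterval :=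
  {τ | (τ : ℝ) ∈ E.S s.1 i ∧ ⌊(q : ℝ) * τ⌋₊ = (s.2 : ℕ)}

/-- Boxes are products, so all lines that meet a box cut it in the same set. Only finitely many
lengths of pieces occur, and averages over pieces have a uniform bound. -/
theorem linePiece_eq_pieceSet {i : Fin (n + 1)} {q : ℕ} {s : E.ι × Fin (q + 1)}
    {y : Fin n → unitInterval} {τ₀ : unitInterval}
    (hτ₀ : τ₀ ∈ linePiece i (E.refinedLabel i q) s y) :
    linePiece i (E.refinedLabel i q) s y = E.pieceSet i q s := by
  have h0 : E.label (ins i τ₀ y) = s.1 := congrArg Prod.fst hτ₀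
  rw [E.label_eq_iff] at h0
  ext τ
  constructor
  · intro hτ
    have h1 : E.label (ins i τ y) = s.1 := congrArg Prod.fst hτ
    have h2 := (E.label_eq_iff _ _).1 h1 i
    rw [ins, Fin.insertNth_apply_same] at h2
    exact ⟨h2, mem_linePiece_gridLabel.1 (congrArg Prod.snd hτ : gridLabel i q (ins i τ y) = s.2)⟩
  · rintro ⟨h1, h2⟩
    refine Prod.ext ((E.label_eq_iff _ _).2 fun j => ?_) ?_
    · rcases Fin.eq_self_or_eq_succAbove i j with rfl | ⟨k, rfl⟩
      · rwa [ins, Fin.insertNth_apply_same]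
      · have := h0 (i.succAbove k)
        simpa only [ins, Fin.insertNth_apply_succAbove] using this
    · exact (mem_linePiece_gridLabel (y := y)).2 h2

/-- The sum of the reciprocals over all labels dominates the reciprocal of the length of the piece
at hand; null pieces contribute 0. -/
theorem abs_lineAvg_le [Fintype E.ι] {i : Fin (n + 1)} (hγ : 0 < γ i) {q : ℕ} (hq : 0 < q)
    (hqM : E.M ≤ q * γ i) {c : ℝ} {θ : Cube n → ℝ} (hθ : IsTest i c θ) (x : Cube n) :
    |lineAvg i (E.refinedLabel i q) (fun x => θ (f x)) x| ≤
      (∑ s, (volume.real (E.pieceSet i q s))⁻¹) * (4 * c / γ i) := by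
  have hc : 0 ≤ c := (abs_nonneg _).trans (hθ.primitive 0 0)
  have h1 : x i ∈ linePiece i (E.refinedLabel i q) (E.refinedLabel i q x) (i.removeNth x) := by
    have h4 : ins i (x i) (i.removeNth x) = x := Fin.insertNth_self_removeNth i x
    rw [linePiece, Set.mem_ofPred_eq, h4]
  have h2 := E.abs_setIntegral_linePiece_le hγ hq hqM hθ (E.refinedLabel i q x) (i.removeNth x) 1
  have hIic1 : Set.Iic (1 : unitInterval) = Set.univ := Set.eq_univ_of_forall fun x => x.2.2
  rw [hIic1, Set.inter_univ] at h2
  rw [lineAvg, pieceAvg, abs_mul, abs_inv, abs_of_nonneg measureReal_nonneg]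
  refine mul_le_mul ?_ h2 (abs_nonneg _) (Finset.sum_nonneg fun _ _ => by positivity)
  rw [E.linePiece_eq_pieceSet h1]
  exact Finset.single_le_sum (f := fun s => (volume.real (E.pieceSet i q s))⁻¹)
    (fun _ _ => by positivity) (Finset.mem_univ _)

theorem measurable_refinedLabel [MeasurableSpace E.ι] [Finite E.ι] [MeasurableSingletonClass E.ι]
    (i : Fin (n + 1)) (q : ℕ) : Measurable (E.refinedLabel i q) := by
  refine Measurable.prodMk (measurable_to_countable' fun s => ?_) (measurable_gridLabel i q)
  have h1 : E.label ⁻¹' {s} = ⋂ j, (fun x : Cube n => (x j : ℝ)) ⁻¹' E.S s j := by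
    ext x
    simp [E.label_eq_iff]
  rw [h1]
  exact MeasurableSet.iInter fun j =>
    (measurable_subtype_coe.comp (measurable_pi_apply j)) (E.ordConnected s j).measurableSet

/-- The Lasota-Yorke inequality by duality. Pairing the image of h with θ means pairing h with θ ∘
f. Subtracting from θ ∘ f its averages over pieces leaves a test function with constant 2 · 4/γ i,
and the averages, being bounded, cost only K‖h‖. The factor 8 is independent of f, so long
compositions absorb it. -/
theorem exists_testVar_transfer_le {γ : Fin (n + 1) → ℝ} {f : Cube n → Cube n}
    (E : ExpandingBranches γ f) (hf : Nonsingular f) (i : Fin (n + 1)) (hγ : 0 < γ i) :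
    ∃ K : ℝ, 0 ≤ K ∧ ∀ h : L1 n, testVar i (transfer f h) ≤
      ENNReal.ofReal (8 / γ i) * testVar i h + ENNReal.ofReal (K * ‖h‖) := by
  let _ : Fintype E.ι := E.fintype
  let _ : MeasurableSpace E.ι := ⊤
  have : MeasurableSingletonClass E.ι := ⟨fun _ => trivial⟩
  obtain ⟨q, hq⟩ := exists_nat_gt (max 0 (E.M / γ i))
  have hq0 : 0 < q := by exact_mod_cast (le_max_left _ _).trans_lt hq
  have hqM : E.M ≤ q * γ i := by
    rw [← div_le_iff₀ hγ]
    exact (le_max_right _ _).trans hq.le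
  set K : ℝ := (∑ s, (volume.real (E.pieceSet i q s))⁻¹) * (4 * 1 / γ i) with hK
  have hK0 : 0 ≤ K := mul_nonneg (Finset.sum_nonneg fun _ _ => by positivity) (by positivity)
  refine ⟨K, hK0, fun h => iSup₂_le fun θ hθ => ?_⟩
  obtain ⟨B, hB⟩ := hθ.bounded
  have hm : Measurable fun x => θ (f x) := hθ.measurable.comp hf.measurable
  have hκ := E.measurable_refinedLabel i q
  have hA : Measurable (lineAvg i (E.refinedLabel i q) fun x => θ (f x)) := measurable_lineAvg hκ hm
  have hAb := E.abs_lineAvg_le hγ hq0 hqM hθ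
  have hT := isTest_sub_lineAvg hκ (E.ordConnected_linePiece i q) hm (fun x => hB _)
    (E.abs_setIntegral_linePiece_le hγ hq0 hqM hθ)
  obtain ⟨B', hB'⟩ := hT.bounded
  have hsplit : ∫ x, transfer f h x * θ x =
      (∫ x, h x * (θ (f x) - lineAvg i (E.refinedLabel i q) (fun x => θ (f x)) x)) +
        ∫ x, h x * lineAvg i (E.refinedLabel i q) (fun x => θ (f x)) x := by
    rw [integral_transfer_mul hf h hθ.measurable hB,
      ← integral_add (integrable_mul h hT.measurable hB') (integrable_mul h hA hAb)]
    exact integral_congr_ae (Eventually.of_forall fun x => by ring)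
  rw [hsplit]
  refine ENNReal.ofReal_add_le.trans (add_le_add ?_ ?_)
  · have h1 := hT.ofReal_integral_le (by positivity) h
    have h2 : 2 * (4 * 1 / γ i) = 8 / γ i := by ring
    rwa [h2] at h1
  · exact ENNReal.ofReal_le_ofReal ((le_abs_self _).trans (abs_integral_mul_le h hA hAb))

end ExpandingBranches

end LasotaYorke

/-! ### Jablonski maps are piecewise expanding -/

section Jablonski

/-- The label is the largest index whose grid point is at most t; at t = 1 the last index must be
left out. -/
theorem exists_subinterval {r : ℕ} {a : Fin (r + 1) → ℝ} (h0 : a 0 = 0)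
    (h1 : a (Fin.last r) = 1) {t : ℝ} (ht : t ∈ Set.Icc (0 : ℝ) 1) :
    ∃ s : Fin r, a s.castSucc ≤ t ∧ (t < a s.succ ∨ (s.succ = Fin.last r ∧ t = 1)) := by
  rcases eq_or_lt_of_le ht.2 with h | h
  · have hr : r ≠ 0 := by
      rintro rfl
      have : (0 : Fin (0 + 1)) = Fin.last 0 := rfl
      rw [this, h1] at h0
      exact one_ne_zero h0
    obtain ⟨r, rfl⟩ := Nat.exists_eq_succ_of_ne_zero hr
    by_cases hl : a (Fin.last r).castSucc ≤ t
    · exact ⟨Fin.last r, hl, Or.inr ⟨rfl, h⟩⟩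
    · set A : Finset (Fin (r + 1 + 1)) := Finset.univ.filter fun k => a k ≤ t ∧ k ≠ Fin.last _
      have hA : A.Nonempty := ⟨0, by
        simp only [A, Finset.mem_filter, Finset.mem_univ, true_and, h0]
        exact ⟨ht.1, (Fin.last_pos).ne⟩⟩
      have hm := A.max'_mem hA
      simp only [A, Finset.mem_filter, Finset.mem_univ, true_and] at hm
      obtain ⟨s, hs⟩ := Fin.exists_castSucc_eq.2 hm.2
      refine ⟨s, hs ▸ hm.1, ?_⟩
      by_cases hsl : s.succ = Fin.last _
      · exact Or.inr ⟨hsl, h⟩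
      · left
        by_contra hcon
        have : s.succ ≤ A.max' hA := A.le_max' _ (by
          simp only [A, Finset.mem_filter, Finset.mem_univ, true_and]
          exact ⟨not_lt.1 hcon, hsl⟩)
        rw [← hs] at this
        exact absurd this (not_le.2 Fin.castSucc_lt_succ)
  · set A : Finset (Fin (r + 1)) := Finset.univ.filter fun k => a k ≤ t
    have hA : A.Nonempty := ⟨0, by
      simp only [A, Finset.mem_filter, Finset.mem_univ, true_and, h0]
      exact ht.1⟩
    have hm := A.max'_mem hA
    simp only [A, Finset.mem_filter, Finset.mem_univ, true_and] at hm
    have hne : A.max' hA ≠ Fin.last r := fun hcon => by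
      rw [hcon, h1] at hm
      linarith
    obtain ⟨s, hs⟩ := Fin.exists_castSucc_eq.2 hne
    refine ⟨s, hs ▸ hm, Or.inl ?_⟩
    by_contra hcon
    have : s.succ ≤ A.max' hA := A.le_max' _ (by
      simp only [A, Finset.mem_filter, Finset.mem_univ, true_and]
      exact not_lt.1 hcon)
    rw [← hs] at this
    exact absurd this (not_le.2 Fin.castSucc_lt_succ)

theorem not_mem_subinterval_of_lt {r : ℕ} {a : Fin (r + 1) → ℝ} (ha : StrictMono a) {t : ℝ}
    {s s' : Fin r} (hlt : s < s')
    (hs : t < a s.succ ∨ (s.succ = Fin.last r ∧ t = 1)) : ¬ a s'.castSucc ≤ t := by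
  intro hs'
  have h1 : s.succ ≤ s'.castSucc := Fin.succ_le_castSucc_iff.2 hlt
  rcases hs with h | ⟨h, -⟩
  · exact absurd (h.trans_le (ha.monotone h1)) (not_lt.2 hs')
  · rw [h] at h1
    exact absurd (h1.trans_lt (Fin.castSucc_lt_last s')) (lt_irrefl _)

theorem subinterval_unique {r : ℕ} {a : Fin (r + 1) → ℝ} (ha : StrictMono a) {t : ℝ}
    {s s' : Fin r} (h1 : a s.castSucc ≤ t) (h2 : t < a s.succ ∨ (s.succ = Fin.last r ∧ t = 1))
    (h1' : a s'.castSucc ≤ t) (h2' : t < a s'.succ ∨ (s'.succ = Fin.last r ∧ t = 1)) : s = s' := by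
  rcases lt_trichotomy s s' with h | h | h
  · exact absurd h1' (not_mem_subinterval_of_lt ha h h2)
  · exact h
  · exact absurd h1 (not_mem_subinterval_of_lt ha h h2')

/-- A `C²` function on a compact interval has a `C^{1,1}` extension to the line whose derivative
takes no new values. -/
theorem exists_extension_of_contDiffOn {a b : ℝ} (hab : a < b) {φ : ℝ → ℝ}
    (hφ : ContDiffOn ℝ 2 φ (Set.Icc a b)) :
    ∃ (Φ Φ' : ℝ → ℝ) (M : ℝ), 0 ≤ M ∧ (∀ t ∈ Set.Icc a b, Φ t = φ t) ∧
      (∀ t, HasDerivAt Φ (Φ' t) t) ∧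
      (∀ t, ∃ t' ∈ Set.Icc a b, Φ' t = derivWithin φ (Set.Icc a b) t') ∧
      (∀ t, |Φ' t| ≤ M) ∧ ∀ s t, |Φ' t - Φ' s| ≤ M * |t - s| := by
  have hud : UniqueDiffOn ℝ (Set.Icc a b) := uniqueDiffOn_Icc hab
  have hD : ContDiffOn ℝ 1 (derivWithin φ (Set.Icc a b)) (Set.Icc a b) :=
    hφ.derivWithin hud (by norm_num)
  obtain ⟨K, hK⟩ := hD.exists_lipschitzOnWith one_ne_zero (convex_Icc a b) isCompact_Icc
  obtain ⟨C, hC⟩ := isCompact_Icc.exists_bound_of_continuousOn hD.continuousOn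
  set p : ℝ → Set.Icc a b := Set.projIcc a b hab.le with hp
  -- The derivative, continued constantly by its end values. Its primitive is the extension.
  set D : ℝ → ℝ := fun t => derivWithin φ (Set.Icc a b) (p t) with hDdef
  have hlip : ∀ s t, |D t - D s| ≤ K * |t - s| := by
    intro s t
    have h1 := hK.dist_le_mul _ (p t).2 _ (p s).2
    have h2 := (LipschitzWith.projIcc hab.le).dist_le_mul t s
    rw [NNReal.coe_one, one_mul, Subtype.dist_eq] at h2
    rw [← Real.dist_eq, ← Real.dist_eq]
    exact h1.trans (mul_le_mul_of_nonneg_left h2 K.2)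
  have hDc : Continuous D := by
    have : LipschitzWith K D := LipschitzWith.of_dist_le_mul fun t s => hlip s t
    exact this.continuous
  have hC0 : 0 ≤ C := (norm_nonneg _).trans (hC a ⟨le_rfl, hab.le⟩)
  refine ⟨fun t => φ a + ∫ x in a..t, D x, D, C + K, by positivity, ?_, ?_, ?_, ?_, ?_⟩
  · intro t ht
    have h1 : ∫ x in a..t, D x = φ t - φ a := by
      refine intervalIntegral.integral_eq_sub_of_hasDerivAt_of_le ht.1
        (hφ.continuousOn.mono (Set.Icc_subset_Icc le_rfl ht.2)) (fun x hx => ?_)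
        (hDc.intervalIntegrable _ _)
      have hx' : x ∈ Set.Icc a b := ⟨hx.1.le, hx.2.le.trans ht.2⟩
      have h2 : D x = derivWithin φ (Set.Icc a b) x := by
        simp only [hDdef, hp, Set.projIcc_of_mem hab.le hx']
      rw [h2]
      exact ((hφ.differentiableOn (by norm_num)) x hx').hasDerivWithinAt.hasDerivAt
        (Icc_mem_nhds hx.1 (hx.2.trans_le ht.2))
    dsimp only
    rw [h1]
    ring
  · intro t
    exact ((hDc.integral_hasStrictDerivAt a t).hasDerivAt).const_add _
  · exact fun t => ⟨p t, (p t).2, rfl⟩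
  · intro t
    have h1 := hC (p t) (p t).2
    rw [Real.norm_eq_abs] at h1
    exact h1.trans (le_add_of_nonneg_right K.2)
  · intro s t
    exact (hlip s t).trans (mul_le_mul_of_nonneg_right (le_add_of_nonneg_left hC0) (abs_nonneg _))

variable {n : ℕ}

/-- The extension of a component takes no new derivative values, so `minExpansion` remains a lower
bound on the whole line. The labels are finite in number, so the sum of the individual constants
serves as a common M. -/
theorem IsJablonski.nonempty_expandingBranches {G : Grid n} {φ : Fin (n + 1) → G.Index → ℝ → ℝ}
    {f : Cube n → Cube n} (hJ : IsJablonski G φ f) :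
    Nonempty (ExpandingBranches (minExpansion G φ) f) := by
  have hex : ∀ x : Cube n, ∃ s : G.Index, x ∈ G.cell s := fun x => by
    choose s hs using fun i => exists_subinterval (G.first i) (G.last i) (x i).2
    exact ⟨s, fun i => hs i⟩
  choose label hlabel using hex
  have hlt : ∀ (s : G.Index) i, G.a i (s i).castSucc < G.a i (s i).succ := fun s i =>
    G.strictMono i Fin.castSucc_lt_succ
  choose Φ Φ' M hM0 heq hder hval hbd hlip using fun (s : G.Index) (i : Fin (n + 1)) =>
    exists_extension_of_contDiffOn (hlt s i) (hJ.contDiff i s)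
  have hMle : ∀ s i, M s i ≤ ∑ s, ∑ i, M s i := fun s i =>
    (Finset.single_le_sum (f := fun i => M s i) (fun i _ => hM0 s i) (Finset.mem_univ i)).trans
      (Finset.single_le_sum (f := fun s => ∑ i, M s i)
        (fun s _ => Finset.sum_nonneg fun i _ => hM0 s i) (Finset.mem_univ s))
  refine ⟨{
    ι := G.Index
    fintype := inferInstance
    label := label
    S := fun s i => {t | G.a i (s i).castSucc ≤ t ∧
      (t < G.a i (s i).succ ∨ ((s i).succ = Fin.last (G.r i) ∧ t = 1))}
    ordConnected := fun s i => ⟨fun t ht t' ht' x hx => ⟨ht.1.trans hx.1, ?_⟩⟩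
    label_eq_iff := fun x s => ⟨fun h i => h ▸ hlabel x i, fun h => funext fun i =>
      subinterval_unique (G.strictMono i) (hlabel x i).1 (hlabel x i).2 (h i).1 (h i).2⟩
    φ := Φ
    φ' := Φ'
    M := ∑ s, ∑ i, M s i
    map_eq := fun x i => ?_
    hasDerivAt := hder
    expand := fun s i t => ?_
    bound := fun s i t => (hbd s i t).trans (hMle s i)
    lipschitz := fun s i t t' => (hlip s i t t').trans
      (mul_le_mul_of_nonneg_right (hMle s i) (abs_nonneg _)) }⟩
  · rcases ht'.2 with h | ⟨h1, h2⟩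
    · exact Or.inl (hx.2.trans_lt h)
    · rcases eq_or_lt_of_le (hx.2.trans_eq h2) with h3 | h3
      · exact Or.inr ⟨h1, h3⟩
      · left
        rwa [h1, G.last i]
  · rw [hJ.eq_component _ x (hlabel x) i, heq]
    refine ⟨(hlabel x i).1, ?_⟩
    rcases (hlabel x i).2 with h | ⟨h1, h2⟩
    · exact h.le
    · rw [h1, G.last i, h2]
  · obtain ⟨t', ht', he⟩ := hval s i t
    rw [he]
    exact csInf_le ⟨0, by rintro _ ⟨_, _, _, rfl⟩; exact abs_nonneg _⟩ ⟨s, t', ht', rfl⟩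

end Jablonski

/-! ### Random recursive inequalities that contract on average -/

section Recursion

variable {Ω : Type*}

theorem birkhoffSum_iterate (T : Ω → Ω) (g : Ω → ℝ) (N l : ℕ) (ω : Ω) :
    birkhoffSum T^[N] (birkhoffSum T g N) l ω = birkhoffSum T g (N * l) ω := by
  induction l with
  | zero => simp
  | succ l ih =>
    rw [birkhoffSum_succ, ih, Nat.mul_succ, birkhoffSum_add, ← Function.iterate_mul]

theorem birkhoffSum_mono {T : Ω → Ω} {g g' : Ω → ℝ} (h : ∀ ω, g ω ≤ g' ω) (k : ℕ) (ω : Ω) :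
    birkhoffSum T g k ω ≤ birkhoffSum T g' k ω :=
  Finset.sum_le_sum fun _ _ => h _

theorem birkhoffSum_mono_right {T : Ω → Ω} {g : Ω → ℝ} (h : ∀ ω, 0 ≤ g ω) {k k' : ℕ}
    (hk : k ≤ k') (ω : Ω) : birkhoffSum T g k ω ≤ birkhoffSum T g k' ω :=
  Finset.sum_le_sum_of_subset_of_nonneg (Finset.range_mono hk) fun _ _ _ => h _

theorem birkhoffSum_nonneg {T : Ω → Ω} {g : Ω → ℝ} (h : ∀ ω, 0 ≤ g ω) (k : ℕ) (ω : Ω) :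
    0 ≤ birkhoffSum T g k ω :=
  Finset.sum_nonneg fun _ _ => h _

/-- A sequence that satisfies a recursive inequality with coefficients `exp (lam ω)` and
`exp (β ω)` is bounded by the sum of the corresponding series. -/
theorem le_tsum_of_recursion {τ : Ω → Ω} {v : ℕ → Ω → ℝ≥0∞} {lam β : Ω → ℝ} {N : ℕ} (hN : 0 < N)
    (k : ℕ) {ω : Ω}
    (hbase : ∀ j, ∀ r < N, v r (τ^[j] ω) ≤ ENNReal.ofReal (Real.exp (β (τ^[j] ω))))
    (hstep : ∀ j k, v (k + N) (τ^[j] ω) ≤ ENNReal.ofReal (Real.exp (lam (τ^[j] ω))) *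
      v k (τ^[j + 1] ω) + ENNReal.ofReal (Real.exp (β (τ^[j] ω)))) :
    v k ω ≤ ∑' l, ENNReal.ofReal (Real.exp (birkhoffSum τ lam l ω + β (τ^[l] ω))) := by
  induction k using Nat.strong_induction_on generalizing ω with
  | _ k ih =>
    rw [tsum_eq_zero_add' ENNReal.summable]
    simp only [birkhoffSum_zero, zero_add, Function.iterate_zero, id]
    rcases lt_or_ge k N with hk | hk
    · exact (hbase 0 k hk).trans le_self_add
    · obtain ⟨k, rfl⟩ := Nat.exists_eq_add_of_le' hk
      have h1 := ih k (by omega) (ω := τ ω) (fun j => hbase (j + 1)) fun j => hstep (j + 1)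
      refine (hstep 0 k).trans ?_
      rw [add_comm]
      refine add_le_add le_rfl ?_
      refine (mul_le_mul_right h1 _).trans_eq ?_
      rw [← ENNReal.tsum_mul_left]
      refine tsum_congr fun l => ?_
      rw [birkhoffSum_succ', ← ENNReal.ofReal_mul (Real.exp_nonneg _), ← Real.exp_add,
        Function.iterate_succ_apply]
      congr 2
      simp only [Function.iterate_zero, id]
      ring

variable [MeasurableSpace Ω] {P : Measure Ω}

theorem ae_forall_iterate {T : Ω → Ω} (hT : MeasurePreserving T P P) {p : Ω → Prop}
    (hp : ∀ᵐ ω ∂P, p ω) : ∀ᵐ ω ∂P, ∀ k, p (T^[k] ω) :=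
  ae_all_iff.2 fun k => (hT.iterate k).quasiMeasurePreserving.ae hp

theorem integrable_birkhoffSum {T : Ω → Ω} (hT : MeasurePreserving T P P) {g : Ω → ℝ}
    (hg : Integrable g P) (k : ℕ) : Integrable (birkhoffSum T g k) P :=
  integrable_finsetSum _ fun j _ => (hT.iterate j).integrable_comp_of_integrable hg

variable [IsProbabilityMeasure P]

/-- The value at T^k ω is the difference of two consecutive Birkhoff sums, which the upper bounds
for g and for -g control from above and below. -/
theorem ae_eventually_iterate_le {T : Ω → Ω} (hT : Ergodic T P) {g : Ω → ℝ} (hg : Integrable g P)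
    {ε : ℝ} (hε : 0 < ε) : ∀ᵐ ω ∂P, ∀ᶠ k : ℕ in atTop, g (T^[k] ω) ≤ ε * k := by
  set I := ∫ ω, g ω ∂P with hI
  have h1 := ae_eventually_birkhoffSum_le hT hg (c := I + ε / 4) (by linarith)
  have h2 := ae_eventually_birkhoffSum_le hT hg.neg (c := -I + ε / 4)
    (by rw [integral_neg']; linarith)
  filter_upwards [h1, h2] with ω hω1 hω2
  obtain ⟨K, hK⟩ := exists_nat_ge ((I + ε / 4) / (ε / 2))
  filter_upwards [(tendsto_add_atTop_nat 1).eventually hω1, hω2, eventually_ge_atTop K]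
    with k hk1 hk2 hk3
  rw [birkhoffSum_succ] at hk1
  rw [birkhoffSum_neg] at hk2
  push_cast at hk1
  have h3 : (K : ℝ) ≤ k := by exact_mod_cast hk3
  rw [div_le_iff₀ (by positivity)] at hK
  nlinarith

/-- Off the bad set `B M` the recursion over N steps contracts on average; on it the crude bound by
exp(S_N b) is used. As `B M` shrinks with M, the crude bound changes the mean of the logarithmic
coefficient arbitrarily little, so the mean stays negative, and the series of `le_tsum_of_recursion`
is eventually dominated by a geometric one. -/
theorem ae_exists_bound_of_recursion {T : Ω → Ω} (hT : Ergodic T P) {v : ℕ → Ω → ℝ≥0∞}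
    {g b : Ω → ℝ} (hg : Integrable g P) (hpos : 0 < ∫ ω, g ω ∂P) (hb : Integrable b P)
    (hb0 : ∀ ω, 0 ≤ b ω) {a : ℝ} (hv0 : ∀ ω, v 0 ω = 0)
    (hexp : ∀ᵐ ω ∂P, ∀ N k, v (k + N) ω ≤
      ENNReal.ofReal (Real.exp (birkhoffSum T b N ω)) * (v k (T^[N] ω) + 1))
    (hLY : ∀ N, ∃ (B : ℕ → Set Ω) (c : ℕ → ℕ), (∀ M, MeasurableSet (B M)) ∧
      (∀ᵐ ω ∂P, ∀ᶠ M in atTop, ω ∉ B M) ∧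
      ∀ M, ∀ᵐ ω ∂P, ω ∉ B M → ∀ k, v (k + N) ω ≤
        ENNReal.ofReal (Real.exp (a - birkhoffSum T g N ω)) * v k (T^[N] ω) + c M) :
    ∀ᵐ ω ∂P, ∃ C : ℝ≥0∞, C ≠ ∞ ∧ ∀ k, v k ω ≤ C := by
  set I := ∫ ω, g ω ∂P with hI
  -- Of the margin 4 in N I > a + 4, one unit pays for the bad set and one for the growth of β along
  -- the orbit; the rest gives summability.
  obtain ⟨N, hN⟩ := exists_nat_gt (max 0 ((a + 4) / I))
  have hN0 : 0 < N := by exact_mod_cast (le_max_left _ _).trans_lt hN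
  have hNr : (0 : ℝ) < N := by exact_mod_cast hN0
  have hNI : a + 4 < N * I := by
    rw [← div_lt_iff₀ hpos]
    exact (le_max_right _ _).trans_lt hN
  obtain ⟨B, c, hBm, hBae, hBLY⟩ := hLY N
  have hmp := hT.toMeasurePreserving
  -- Adding F raises a - S_N g to at least S_N b, the exponent of the crude bound. F is integrable,
  -- so its integral over `B M` tends to 0.
  set F : Ω → ℝ := fun ω => |birkhoffSum T b N ω| + |a - birkhoffSum T g N ω| with hF
  have hFi : Integrable F P := (integrable_birkhoffSum hmp hb N).abs.add
    (((integrable_const a).sub (integrable_birkhoffSum hmp hg N)).abs)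
  have hF0 : ∀ ω, 0 ≤ F ω := fun ω => add_nonneg (abs_nonneg _) (abs_nonneg _)
  have hlim : Tendsto (fun M => ∫ ω, (B M).indicator F ω ∂P) atTop (𝓝 0) := by
    have h0 : (0 : ℝ) = ∫ _, (0 : ℝ) ∂P := by simp
    rw [h0]
    refine tendsto_integral_of_dominated_convergence F
      (fun M => (hFi.indicator (hBm M)).aestronglyMeasurable) hFi (fun M => ?_) ?_
    · refine Eventually.of_forall fun ω => ?_
      refine (norm_indicator_le_norm_self _ _).trans_eq ?_
      rw [Real.norm_eq_abs, abs_of_nonneg (hF0 ω)]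
    · filter_upwards [hBae] with ω hω
      refine tendsto_const_nhds.congr' ?_
      filter_upwards [hω] with M hM
      rw [Set.indicator_of_notMem hM]
  obtain ⟨M, hM⟩ := (hlim.eventually (gt_mem_nhds (show (0 : ℝ) < 1 / N by positivity))).exists
  set ψ : Ω → ℝ := (B M).indicator F with hψ
  have hψi : Integrable ψ P := hFi.indicator (hBm M)
  have hψ0 : ∀ ω, 0 ≤ ψ ω := fun ω => Set.indicator_nonneg (fun ω _ => hF0 ω) ω
  set lam : Ω → ℝ := fun ω => a - birkhoffSum T g N ω + ψ ω with hlam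
  set β : Ω → ℝ := fun ω => birkhoffSum T b N ω + c M with hβ
  have hβi : Integrable β P := (integrable_birkhoffSum hmp hb N).add (integrable_const _)
  have hstep : ∀ᵐ ω ∂P, (∀ r < N, v r ω ≤ ENNReal.ofReal (Real.exp (β ω))) ∧
      ∀ k, v (k + N) ω ≤ ENNReal.ofReal (Real.exp (lam ω)) * v k (T^[N] ω) +
        ENNReal.ofReal (Real.exp (β ω)) := by
    filter_upwards [hexp, hBLY M] with ω hω1 hω2
    have hbβ : birkhoffSum T b N ω ≤ β ω := le_add_of_nonneg_right (Nat.cast_nonneg (c M))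
    refine ⟨fun r hr => ?_, fun k => ?_⟩
    · have h1 := hω1 r 0
      rw [zero_add, hv0, zero_add, mul_one] at h1
      refine h1.trans (ENNReal.ofReal_le_ofReal (Real.exp_le_exp.2 (le_trans ?_ hbβ)))
      exact birkhoffSum_mono_right hb0 hr.le ω
    · by_cases hω : ω ∈ B M
      · refine (hω1 N k).trans ?_
        rw [mul_add, mul_one]
        have h1 : birkhoffSum T b N ω ≤ lam ω := by
          simp only [hlam, hψ, Set.indicator_of_mem hω, hF]
          linarith [le_abs_self (birkhoffSum T b N ω), neg_abs_le (a - birkhoffSum T g N ω)]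
        gcongr
      · refine (hω2 hω k).trans ?_
        have h1 : lam ω = a - birkhoffSum T g N ω := by
          simp only [hlam, hψ, Set.indicator_of_notMem hω, add_zero]
        rw [h1]
        refine add_le_add le_rfl ?_
        rw [← ENNReal.ofReal_natCast]
        refine ENNReal.ofReal_le_ofReal ?_
        have h2 : (c M : ℝ) ≤ β ω := le_add_of_nonneg_left (birkhoffSum_nonneg hb0 N ω)
        linarith [Real.add_one_le_exp (β ω)]
  have hsum1 := ae_eventually_birkhoffSum_le hT (hψi.sub hg) (c := (-a - 3) / N) (by
    rw [integral_sub' hψi hg, lt_div_iff₀ hNr, sub_mul]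
    rw [lt_div_iff₀ hNr] at hM
    linarith [mul_comm (N : ℝ) I])
  have hsum2 := ae_eventually_iterate_le hT hβi (ε := 1 / N) (by positivity)
  filter_upwards [ae_forall_iterate (hmp.iterate N) hstep, hsum1, hsum2] with ω hω1 hω2 hω3
  refine ⟨_, ?_, fun k => le_tsum_of_recursion (lam := lam) hN0 k (fun j => (hω1 j).1) fun j k => ?_⟩
  · have htends : Tendsto (fun l : ℕ => N * l) atTop atTop :=
      tendsto_id.const_mul_atTop' hN0
    have hbound : ∀ᶠ l : ℕ in atTop,
        birkhoffSum T^[N] lam l ω + β ((T^[N])^[l] ω) ≤ -l := by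
      filter_upwards [htends.eventually hω2, htends.eventually hω3] with l h1 h2
      -- T^N need not be ergodic. Since ψ ≥ 0, it is at most its own Birkhoff sum of length N, and
      -- the sum along T^N is bounded by one along T.
      have h3 : birkhoffSum T^[N] lam l ω ≤ l * a + birkhoffSum T (ψ - g) (N * l) ω := by
        rw [← birkhoffSum_iterate]
        have h4 : ∀ ω, lam ω ≤ (fun _ => a) ω + birkhoffSum T (ψ - g) N ω := by
          intro ω
          have h5 : birkhoffSum T ψ 1 ω ≤ birkhoffSum T ψ N ω := birkhoffSum_mono_right hψ0 hN0 ω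
          rw [birkhoffSum_one] at h5
          rw [birkhoffSum_sub]
          simp only [hlam]
          linarith
        refine (birkhoffSum_mono h4 l ω).trans_eq ?_
        have h6 := birkhoffSum_add' T^[N] (fun _ => a) (birkhoffSum T (ψ - g) N) l ω
        refine Eq.trans ?_ (h6.trans ?_)
        · rfl
        · simp [birkhoffSum]
      have e1 : ((N * l : ℕ) : ℝ) * ((-a - 3) / N) = l * (-a - 3) := by
        push_cast
        field_simp
      have e2 : 1 / (N : ℝ) * ((N * l : ℕ) : ℝ) = l := by
        push_cast
        field_simp
      rw [e1] at h1
      rw [e2, Function.iterate_mul] at h2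
      have h0 : (0 : ℝ) ≤ l := Nat.cast_nonneg l
      linarith
    have hs : Summable fun l : ℕ =>
        Real.exp (birkhoffSum T^[N] lam l ω + β ((T^[N])^[l] ω)) := by
      refine Summable.of_norm_bounded_eventually_nat Real.summable_exp_neg_nat ?_
      filter_upwards [hbound] with l hl
      rw [Real.norm_eq_abs, Real.abs_exp]
      exact Real.exp_le_exp.2 hl
    exact hs.tsum_ofReal_ne_top
  · have := (hω1 j).2 k
    rwa [Function.iterate_succ_apply']

end Recursion

/-! ### The `BV` norm -/

section BV

variable {n : ℕ}

theorem totalVariation_eq_iSup_testVar (h : L1 n) : totalVariation h = ⨆ i, testVar i h :=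
  iSup_congr fun i => dirVariation_eq_testVar i h

theorem testVar_le_totalVariation (i : Fin (n + 1)) (h : L1 n) :
    testVar i h ≤ totalVariation h := by
  rw [totalVariation_eq_iSup_testVar]
  exact le_iSup (fun i => testVar i h) i

theorem totalVariation_le_iff {h : L1 n} {c : ℝ≥0∞} :
    totalVariation h ≤ c ↔ ∀ i, testVar i h ≤ c := by
  rw [totalVariation_eq_iSup_testVar, iSup_le_iff]

theorem lowerSemicontinuous_totalVariation :
    LowerSemicontinuous (totalVariation : L1 n → ℝ≥0∞) := by
  have h1 : (totalVariation : L1 n → ℝ≥0∞) = fun h => ⨆ i, testVar i h :=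
    funext totalVariation_eq_iSup_testVar
  rw [h1]
  exact lowerSemicontinuous_iSup lowerSemicontinuous_testVar

theorem totalVariation_add_le (h g : L1 n) :
    totalVariation (h + g) ≤ totalVariation h + totalVariation g :=
  totalVariation_le_iff.2 fun i => (testVar_add_le i h g).trans
    (add_le_add (testVar_le_totalVariation i h) (testVar_le_totalVariation i g))

theorem totalVariation_smul_le (a : ℝ) (h : L1 n) :
    totalVariation (a • h) ≤ ENNReal.ofReal |a| * totalVariation h :=
  totalVariation_le_iff.2 fun i => (testVar_smul_le i a h).trans
    (by gcongr; exact testVar_le_totalVariation i h)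

theorem bvNorm_add_le (h g : L1 n) : bvNorm (h + g) ≤ bvNorm h + bvNorm g := by
  refine (add_le_add (enorm_add_le h g) (totalVariation_add_le h g)).trans_eq ?_
  simp only [bvNorm]
  ring

theorem bvNorm_smul_le (a : ℝ) (h : L1 n) :
    bvNorm (a • h) ≤ ENNReal.ofReal |a| * bvNorm h := by
  rw [bvNorm, bvNorm, mul_add, enorm_smul, Real.enorm_eq_ofReal_abs]
  exact add_le_add le_rfl (totalVariation_smul_le a h)

theorem enorm_le_bvNorm (h : L1 n) : ‖h‖ₑ ≤ bvNorm h := le_self_add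

theorem totalVariation_le_bvNorm (h : L1 n) : totalVariation h ≤ bvNorm h := le_add_self

theorem bvNorm_lt_top_iff {h : L1 n} : bvNorm h < ∞ ↔ IsBV h := by
  rw [bvNorm, ENNReal.add_lt_top, IsBV]
  exact and_iff_right enorm_lt_top

theorem bvNorm_apply_le {T : L1 n → L1 n} (hT : ∀ (a : ℝ) h, T (a • h) = a • T h) {h : L1 n}
    (hh : IsBV h) : bvNorm (T h) ≤ bvOpNorm T * bvNorm h := by
  have hfin : bvNorm h ≠ ∞ := (bvNorm_lt_top_iff.2 hh).ne
  rcases eq_or_ne (bvNorm h) 0 with h0 | h0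
  · have h1 : h = 0 := by
      have := (enorm_le_bvNorm h).trans_eq h0
      rwa [nonpos_iff_eq_zero, enorm_eq_zero] at this
    have h2 : T h = (0 : ℝ) • T h := by
      rw [← hT, h1, smul_zero]
    rw [h2]
    refine (bvNorm_smul_le 0 _).trans ?_
    simp
  set r : ℝ := (bvNorm h).toReal with hr
  have hr0 : 0 < r := ENNReal.toReal_pos h0 hfin
  have hrr : ENNReal.ofReal r = bvNorm h := ENNReal.ofReal_toReal hfin
  have h1 : bvNorm (r⁻¹ • h) ≤ 1 := by
    refine (bvNorm_smul_le _ _).trans_eq ?_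
    rw [← hrr, abs_of_pos (inv_pos.2 hr0), ← ENNReal.ofReal_mul (by positivity),
      inv_mul_cancel₀ hr0.ne', ENNReal.ofReal_one]
  have h2 : bvNorm (T (r⁻¹ • h)) ≤ bvOpNorm T := le_iSup₂ (f := fun h _ => bvNorm (T h)) _ h1
  have h3 : T h = r • T (r⁻¹ • h) := by
    rw [hT, smul_smul, mul_inv_cancel₀ hr0.ne', one_smul]
  rw [h3]
  refine (bvNorm_smul_le _ _).trans ?_
  rw [abs_of_pos hr0, hrr, mul_comm]
  gcongr

theorem bvOpNorm_le_add (T T' : L1 n → L1 n) : bvOpNorm T' ≤ bvOpNorm T + bvOpNorm (T' - T) := by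
  refine iSup₂_le fun h hh => ?_
  have h1 : T' h = T h + (T' - T) h := by simp
  rw [h1]
  exact (bvNorm_add_le _ _).trans (add_le_add (le_iSup₂ (f := fun h _ => bvNorm (T h)) h hh)
    (le_iSup₂ (f := fun h _ => bvNorm ((T' - T) h)) h hh))

theorem totalVariation_const (a : ℝ) :
    totalVariation (Lp.const 1 (volume : Measure (Cube n)) a) = 0 := by
  refine nonpos_iff_eq_zero.1 (totalVariation_le_iff.2 fun i => iSup₂_le fun θ hθ => ?_)
  obtain ⟨B, hB⟩ := hθ.bounded
  have hi : Integrable θ := Integrable.of_bound hθ.measurable.aestronglyMeasurable B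
    (Eventually.of_forall fun x => by simpa using hB x)
  have h1 : ∫ x, (Lp.const 1 (volume : Measure (Cube n)) a) x * θ x = 0 := by
    have h2 : ∫ x, (Lp.const 1 (volume : Measure (Cube n)) a) x * θ x = ∫ x, a * θ x :=
      integral_congr_ae ((Lp.coeFn_const 1 volume a).mono fun x hx => by
        dsimp only
        rw [hx, Function.const_apply])
    rw [h2, integral_const_mul, integral_eq_integral_ins i hi]
    simp [hθ.total]
  rw [h1, ENNReal.ofReal_zero]

/-- In the one-dimensional estimate, v x = K x dominates the increments of g on every line. -/
theorem testVar_le_of_lipschitz (i : Fin (n + 1)) {g : Cube n → ℝ} {K : ℝ}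
    (hK : ∀ x y, |g x - g y| ≤ K * dist x y) {h : L1 n} (hgh : h =ᵐ[volume] g) :
    testVar i h ≤ ENNReal.ofReal K := by
  refine iSup₂_le fun θ hθ => ENNReal.ofReal_le_ofReal ?_
  obtain ⟨B, hB⟩ := hθ.bounded
  have hgi : Integrable g := (L1.integrable_coeFn h).congr hgh
  have hgθ : Integrable fun x => g x * θ x := integrable_mul_of_bounded hgi hθ.measurable hB
  have h1 : ∫ x, h x * θ x = ∫ y, ∫ τ, g (ins i τ y) * θ (ins i τ y) := by
    rw [← integral_eq_integral_ins i hgθ]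
    exact integral_congr_ae (hgh.mono fun x hx => by simp only [hx])
  have h2 : ∀ᵐ y, ‖∫ τ, g (ins i τ y) * θ (ins i τ y)‖ ≤ K := by
    filter_upwards [ae_integrable_ins i hgθ] with y hy
    have hθi : Integrable fun τ => θ (ins i τ y) := Integrable.of_bound
      (hθ.measurable.comp (measurable_ins_left i y)).aestronglyMeasurable B
      (Eventually.of_forall fun x => by simpa using hB _)
    have h3 := abs_integral_mul_le_of_variation (a := 0) (b := 1) (B := B) (c := 1) zero_le_one
      (u := fun x => g (ins i (Set.projIcc 0 1 zero_le_one x) y)) (v := fun x => K * x)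
      (Θ := fun x => θ (ins i (Set.projIcc 0 1 zero_le_one x) y))
      (intervalIntegrable_projIcc hθi) (fun x => hB _) (intervalIntegrable_projIcc hy)
      (fun s hs t ht hst => by
        refine (hK _ _).trans_eq ?_
        rw [Set.projIcc_of_mem zero_le_one hs, Set.projIcc_of_mem zero_le_one ht,
          Fin.dist_insertNth_insertNth, dist_self, max_eq_left dist_nonneg, Subtype.dist_eq,
          Real.dist_eq, abs_of_nonneg (sub_nonneg.2 hst)]
        ring)
      (fun t ht => by
        have h2 := setIntegral_Iic_eq (fun τ => θ (ins i τ y)) ⟨t, ht⟩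
        rw [← h2]
        exact hθ.primitive y _)
    rw [← integral_eq_intervalIntegral (fun τ => θ (ins i τ y)), hθ.total, abs_zero, mul_zero, mul_zero,
      add_zero, ← integral_eq_intervalIntegral (fun τ => g (ins i τ y) * θ (ins i τ y))] at h3
    rw [Real.norm_eq_abs]
    linarith
  rw [h1]
  have h4 := norm_integral_le_of_norm_le_const h2
  simp only [probReal_univ, mul_one] at h4
  exact (le_abs_self _).trans h4

/-- Polynomials in the coordinates are Lipschitz, hence of bounded variation, and by
Stone-Weierstrass dense in the continuous functions, hence in L¹. -/
theorem dense_isBV : Dense {h : L1 n | IsBV h} := by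
  set A : Subalgebra ℝ C(Cube n, ℝ) := Algebra.adjoin ℝ
    (Set.range fun i : Fin (n + 1) => (⟨fun x => (x i : ℝ), by fun_prop⟩ : C(Cube n, ℝ))) with hA
  have hsep : A.SeparatesPoints := by
    intro x y hxy
    obtain ⟨i, hi⟩ := Function.ne_iff.1 hxy
    refine ⟨_, ⟨⟨fun x => (x i : ℝ), by fun_prop⟩, Algebra.subset_adjoin ⟨i, rfl⟩, rfl⟩, ?_⟩
    exact fun h => hi (Subtype.ext h)
  have hdense : Dense (A : Set C(Cube n, ℝ)) := by
    rw [dense_iff_closure_eq, ← Subalgebra.topologicalClosure_coe,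
      ContinuousMap.subalgebra_topologicalClosure_eq_top_of_separatesPoints A hsep]
    rfl
  have hlip : ∀ g ∈ A, ∃ K : ℝ, 0 ≤ K ∧ ∀ x y, |g x - g y| ≤ K * dist x y := by
    intro g hg
    induction hg using Algebra.adjoin_induction with
    | mem g hg =>
      obtain ⟨i, rfl⟩ := hg
      refine ⟨1, zero_le_one, fun x y => ?_⟩
      rw [one_mul]
      exact dist_le_pi_dist x y i
    | algebraMap r => exact ⟨0, le_rfl, fun x y => by simp [Algebra.algebraMap_eq_smul_one]⟩
    | add g g' _ _ hg hg' =>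
      obtain ⟨K, hK0, hK⟩ := hg
      obtain ⟨K', hK0', hK'⟩ := hg'
      refine ⟨K + K', add_nonneg hK0 hK0', fun x y => ?_⟩
      simp only [ContinuousMap.add_apply]
      have e : g x + g' x - (g y + g' y) = (g x - g y) + (g' x - g' y) := by ring
      rw [e, add_mul]
      exact (abs_add_le _ _).trans (add_le_add (hK x y) (hK' x y))
    | mul g g' _ _ hg hg' =>
      obtain ⟨K, hK0, hK⟩ := hg
      obtain ⟨K', hK0', hK'⟩ := hg'
      refine ⟨‖g‖ * K' + K * ‖g'‖, by positivity, fun x y => ?_⟩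
      simp only [ContinuousMap.mul_apply]
      have e : g x * g' x - g y * g' y = g x * (g' x - g' y) + (g x - g y) * g' y := by ring
      rw [e]
      refine (abs_add_le _ _).trans ?_
      rw [abs_mul, abs_mul]
      have e1 := mul_le_mul (g.norm_coe_le_norm x) (hK' x y) (abs_nonneg _) (norm_nonneg _)
      have e2 := mul_le_mul (hK x y) (g'.norm_coe_le_norm y) (norm_nonneg _)
        (mul_nonneg hK0 dist_nonneg)
      rw [Real.norm_eq_abs] at e1 e2
      linarith
  have hrange := (ContinuousMap.toLp_denseRange (p := 1) ℝ (volume : Measure (Cube n)) ℝ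
    ENNReal.one_ne_top).dense_image (ContinuousMap.toLp (E := ℝ) 1 volume ℝ).continuous hdense
  refine hrange.mono ?_
  rintro _ ⟨g, hg, rfl⟩
  obtain ⟨K, -, hK⟩ := hlip g hg
  refine lt_of_le_of_lt (totalVariation_le_iff.2 fun i => ?_) (ENNReal.ofReal_lt_top (r := K))
  exact testVar_le_of_lipschitz i hK
    (ContinuousMap.coeFn_toLp (E := ℝ) volume g)

end BV

/-! ### Measurability of random transfer operators -/

section Measurability

variable {Ω : Type*} [TopologicalSpace Ω] [MeasurableSpace Ω] [BorelSpace Ω] {n : ℕ}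

instance secondCountableTopology_L1 : SecondCountableTopology (L1 n) := by
  have : Fact ((1 : ℝ≥0∞) ≠ ∞) := ⟨ENNReal.one_ne_top⟩
  have : MeasurableSpace.CountablyGenerated (Cube n) := inferInstance
  exact Lp.SecondCountableTopology

/-- A set that is relatively open in each set of a countable measurable cover is measurable. -/
theorem measurableSet_of_cover {A : ℕ → Set Ω} (hA : ∀ k, MeasurableSet (A k))
    (hcov : ⋃ k, A k = Set.univ) {S : Set Ω} (hS : ∀ k, ∀ ω ∈ A k ∩ S, S ∈ 𝓝[A k] ω) :
    MeasurableSet S := by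
  have h1 : ∀ k, MeasurableSet (A k ∩ S) := by
    intro k
    set O : Set Ω := ⋃₀ {U | IsOpen U ∧ U ∩ A k ⊆ S} with hO
    have h2 : A k ∩ S = A k ∩ O := by
      ext ω
      constructor
      · rintro ⟨h3, h4⟩
        obtain ⟨U, hU, hωU, hUS⟩ := mem_nhdsWithin.1 (hS k ω ⟨h3, h4⟩)
        exact ⟨h3, U, ⟨hU, hUS⟩, hωU⟩
      · rintro ⟨h3, U, ⟨-, hUS⟩, hωU⟩
        exact ⟨h3, hUS ⟨hωU, h3⟩⟩
    rw [h2]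
    exact (hA k).inter (isOpen_sUnion fun U hU => hU.1).measurableSet
  have h3 : S = ⋃ k, A k ∩ S := by
    rw [← Set.iUnion_inter, hcov, Set.univ_inter]
  rw [h3]
  exact MeasurableSet.iUnion h1

/-- By the triangle inequality for the operator norm, its strict sublevel sets are relatively open
in each set of the cover. -/
theorem measurable_bvOpNorm {T : Ω → L1 n → L1 n} (hT : PContinuous T) :
    Measurable fun ω => bvOpNorm (T ω) := by
  obtain ⟨A, hA, hcov, hcont⟩ := hT
  refine measurable_of_Iio fun c => measurableSet_of_cover hA hcov fun k ω hω => ?_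
  have hω2 : bvOpNorm (T ω) < c := hω.2
  have h1 : Tendsto (fun ω' => bvOpNorm (T ω) + bvOpNorm (T ω' - T ω)) (𝓝[A k] ω)
      (𝓝 (bvOpNorm (T ω) + 0)) := (hcont k ω hω.1).const_add _
  rw [add_zero] at h1
  filter_upwards [h1.eventually (gt_mem_nhds hω2)] with ω' hω'
  exact (bvOpNorm_le_add _ _).trans_lt hω'

theorem stronglyMeasurable_apply_of_isBV {T : Ω → L1 n → L1 n} (hT : PContinuous T)
    (hsmul : ∀ ω (a : ℝ) h, T ω (a • h) = a • T ω h) {h : L1 n} (hh : IsBV h) :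
    StronglyMeasurable fun ω => T ω h := by
  obtain ⟨A, hA, hcov, hcont⟩ := hT
  borelize (L1 n)
  refine Measurable.stronglyMeasurable (measurable_of_isOpen fun U hU => ?_)
  refine measurableSet_of_cover hA hcov fun k ω hω => ?_
  have hfin : bvNorm h ≠ ∞ := (bvNorm_lt_top_iff.2 hh).ne
  have h1 : Tendsto (fun ω' => bvOpNorm (T ω' - T ω) * bvNorm h) (𝓝[A k] ω) (𝓝 0) := by
    have := ENNReal.Tendsto.mul_const (hcont k ω hω.1) (b := bvNorm h) (Or.inr hfin)
    rwa [zero_mul] at this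
  have h2 : Tendsto (fun ω' => T ω' h) (𝓝[A k] ω) (𝓝 (T ω h)) := by
    rw [tendsto_iff_edist_tendsto_0]
    refine tendsto_of_tendsto_of_tendsto_of_le_of_le tendsto_const_nhds h1
      (fun _ => zero_le) fun ω' => ?_
    rw [edist_eq_enorm_sub]
    refine (enorm_le_bvNorm _).trans ?_
    exact bvNorm_apply_le (T := T ω' - T ω) (fun a h => by
      simp only [Pi.sub_apply, hsmul, smul_sub]) hh
  exact h2.eventually (hU.mem_nhds hω.2)

/-- P-continuity gives this only for h of bounded variation; density of BV and continuity of each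
operator on L¹ give the rest. -/
theorem stronglyMeasurable_transfer_apply {f : Ω → Cube n → Cube n}
    (hf : ∀ ω, Nonsingular (f ω)) (hT : PContinuous fun ω => transfer (f ω)) (h : L1 n) :
    StronglyMeasurable fun ω => transfer (f ω) h := by
  obtain ⟨u, hu, hlim⟩ := mem_closure_iff_seq_limit.1 (dense_isBV h)
  refine stronglyMeasurable_of_tendsto atTop
    (fun k => stronglyMeasurable_apply_of_isBV hT (fun ω a h => transfer_smul (hf ω) a h) (hu k))
    (tendsto_pi_nhds.2 fun ω => ?_)
  exact ((transferCLM (f ω) (hf ω)).continuous.tendsto h).comp hlim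

theorem stronglyMeasurable_transfer_comp {Ω : Type*} [MeasurableSpace Ω] {T : Ω → L1 n →L[ℝ] L1 n}
    (hT : ∀ h, StronglyMeasurable fun ω => T ω h) {u : Ω → L1 n} (hu : StronglyMeasurable u) :
    StronglyMeasurable fun ω => T ω (u ω) := by
  borelize (L1 n)
  have h1 : StronglyMeasurable (Function.uncurry fun (h : L1 n) (ω : Ω) => T ω h) :=
    stronglyMeasurable_uncurry_of_continuous_of_stronglyMeasurable
      (fun ω => (T ω).continuous) hT
  exact h1.comp_measurable (hu.measurable.prodMk measurable_id)

/-- By lower semicontinuity of the variation the condition is closed in h, so a countable dense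
subset of H decides it. -/
theorem measurableSet_forall_totalVariation_le {Ω : Type*} [MeasurableSpace Ω]
    {T : Ω → L1 n →L[ℝ] L1 n} (hT : ∀ h, StronglyMeasurable fun ω => T ω h) (H : Set (L1 n))
    {r : Ω → ℝ≥0∞} (hr : Measurable r) :
    MeasurableSet {ω | ∀ h ∈ H, totalVariation (T ω h) ≤ r ω} := by
  borelize (L1 n)
  obtain ⟨D, hDH, hDc, hHD⟩ :=
    (TopologicalSpace.IsSeparable.of_separableSpace H).exists_countable_dense_subset
  have h1 : {ω | ∀ h ∈ H, totalVariation (T ω h) ≤ r ω} =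
      ⋂ h ∈ D, {ω | totalVariation (T ω h) ≤ r ω} := by
    ext ω
    simp only [Set.mem_iInter, Set.mem_ofPred_eq]
    refine ⟨fun h u hu => h u (hDH hu), fun h u hu => ?_⟩
    have hcl : IsClosed {u : L1 n | totalVariation (T ω u) ≤ r ω} :=
      (lowerSemicontinuous_totalVariation.isClosed_preimage (r ω)).preimage (T ω).continuous
    exact closure_minimal (fun u hu => h u hu) hcl (hHD hu)
  rw [h1]
  exact MeasurableSet.biInter hDc fun h _ => measurableSet_le
    (lowerSemicontinuous_totalVariation.measurable.comp (hT h).measurable) hr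

end Measurability

/-! ### Cocycles of maps and of transfer operators -/

section Cocycle

variable {Ω : Type*} {n : ℕ}

/-- The operators `L (T ω) ∘ L (T² ω) ∘ ... ∘ L (Tᵏ ω)`. -/
def cocycle {E : Type*} [NormedAddCommGroup E] [NormedSpace ℝ E] (T : Ω → Ω)
    (L : Ω → E →L[ℝ] E) : ℕ → Ω → E →L[ℝ] E
  | 0, _ => ContinuousLinearMap.id ℝ E
  | k + 1, ω => (L (T ω)).comp (cocycle T L k (T ω))

theorem cocycle_add {E : Type*} [NormedAddCommGroup E] [NormedSpace ℝ E] (T : Ω → Ω)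
    (L : Ω → E →L[ℝ] E) (N k : ℕ) (ω : Ω) (h : E) :
    cocycle T L (k + N) ω h = cocycle T L N ω (cocycle T L k (T^[N] ω) h) := by
  induction N generalizing ω with
  | zero => rfl
  | succ N ih => exact congrArg (L (T ω)) (ih (T ω))

/-- The maps `f (T ω) ∘ f (T² ω) ∘ ... ∘ f (Tᵏ ω)`. -/
def mapCocycle (T : Ω → Ω) (f : Ω → Cube n → Cube n) : ℕ → Ω → Cube n → Cube n
  | 0, _ => id
  | k + 1, ω => f (T ω) ∘ mapCocycle T f k (T ω)

theorem transfer_id (h : L1 n) : transfer id h = h :=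
  (eq_transfer_of_setIntegral (Measure.QuasiMeasurePreserving.id _) fun _ _ => rfl).symm

theorem transfer_comp {f g : Cube n → Cube n} (hf : Nonsingular f) (hg : Nonsingular g)
    (h : L1 n) : transfer (f ∘ g) h = transfer f (transfer g h) := by
  refine (eq_transfer_of_setIntegral (Measure.QuasiMeasurePreserving.comp hf hg)
    fun A hA => ?_).symm
  rw [setIntegral_transfer hf _ hA, setIntegral_transfer hg _ (hf.measurable hA)]
  rfl

theorem nonsingular_mapCocycle {T : Ω → Ω} {f : Ω → Cube n → Cube n}
    (hf : ∀ ω, Nonsingular (f ω)) (k : ℕ) (ω : Ω) : Nonsingular (mapCocycle T f k ω) := by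
  induction k generalizing ω with
  | zero => exact Measure.QuasiMeasurePreserving.id _
  | succ k ih => exact Measure.QuasiMeasurePreserving.comp (hf (T ω)) (ih (T ω))

theorem transfer_mapCocycle {T : Ω → Ω} {f : Ω → Cube n → Cube n}
    (hf : ∀ ω, Nonsingular (f ω)) (k : ℕ) (ω : Ω) (h : L1 n) :
    transfer (mapCocycle T f k ω) h =
      cocycle T (fun ω => transferCLM (f ω) (hf ω)) k ω h := by
  induction k generalizing ω with
  | zero => exact transfer_id h
  | succ k ih =>
    rw [mapCocycle, transfer_comp (hf _) (nonsingular_mapCocycle hf k _), ih]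
    rfl

theorem pullback_eq_cocycle [MeasurableSpace Ω] (σ : Ω ≃ᵐ Ω) {f : Ω → Cube n → Cube n}
    (hf : ∀ ω, Nonsingular (f ω)) (k : ℕ) (ω : Ω) :
    pullback σ f k ω = cocycle σ.symm (fun ω => transferCLM (f ω) (hf ω)) k ω
      (Lp.const 1 volume (1 : ℝ)) := by
  induction k generalizing ω with
  | zero => rfl
  | succ k ih => exact congrArg (transfer (f (σ.symm ω))) (ih (σ.symm ω))

theorem pullback_eq_skew [MeasurableSpace Ω] (σ : Ω ≃ᵐ Ω) {f : Ω → Cube n → Cube n}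
    (hf : ∀ ω, Nonsingular (f ω)) (k : ℕ) (ω : Ω) :
    pullback σ f k ω = (skew σ (fun ω => transferCLM (f ω) (hf ω)) ^ k)
      (fun _ => Lp.const 1 volume (1 : ℝ)) ω := by
  induction k generalizing ω with
  | zero => rfl
  | succ k ih =>
    rw [pow_succ', Module.End.mul_apply, skew_apply, ← ih]
    rfl

theorem pullback_nonneg [MeasurableSpace Ω] (σ : Ω ≃ᵐ Ω) {f : Ω → Cube n → Cube n}
    (hf : ∀ ω, Nonsingular (f ω)) (k : ℕ) (ω : Ω) : 0 ≤ pullback σ f k ω := by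
  induction k generalizing ω with
  | zero =>
    rw [pullback, ← Lp.coeFn_nonneg]
    filter_upwards [Lp.coeFn_const 1 (volume : Measure (Cube n)) (1 : ℝ)] with x hx
    rw [hx]
    exact zero_le_one
  | succ k ih => exact transfer_nonneg (hf _) (ih _)

theorem norm_pullback [MeasurableSpace Ω] (σ : Ω ≃ᵐ Ω) {f : Ω → Cube n → Cube n}
    (hf : ∀ ω, Nonsingular (f ω)) (k : ℕ) (ω : Ω) : ‖pullback σ f k ω‖ = 1 := by
  induction k generalizing ω with
  | zero =>
    rw [norm_eq_integral_of_nonneg (pullback_nonneg σ hf 0 ω), pullback,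
      integral_congr_ae (Lp.coeFn_const 1 (volume : Measure (Cube n)) (1 : ℝ))]
    simp
  | succ k ih =>
    rw [← ih (σ.symm ω)]
    exact norm_transfer_of_nonneg (hf _) (pullback_nonneg σ hf k _)

theorem stronglyMeasurable_cocycle [MeasurableSpace Ω] {T : Ω → Ω} (hT : Measurable T)
    {L : Ω → L1 n →L[ℝ] L1 n} (hL : ∀ h, StronglyMeasurable fun ω => L ω h) (k : ℕ) (h : L1 n) :
    StronglyMeasurable fun ω => cocycle T L k ω h := by
  induction k with
  | zero => exact stronglyMeasurable_const
  | succ k ih => exact (stronglyMeasurable_transfer_comp hL ih).comp_measurable hT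

/-- Operator norms multiply, so their logarithms add up. The value of b at T^k ω belongs to the
operator at T^(k+1) ω, because the cocycle at ω starts with the operator at T ω. -/
theorem bvNorm_cocycle_le {T : Ω → Ω} {f : Ω → Cube n → Cube n}
    (hf : ∀ ω, Nonsingular (f ω)) {b : Ω → ℝ} {ω : Ω}
    (hb : ∀ k, bvOpNorm (transfer (f (T^[k + 1] ω))) ≤ ENNReal.ofReal (Real.exp (b (T^[k] ω))))
    (N : ℕ) {h : L1 n} (hh : IsBV h) :
    bvNorm (cocycle T (fun ω => transferCLM (f ω) (hf ω)) N ω h) ≤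
      ENNReal.ofReal (Real.exp (birkhoffSum T b N ω)) * bvNorm h := by
  induction N generalizing ω with
  | zero => simp [cocycle]
  | succ N ih =>
    have h1 := ih (ω := T ω) fun k => hb (k + 1)
    have h2 : IsBV (cocycle T (fun ω => transferCLM (f ω) (hf ω)) N (T ω) h) :=
      bvNorm_lt_top_iff.1 (h1.trans_lt (ENNReal.mul_lt_top ENNReal.ofReal_lt_top
        (bvNorm_lt_top_iff.2 hh)))
    refine (bvNorm_apply_le (T := transfer (f (T ω)))
      (fun a h => transfer_smul (hf _) a h) h2).trans ?_
    rw [birkhoffSum_succ', Real.exp_add, ENNReal.ofReal_mul (Real.exp_nonneg _), mul_assoc]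
    exact mul_le_mul' (hb 0) h1

namespace ExpandingBranches

/-- The branches of the identity. -/
def refl : ExpandingBranches (fun _ => 1) (id : Cube n → Cube n) where
  ι := Unit
  fintype := inferInstance
  label _ := ()
  S _ _ := Set.univ
  ordConnected _ _ := Set.ordConnected_univ
  label_eq_iff x s := by simp
  φ _ _ t := t
  φ' _ _ _ := 1
  M := 1
  map_eq _ _ := rfl
  hasDerivAt _ _ t := hasDerivAt_id t
  expand _ _ _ := by simp
  bound _ _ _ := by simp
  lipschitz _ _ t t' := by simp

/-- The expansion bounds may be decreased. -/
def weaken {γ γ' : Fin (n + 1) → ℝ} {f : Cube n → Cube n} (E : ExpandingBranches γ f)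
    (h : ∀ i, γ' i ≤ γ i) : ExpandingBranches γ' f where
  ι := E.ι
  fintype := E.fintype
  label := E.label
  S := E.S
  ordConnected := E.ordConnected
  label_eq_iff := E.label_eq_iff
  φ := E.φ
  φ' := E.φ'
  M := E.M
  map_eq := E.map_eq
  hasDerivAt := E.hasDerivAt
  expand s i t := (h i).trans (E.expand s i t)
  bound := E.bound
  lipschitz := E.lipschitz

/-- Expansion rates multiply under composition. With one rate common to all directions, their
logarithms form a single Birkhoff sum. -/
theorem nonempty_mapCocycle {T : Ω → Ω} {f : Ω → Cube n → Cube n} {g : Ω → ℝ} {ω : Ω}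
    (hE : ∀ k, Nonempty (ExpandingBranches (fun _ => Real.exp (g (T^[k] ω))) (f (T^[k + 1] ω))))
    (N : ℕ) : Nonempty (ExpandingBranches (fun _ => Real.exp (birkhoffSum T g N ω))
      (mapCocycle T f N ω)) := by
  induction N generalizing ω with
  | zero => exact ⟨refl.weaken fun i => by simp⟩
  | succ N ih =>
    obtain ⟨E₁⟩ := ih (ω := T ω) fun k => hE (k + 1)
    obtain ⟨E₂⟩ := hE 0
    exact ⟨(comp (fun _ => Real.exp_pos _) E₂ E₁).weaken fun i => by
      rw [birkhoffSum_succ', Real.exp_add]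
      rfl⟩

theorem exists_totalVariation_transfer_le {c : ℝ} {f : Cube n → Cube n}
    (E : ExpandingBranches (fun _ => c) f) (hc : 0 < c) (hf : Nonsingular f) :
    ∃ K : ℝ, ∀ h : L1 n, ‖h‖ ≤ 1 → totalVariation (transfer f h) ≤
      ENNReal.ofReal (8 / c) * totalVariation h + ENNReal.ofReal K := by
  choose K hK0 hK using fun i => E.exists_testVar_transfer_le hf i hc
  refine ⟨∑ i, K i, fun h hh => totalVariation_le_iff.2 fun i => (hK i h).trans ?_⟩
  gcongr
  · exact testVar_le_totalVariation i h
  · calc K i * ‖h‖ ≤ K i * 1 := mul_le_mul_of_nonneg_left hh (hK0 i)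
      _ = K i := mul_one _
      _ ≤ ∑ i, K i := Finset.single_le_sum (fun i _ => hK0 i) (Finset.mem_univ i)

end ExpandingBranches

end Cocycle

/-! ### Bounded variation of the pulled-back iterates -/

section Pullback

variable {n : ℕ}

theorem le_ofReal_exp_of_log_toENNReal_lt_top {x : ℝ≥0∞} (hx : (ENNReal.log x).toENNReal < ∞) :
    x ≤ ENNReal.ofReal (Real.exp (ENNReal.log x).toENNReal.toReal) := by
  have h1 : ENNReal.log x ≤ (((ENNReal.log x).toENNReal.toReal : ℝ) : EReal) := by
    rw [EReal.coe_ennreal_toReal hx.ne, EReal.coe_toENNReal_eq_max]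
    exact le_max_right _ _
  have h2 := EReal.exp_monotone h1
  rwa [ENNReal.exp_log, EReal.exp_coe] at h2

/-- An application of `ae_exists_bound_of_recursion` along σ⁻¹. The crude bound comes from the
operator norms on BV, the contracting one from the Lasota-Yorke inequality for the composition of N
maps, with a = log 8. -/
theorem ae_exists_totalVariation_pullback_le {Ω : Type*} [TopologicalSpace Ω] [MeasurableSpace Ω]
    [BorelSpace Ω] {P : Measure Ω} [IsProbabilityMeasure P] {σ : Ω ≃ᵐ Ω} (hσ : Ergodic σ P)
    {f : Ω → Cube n → Cube n} (hf : IsAdmissible P f) (hlog : LogIntegrable P f) :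
    ∀ᵐ ω ∂P, ∃ C : ℝ≥0∞, C ≠ ∞ ∧ ∀ k, totalVariation (pullback σ f k ω) ≤ C := by
  have hns := hf.nonsingular
  obtain ⟨G, φ, γ, hJ, hγ, hpos, hint, hlt⟩ := hf.expanding
  have hT : Ergodic σ.symm P := hσ.symm
  have hmp := hT.toMeasurePreserving
  set T : Ω → Ω := ⇑σ.symm with hTdef
  set L : Ω → L1 n →L[ℝ] L1 n := fun ω => transferCLM (f ω) (hns ω) with hL
  have hLm : ∀ h, StronglyMeasurable fun ω => L ω h := fun h =>
    stronglyMeasurable_transfer_apply hns hf.pContinuous h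
  set g₀ : Ω → ℝ := fun ω => ⨅ i, Real.log (minExpansion G (φ ω) i) with hg₀
  -- A measurable version, since the sets `D M` below have to be measurable.
  set g₁ : Ω → ℝ := hint.aestronglyMeasurable.mk g₀ with hg₁
  have hg₁m : Measurable g₁ := hint.aestronglyMeasurable.stronglyMeasurable_mk.measurable
  have hg₀₁ : g₀ =ᵐ[P] g₁ := hint.aestronglyMeasurable.ae_eq_mk
  have hg₁i : Integrable g₁ P := hint.congr hg₀₁
  -- Shifted by T, as is b, because the cocycle at ω starts at T ω.
  set g : Ω → ℝ := fun ω => g₁ (T ω) with hg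
  have hgi : Integrable g P := hmp.integrable_comp_of_integrable hg₁i
  have hgm : Measurable g := hg₁m.comp hmp.measurable
  have hgpos : 0 < ∫ ω, g ω ∂P := by
    rw [integral_comp_eq_of_measurePreserving hmp hg₁i.aestronglyMeasurable,
      ← integral_congr_ae hg₀₁]
    exact hγ.trans hlt
  set b₀ : Ω → ℝ≥0∞ := fun ω => (ENNReal.log (bvOpNorm (transfer (f ω)))).toENNReal with hb₀
  have hb₀m : Measurable b₀ :=
    (ENNReal.measurable_log.comp (measurable_bvOpNorm hf.pContinuous)).ereal_toENNReal
  have hb₀i : Integrable (fun ω => (b₀ ω).toReal) P :=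
    integrable_toReal_of_lintegral_ne_top hb₀m.aemeasurable hlog.ne
  set b : Ω → ℝ := fun ω => (b₀ (T ω)).toReal with hb
  have hbi : Integrable b P := hmp.integrable_comp_of_integrable hb₀i
  have hgood : ∀ᵐ ω ∂P, (∀ i, 0 < minExpansion G (φ ω) i) ∧ g₀ ω = g₁ ω ∧ b₀ ω < ∞ := by
    filter_upwards [hpos, hg₀₁, ae_lt_top hb₀m hlog.ne] with ω h1 h2 h3
    exact ⟨h1, h2, h3⟩
  have hgoods := ae_forall_iterate hmp hgood
  have hstep : ∀ N k ω, pullback σ f (k + N) ω =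
      cocycle T L N ω (pullback σ f k (T^[N] ω)) := by
    intro N k ω
    rw [pullback_eq_cocycle σ hns, pullback_eq_cocycle σ hns, cocycle_add]
  refine ae_exists_bound_of_recursion hT (v := fun k ω => totalVariation (pullback σ f k ω))
    hgi hgpos hbi (fun ω => ENNReal.toReal_nonneg) (a := Real.log 8)
    (fun ω => totalVariation_const 1) ?_ fun N => ?_
  · filter_upwards [hgoods] with ω hω N k
    rw [hstep]
    by_cases hBV : IsBV (pullback σ f k (T^[N] ω))
    · refine (totalVariation_le_bvNorm _).trans ((bvNorm_cocycle_le hns (b := b)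
        (fun j => ?_) N hBV).trans_eq ?_)
      · rw [Function.iterate_succ_apply']
        have := (hω (j + 1)).2.2
        rw [Function.iterate_succ_apply'] at this
        exact le_ofReal_exp_of_log_toENNReal_lt_top this
      · rw [bvNorm, ← ofReal_norm, norm_pullback σ hns, ENNReal.ofReal_one, add_comm]
    · have h1 : totalVariation (pullback σ f k (T^[N] ω)) = ∞ := by
        rwa [IsBV, not_lt, top_le_iff] at hBV
      rw [h1, top_add, ENNReal.mul_top]
      · exact le_top
      · exact (ENNReal.ofReal_pos.2 (Real.exp_pos _)).ne'
  · set A : Ω → ℝ≥0∞ := fun ω =>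
      ENNReal.ofReal (Real.exp (Real.log 8 - birkhoffSum T g N ω)) with hA
    have hSm : Measurable (birkhoffSum T g N) :=
      Finset.measurable_fun_sum _ fun j _ => hgm.comp (hmp.measurable.iterate j)
    have hAm : Measurable A :=
      (Real.measurable_exp.comp (measurable_const.sub hSm)).ennreal_ofReal
    have hA0 : ∀ ω, A ω ≠ 0 := fun ω => (ENNReal.ofReal_pos.2 (Real.exp_pos _)).ne'
    -- The Lasota-Yorke constant K of the composition comes without measurability in ω. Rounding the
    -- bound on the variation of h up to an integer j replaces "K is at most M" by countably many
    -- conditions over fixed sets of h, each of them measurable.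
    set D : ℕ → Set Ω := fun M => (⋂ j : ℕ, {ω | ∀ h ∈ {h : L1 n | ‖h‖ ≤ 1 ∧
      totalVariation h ≤ j}, totalVariation (cocycle T L N ω h) ≤ A ω * j + M}) ∩
      {ω | A ω ≤ M} with hD
    have hDm : ∀ M, MeasurableSet (D M) := fun M =>
      (MeasurableSet.iInter fun j => measurableSet_forall_totalVariation_le
        (fun h => stronglyMeasurable_cocycle hmp.measurable hLm N h) _
        ((hAm.mul_const _).add_const _)).inter (measurableSet_le hAm measurable_const)
    -- One M is the additive constant; the other bounds `A ω`, the price of rounding the variation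
    -- up by at most 1.
    refine ⟨fun M => (D M)ᶜ, fun M => 2 * M, fun M => (hDm M).compl, ?_, fun M => ?_⟩
    · filter_upwards [hgoods] with ω hω
      obtain ⟨E⟩ := ExpandingBranches.nonempty_mapCocycle (T := T) (f := f) (g := g) (ω := ω)
        (fun k => by
          rw [Function.iterate_succ_apply']
          have h1 := hω (k + 1)
          rw [Function.iterate_succ_apply'] at h1
          obtain ⟨E⟩ := (hJ (T (T^[k] ω))).nonempty_expandingBranches
          refine ⟨E.weaken fun i => ?_⟩
          have h2 : g (T^[k] ω) ≤ Real.log (minExpansion G (φ (T (T^[k] ω))) i) := by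
            simp only [hg]
            rw [← h1.2.1]
            exact ciInf_le (Set.finite_range _).bddBelow i
          calc Real.exp (g (T^[k] ω)) ≤ Real.exp (Real.log (minExpansion G (φ (T (T^[k] ω))) i)) :=
                Real.exp_le_exp.2 h2
            _ = _ := Real.exp_log (h1.1 i)) N
      obtain ⟨K, hK⟩ := E.exists_totalVariation_transfer_le (Real.exp_pos _)
        (nonsingular_mapCocycle hns N ω)
      have hAeq : ENNReal.ofReal (8 / Real.exp (birkhoffSum T g N ω)) = A ω := by
        simp only [hA]
        rw [Real.exp_sub, Real.exp_log (by norm_num)]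
      rw [hAeq] at hK
      obtain ⟨M₀, hM₀⟩ := exists_nat_ge (max K (A ω).toReal)
      filter_upwards [eventually_ge_atTop M₀] with M hM
      have hMr : max K (A ω).toReal ≤ M := hM₀.trans (by exact_mod_cast hM)
      rw [Set.notMem_compl_iff]
      refine ⟨Set.mem_iInter.2 fun j h hh => ?_, ?_⟩
      · have h1 := hK h hh.1
        rw [transfer_mapCocycle hns] at h1
        refine h1.trans (add_le_add ?_ ?_)
        · gcongr
          exact hh.2
        · rw [← ENNReal.ofReal_natCast]
          exact ENNReal.ofReal_le_ofReal ((le_max_left _ _).trans hMr)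
      · rw [Set.mem_ofPred_eq, ← ENNReal.ofReal_toReal (a := A ω) ENNReal.ofReal_ne_top,
          ← ENNReal.ofReal_natCast]
        exact ENNReal.ofReal_le_ofReal ((le_max_right _ _).trans hMr)
    · refine Eventually.of_forall fun ω hω k => ?_
      rw [Set.notMem_compl_iff] at hω
      rw [hstep]
      set u := pullback σ f k (T^[N] ω) with hu
      rcases eq_or_ne (totalVariation u) ∞ with htop | htop
      · rw [htop, ENNReal.mul_top (hA0 ω), top_add]
        exact le_top
      set j : ℕ := ⌈(totalVariation u).toReal⌉₊ with hj
      have h1 : totalVariation u ≤ j := by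
        rw [← ENNReal.ofReal_toReal htop, ← ENNReal.ofReal_natCast]
        exact ENNReal.ofReal_le_ofReal (Nat.le_ceil _)
      have h2 : (j : ℝ≥0∞) ≤ totalVariation u + 1 := by
        rw [← ENNReal.ofReal_toReal htop, ← ENNReal.ofReal_natCast, ← ENNReal.ofReal_one,
          ← ENNReal.ofReal_add ENNReal.toReal_nonneg zero_le_one]
        exact ENNReal.ofReal_le_ofReal (Nat.ceil_lt_add_one ENNReal.toReal_nonneg).le
      have h3 := Set.mem_iInter.1 hω.1 j u ⟨(norm_pullback σ hns k _).le, h1⟩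
      have h4 : A ω ≤ M := hω.2
      calc totalVariation (cocycle T L N ω u) ≤ A ω * j + M := h3
        _ ≤ A ω * (totalVariation u + 1) + M := by gcongr
        _ = A ω * totalVariation u + (A ω + M) := by ring
        _ ≤ A ω * totalVariation u + ((2 * M : ℕ) : ℝ≥0∞) := by
          gcongr
          push_cast
          rw [two_mul]
          gcongr

end Pullback

/-! ### Compactness and densities -/

section Density

variable {n : ℕ}

/-- The functions of norm at most `1` and variation at most `C`. -/
def bvBall (n : ℕ) (C : ℝ) : Set (L1 n) := {h | ‖h‖ ≤ 1 ∧ ∀ i, testVar i h ≤ ENNReal.ofReal C}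

/-- Totally bounded by the grid estimate, and closed because the variation is lower semicontinuous.
-/
theorem isCompact_bvBall {C : ℝ} (hC : 0 ≤ C) : IsCompact (bvBall n C) := by
  refine isCompact_iff_totallyBounded_isComplete.2
    ⟨totallyBounded_testVar_le C hC, IsClosed.isComplete ?_⟩
  have h1 : bvBall n C = {h | ‖h‖ ≤ 1} ∩ ⋂ i, testVar i ⁻¹' Set.Iic (ENNReal.ofReal C) := by
    ext h
    simp [bvBall]
  rw [h1]
  exact (isClosed_le continuous_norm continuous_const).inter
    (isClosed_iInter fun i => (lowerSemicontinuous_testVar i).isClosed_preimage _)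

theorem convex_bvBall (C : ℝ) : Convex ℝ (bvBall n C) := by
  rintro x ⟨hx1, hx2⟩ y ⟨hy1, hy2⟩ a b ha hb hab
  refine ⟨?_, fun i => ?_⟩
  · refine (norm_add_le _ _).trans ?_
    rw [norm_smul, norm_smul, Real.norm_of_nonneg ha, Real.norm_of_nonneg hb]
    nlinarith
  · calc testVar i (a • x + b • y) ≤ testVar i (a • x) + testVar i (b • y) := testVar_add_le i _ _
      _ ≤ ENNReal.ofReal |a| * testVar i x + ENNReal.ofReal |b| * testVar i y :=
        add_le_add (testVar_smul_le i a x) (testVar_smul_le i b y)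
      _ ≤ ENNReal.ofReal a * ENNReal.ofReal C + ENNReal.ofReal b * ENNReal.ofReal C := by
        rw [abs_of_nonneg ha, abs_of_nonneg hb]
        gcongr
        · exact hx2 i
        · exact hy2 i
      _ = ENNReal.ofReal C := by
        rw [← add_mul, ← ENNReal.ofReal_add ha hb, hab, ENNReal.ofReal_one, one_mul]

theorem isBV_of_mem_bvBall {C : ℝ} {h : L1 n} (hh : h ∈ bvBall n C) : IsBV h :=
  (totalVariation_le_iff.2 hh.2).trans_lt ENNReal.ofReal_lt_top

/-- The probability densities. -/
def densities (n : ℕ) : Set (L1 n) := {h | 0 ≤ h ∧ ‖h‖ = 1}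

theorem isClosed_densities : IsClosed (densities n) := by
  have h1 : IsClosed {h : L1 n | 0 ≤ h} := isClosed_le continuous_const continuous_id
  have h2 : IsClosed {h : L1 n | ‖h‖ = 1} := isClosed_eq continuous_norm continuous_const
  rw [densities, Set.ofPred_and]
  exact h1.inter h2

/-- On nonnegative functions the norm is the integral, which is linear. -/
theorem convex_densities : Convex ℝ (densities n) := by
  rintro x ⟨hx1, hx2⟩ y ⟨hy1, hy2⟩ a b ha hb hab
  have hsmul : ∀ (c : ℝ) (u : L1 n), 0 ≤ c → 0 ≤ u → 0 ≤ c • u := fun c u hc hu => by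
    rw [← Lp.coeFn_nonneg] at hu ⊢
    filter_upwards [hu, Lp.coeFn_smul c u] with t ht hct
    rw [hct]
    exact mul_nonneg hc ht
  have h0 : 0 ≤ a • x + b • y := add_nonneg (hsmul a x ha hx1) (hsmul b y hb hy1)
  refine ⟨h0, ?_⟩
  have h1 := map_add (pairing (n := n) (fun _ => 1) measurable_const 1 (by simp)) (a • x) (b • y)
  rw [map_smul, map_smul] at h1
  simp only [pairing_apply, mul_one, smul_eq_mul] at h1
  rw [norm_eq_integral_of_nonneg hx1] at hx2
  rw [norm_eq_integral_of_nonneg hy1] at hy2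
  rw [norm_eq_integral_of_nonneg h0, h1, hx2, hy2, mul_one, mul_one, hab]

theorem cesaro_mem {Ω : Type*} [MeasurableSpace Ω] {σ : Ω ≃ᵐ Ω} {f : Ω → Cube n → Cube n} {ω : Ω}
    {K : Set (L1 n)} (hK : Convex ℝ K) (h : ∀ k, pullback σ f k ω ∈ K) {s : ℕ} (hs : 1 ≤ s) :
    cesaro σ f s ω ∈ K := by
  have hs0 : (s : ℝ) ≠ 0 := by
    have : s ≠ 0 := by omega
    exact_mod_cast this
  rw [cesaro, Finset.smul_sum]
  refine hK.sum_mem (fun k _ => by positivity) ?_ fun k _ => h k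
  simp [hs0]

/-- Convergence of the averages, with the bounds that the limit inherits. -/
theorem exists_limit_cesaro {Ω : Type*} [TopologicalSpace Ω] [MeasurableSpace Ω]
    [BorelSpace Ω] {P : Measure Ω} [IsProbabilityMeasure P] {σ : Ω ≃ᵐ Ω} (hσ : Ergodic σ P)
    {f : Ω → Cube n → Cube n} (hf : IsAdmissible P f) (hlog : LogIntegrable P f) :
    (∀ᵐ ω ∂P, IsCompact (closure ((fun s => cesaro σ f s ω) '' {s : ℕ | 1 ≤ s}))) ∧
    ∃ h : Ω → L1 n, (∀ᵐ ω ∂P, Tendsto (fun s => cesaro σ f s ω) atTop (𝓝 (h ω)) ∧ IsBV (h ω)) ∧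
      IsRandomInvariantDensity P σ f h := by
  have hns := hf.nonsingular
  set L : Ω → L1 n →L[ℝ] L1 n := fun ω => transferCLM (f ω) (hns ω) with hL
  have hLm : ∀ h, StronglyMeasurable fun ω => L ω h := fun h =>
    stronglyMeasurable_transfer_apply hns hf.pContinuous h
  have hball : ∀ᵐ ω ∂P, ∃ C : ℝ, 0 ≤ C ∧ ∀ k, pullback σ f k ω ∈ bvBall n C := by
    filter_upwards [ae_exists_totalVariation_pullback_le hσ hf hlog] with ω hω
    obtain ⟨C, hC, hle⟩ := hω
    refine ⟨C.toReal, ENNReal.toReal_nonneg, fun k => ⟨(norm_pullback σ hns k ω).le, ?_⟩⟩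
    rw [ENNReal.ofReal_toReal hC]
    exact totalVariation_le_iff.1 (hle k)
  have hdens : ∀ k ω, pullback σ f k ω ∈ densities n := fun k ω =>
    ⟨pullback_nonneg σ hns k ω, norm_pullback σ hns k ω⟩
  refine ⟨?_, ?_⟩
  · filter_upwards [hball] with ω hω
    obtain ⟨C, hC0, hC⟩ := hω
    refine (isCompact_bvBall hC0).closure_of_subset ?_
    rintro _ ⟨s, hs, rfl⟩
    exact cesaro_mem (convex_bvBall C) hC hs
  obtain ⟨h₀, hm, hlim, heq⟩ := exists_ae_tendsto_average hσ (L := L)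
    (u₀ := fun _ => Lp.const 1 volume (1 : ℝ)) (fun ω x => norm_transfer_le (hns ω) x)
    (fun k => by
      have h1 : (skew σ L ^ k) (fun _ => Lp.const 1 volume (1 : ℝ)) =
          fun ω => cocycle σ.symm L k ω (Lp.const 1 volume (1 : ℝ)) := by
        funext ω
        rw [← pullback_eq_skew σ hns, pullback_eq_cocycle σ hns]
      rw [h1]
      exact (stronglyMeasurable_cocycle σ.symm.measurable hLm k _).aestronglyMeasurable)
    (fun k ω => by rw [← pullback_eq_skew σ hns, norm_pullback σ hns])
    (by
      filter_upwards [hball] with ω hω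
      obtain ⟨C, hC0, hC⟩ := hω
      refine ⟨bvBall n C, isCompact_bvBall hC0, convex_bvBall C, fun k => ?_⟩
      rw [← pullback_eq_skew σ hns]
      exact hC k)
  have hlim' : ∀ᵐ ω ∂P, Tendsto (fun s => cesaro σ f s ω) atTop (𝓝 (h₀ ω)) := by
    filter_upwards [hlim] with ω hω
    refine hω.congr fun s => ?_
    simp only [cesaro, pullback_eq_skew σ hns]
    rfl
  -- The densities and the BV balls are convex and closed, so they contain the averages for s ≥ 1
  -- and then the limit.
  have hmem : ∀ᵐ ω ∂P, h₀ ω ∈ densities n ∧ IsBV (h₀ ω) := by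
    filter_upwards [hlim', hball] with ω hω hb
    obtain ⟨C, hC0, hC⟩ := hb
    have hev : ∀ᶠ s : ℕ in atTop, 1 ≤ s := eventually_ge_atTop 1
    exact ⟨isClosed_densities.mem_of_tendsto hω
        (hev.mono fun s hs => cesaro_mem convex_densities (fun k => hdens k ω) hs),
      isBV_of_mem_bvBall ((isCompact_bvBall hC0).isClosed.mem_of_tendsto hω
        (hev.mono fun s hs => cesaro_mem (convex_bvBall C) hC hs))⟩
  classical
  -- The constant density 1 replaces h₀ where the latter is not a density. This happens on a null
  -- set, which is measurable because the densities form a closed set.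
  set h : Ω → L1 n := fun ω => if h₀ ω ∈ densities n then h₀ ω else Lp.const 1 volume (1 : ℝ)
    with hh
  have hall : ∀ ω, h ω ∈ densities n := by
    intro ω
    by_cases hω : h₀ ω ∈ densities n
    · simp only [hh, if_pos hω, hω]
    · simp only [hh, if_neg hω]
      exact hdens 0 ω
  have hae : h =ᵐ[P] h₀ := hmem.mono fun ω hω => if_pos hω.1
  refine ⟨h, ?_, fun ω => (hall ω).1, fun ω => (hall ω).2, ?_, ?_⟩
  · filter_upwards [hlim', hmem, hae] with ω h1 h2 h3
    rw [h3]
    exact ⟨h1, h2.2⟩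
  · borelize (L1 n)
    exact StronglyMeasurable.ite (hm.measurable isClosed_densities.measurableSet) hm
      stronglyMeasurable_const
  · filter_upwards [heq, hae, hσ.toMeasurePreserving.quasiMeasurePreserving.ae hae]
      with ω h1 h2 h3
    rw [h2, h3]
    exact h1

end Density

end

end RandomJablonski

theorem theorem4p2 {Ω : Type*} [TopologicalSpace Ω] [PolishSpace Ω] [MeasurableSpace Ω]
    [BorelSpace Ω] (P : Measure Ω) [IsProbabilityMeasure P] (σ : Ω ≃ᵐ Ω) (hσ : Ergodic σ P)
    {n : ℕ} (f : Ω → RandomJablonski.Cube n → RandomJablonski.Cube n)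
    (hf : RandomJablonski.IsAdmissible P f) (hlog : RandomJablonski.LogIntegrable P f) :
    (∀ᵐ ω ∂P, IsCompact (closure
      ((fun s => RandomJablonski.cesaro σ f s ω) '' {s : ℕ | 1 ≤ s}))) ∧
    ∃ h : Ω → RandomJablonski.L1 n,
      (∀ᵐ ω ∂P, Tendsto (fun s => RandomJablonski.cesaro σ f s ω) atTop (𝓝 (h ω)) ∧
        RandomJablonski.IsBV (h ω)) ∧
      RandomJablonski.IsRandomInvariantDensity P σ f h := by
  exact RandomJablonski.exists_limit_cesaro hσ hf hlog
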